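/- Let $n\ge 2$ and let $T$ be one of (i) $[a,b]$ with $a<b$, (ii) $[a,\infty)$, (iii) $(-\infty,\infty)$ with $n$ even. Let $$K_n=\Bigl\{c\in\mathbb R^{n+1} : \sum_{j=0}^n c_jt^j\ge 0\ \text{ for all } t\in T\Bigr\}$$ and let $\partial K_n$ be its topological boundary. Put $\mathbb R_+=(0,\infty)$ and $\Delta_m=\{(\gamma_1,\dots,\gamma_m)\in(\mathrm{int}\,T)^m:\gamma_1<\dots<\gamma_m\}$, where $\Delta_0$ is a single point (the empty tuple). For $k\ge1$, $\alpha\in\mathbb R_+^2$ and $\gamma\in\Delta_{k-1}$ define $p_k(t)=p_k(t;\alpha,\gamma)$, empty products being $1$, as follows. (i) For $T=[a,b]$: $$p_{2m}=\alpha_1\prod_{j=1}^m(t-\gamma_{2j-1})^2+\alpha_2(t-a)(b-t)\prod_{j=1}^{m-1}(t-\gamma_{2j})^2,$$ $$p_{2m+1}=\alpha_1(t-a)\prod_{j=1}^m(t-\gamma_{2j})^2+\alpha_2(b-t)\prod_{j=1}^m(t-\gamma_{2j-1})^2.$$ (ii) For $T=[a,\infty)$: $$p_{2m}=\alpha_1\prod_{j=1}^m(t-\gamma_{2j-1})^2+\alpha_2(t-a)\prod_{j=1}^{m-1}(t-\gamma_{2j})^2,$$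 $$p_{2m+1}=\alpha_1(t-a)\prod_{j=1}^m(t-\gamma_{2j})^2+\alpha_2\prod_{j=1}^m(t-\gamma_{2j-1})^2.$$ (iii) For $T=(-\infty,\infty)$ (even index only): $$p_{2m}=\alpha_1\prod_{j=1}^m(t-\gamma_{2j-1})^2+\alpha_2\prod_{j=1}^{m-1}(t-\gamma_{2j})^2.$$ For $k\le n$ let $\varphi_k(\alpha,\gamma)\in\mathbb R^{n+1}$ be the vector of coefficients of $1,t,\dots,t^n$ in $p_k(t;\alpha,\gamma)$. For $i\in\{1,2\}$ with $n-i\ge1$ let $\varphi_n^{(i)}(\alpha,\gamma,\tilde\gamma)\in\mathbb R^{n+1}$, $\gamma\in\Delta_{n-1-i}$, be the coefficient vector of $(t-\tilde\gamma)^i\,p_{n-i}(t;\alpha,\gamma)$. For $n=2$ let $\varphi_2^{(2)}(\alpha_1,\tilde\gamma)\in\mathbb R^3$ be the coefficient vector of $\alpha_1(t-\tilde\gamma)^2$, $\alpha_1\in\mathbb R_+$. Let $S$ be either $\mathrm{int}\,T$ or $T$, and put $$D=\begin{cases}\varphi_n^{(2)}\bigl(\mathbb R_+^2\times\Delta_{n-3}\times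 S\bigr)&(n\ge3),\\ \varphi_2^{(2)}(\mathbb R_+\times S)&(n=2).\end{cases}$$ Then, up to sets of $n$-dimensional Hausdorff measure zero, $$\partial K_n=\begin{cases} D\ \sqcup\ \varphi_n^{(1)}(\mathbb R_+^2\times\Delta_{n-2},a)\ \sqcup\ \bigl\{-\varphi_n^{(1)}(\mathbb R_+^2\times\Delta_{n-2},b)\bigr\}&\text{(i) } T=[a,b],\\ D\ \sqcup\ \varphi_n^{(1)}(\mathbb R_+^2\times\Delta_{n-2},a)\ \sqcup\ \varphi_{n-1}(\mathbb R_+^2\times\Delta_{n-2})&\text{(ii) } T=[a,\infty),\\ D&\text{(iii) } T=(-\infty,\infty),\ n\text{ even}, \end{cases}$$ where $\sqcup$ denotes a union of pairwise disjoint sets. Moreover each of the maps $\varphi_n$ on $\mathbb R_+^2\times\Delta_{n-1}$, $\varphi_n^{(2)}$ on the parameter set of $D$, $\varphi_n^{(1)}(\cdot,a)$ (cases (i), (ii)) and $\varphi_n^{(1)}(\cdot,b)$ (case (i)) on $\mathbb R_+^2\times\Delta_{n-2}$, and $\varphi_{n-1}$ on $\mathbb R_+^2\times\Delta_{n-2}$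 (case (ii)), is a diffeomorphism onto its image. Here a map between subsets of Euclidean spaces is called smooth if near every point of its domain it extends to a $C^\infty$ map on an open subset of the ambient space, and a diffeomorphism is a smooth bijection with smooth inverse. -/

import Mathlib

open Set Filter MeasureTheory Polynomial
open scoped ContDiff Topology

noncomputable section

namespace PosPoly

/-- Coefficient space `ℝ^{n+1}`, with its Euclidean metric. -/
abbrev Coeffs (n : ℕ) : Type := EuclideanSpace ℝ (Fin (n + 1))

/-- The coefficient vector `(c_0, …, c_n)` of a polynomial of degree at most `n`. -/
def coeffVec (n : ℕ) (p : ℝ[X]) : Coeffs n :=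
  WithLp.toLp 2 (fun j : Fin (n + 1) => p.coeff (j : ℕ))

/-- The cone `K_n` of (coefficient vectors of) polynomials of degree at most `n` which are
nonnegative on `T`. -/
def posCone (T : Set ℝ) (n : ℕ) : Set (Coeffs n) :=
  {c | ∀ t ∈ T, 0 ≤ ∑ j : Fin (n + 1), c j * t ^ (j : ℕ)}

/-- `Δ_m(T)`: strictly increasing `m`-tuples of points of the interior of `T`
(a single point, the empty tuple, when `m = 0`). -/
def Delta (T : Set ℝ) (m : ℕ) : Set (Fin m → ℝ) :=
  {τ | (∀ i, τ i ∈ interior T) ∧ StrictMono τ}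

/-- `ℝ_+^2` with `ℝ_+ = (0, ∞)`. -/
def posQuadrant : Set (ℝ × ℝ) := Ioi 0 ×ˢ Ioi 0

/-- `∏_j (t - γ_{2j-1})^2`, the product over the odd places of `γ_1, …, γ_m`; the entry `γ_k` is
`γ (k - 1)` here, so these are the even values of the index. -/
def oddProd {m : ℕ} (γ : Fin m → ℝ) : ℝ[X] :=
  ∏ j ∈ Finset.univ.filter (fun j : Fin m => Even (j : ℕ)), (X - C (γ j)) ^ 2

/-- `∏_j (t - γ_{2j})^2`, the product over the even places of `γ_1, …, γ_m`. -/
def evenProd {m : ℕ} (γ : Fin m → ℝ) : ℝ[X] :=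
  ∏ j ∈ Finset.univ.filter (fun j : Fin m => Odd (j : ℕ)), (X - C (γ j)) ^ 2

/-- The type of a family of polynomials `p_k(t; α, γ)` with `α ∈ ℝ²` and `γ ∈ ℝ^{k-1}`. -/
abbrev PolyFamily : Type := (k : ℕ) → ℝ × ℝ → (Fin (k - 1) → ℝ) → ℝ[X]

/-- `p_k(t; α, γ)` for `T = [a, b]`. -/
def pIcc (a b : ℝ) : PolyFamily := fun k α γ =>
  if Even k then C α.1 * oddProd γ + C α.2 * ((X - C a) * (C b - X)) * evenProd γ
  else C α.1 * (X - C a) * evenProd γ + C α.2 * (C b - X) * oddProd γ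

/-- `p_k(t; α, γ)` for `T = [a, ∞)`. -/
def pIci (a : ℝ) : PolyFamily := fun k α γ =>
  if Even k then C α.1 * oddProd γ + C α.2 * (X - C a) * evenProd γ
  else C α.1 * (X - C a) * evenProd γ + C α.2 * oddProd γ

/-- `p_k(t; α, γ)` for `T = (-∞, ∞)`, where it is used for even `k` only. -/
def pUniv : PolyFamily := fun _ α γ => C α.1 * oddProd γ + C α.2 * evenProd γ

/-- `φ_k(α, γ)`: the coefficient vector of `p_k(t; α, γ)`, as a vector of `ℝ^{n+1}`
(for `k < n` the coefficients of `t^{k+1}, …, t^n` are zero). -/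
def phi (p : PolyFamily) (n k : ℕ) (x : (ℝ × ℝ) × (Fin (k - 1) → ℝ)) : Coeffs n :=
  coeffVec n (p k x.1 x.2)

/-- `φ_n^{(i)}(α, γ, γ')`: the coefficient vector of `(t - γ')^i p_{n-i}(t; α, γ)`. -/
def phiRoot (p : PolyFamily) (n i : ℕ)
    (x : (ℝ × ℝ) × (Fin (n - i - 1) → ℝ)) (γ' : ℝ) : Coeffs n :=
  coeffVec n ((X - C γ') ^ i * p (n - i) x.1 x.2)

/-- `φ_2^{(2)}(α₁, γ')`: the coefficient vector of `(t - γ')^2 α₁`; used for `n = 2`. -/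
def phiSq (n : ℕ) (x : ℝ × ℝ) : Coeffs n :=
  coeffVec n ((X - C x.2) ^ 2 * C x.1)

/-- The parameter set `ℝ_+^2 × Δ_{k-1}(T)` of `φ_k`. -/
def dom (T : Set ℝ) (k : ℕ) : Set ((ℝ × ℝ) × (Fin (k - 1) → ℝ)) :=
  posQuadrant ×ˢ Delta T (k - 1)

/-- `φ_n^{(2)}(ℝ_+^2 × Δ_{n-3} × S)` if `n ≠ 2`, and `φ_2^{(2)}(ℝ_+ × S)` if `n = 2`:
polynomials with a double root in `S`. -/
def doubleRootPiece (p : PolyFamily) (T S : Set ℝ) (n : ℕ) : Set (Coeffs n) :=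
  if n = 2 then phiSq n '' (Ioi 0 ×ˢ S)
  else (fun y : ((ℝ × ℝ) × (Fin (n - 2 - 1) → ℝ)) × ℝ => phiRoot p n 2 y.1 y.2) ''
    (dom T (n - 2) ×ˢ S)

/-- `φ_n^{(1)}(ℝ_+^2 × Δ_{n-2}, a)`: polynomials `(t - a) p_{n-1}`. -/
def leftPiece (p : PolyFamily) (T : Set ℝ) (a : ℝ) (n : ℕ) : Set (Coeffs n) :=
  (fun x => phiRoot p n 1 x a) '' dom T (n - 1)

/-- `-φ_n^{(1)}(ℝ_+^2 × Δ_{n-2}, b)`: polynomials `(b - t) p_{n-1}`. -/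
def rightPiece (p : PolyFamily) (T : Set ℝ) (b : ℝ) (n : ℕ) : Set (Coeffs n) :=
  (fun x => -phiRoot p n 1 x b) '' dom T (n - 1)

/-- `φ_{n-1}(ℝ_+^2 × Δ_{n-2})`, in `ℝ^{n+1}`: polynomials `p_{n-1}`. -/
def lowDegreePiece (p : PolyFamily) (T : Set ℝ) (n : ℕ) : Set (Coeffs n) :=
  phi p n (n - 1) '' dom T (n - 1)

/-- Smoothness of a map on an arbitrary subset of a normed space: near each point of the subset,
the map agrees on the subset with a smooth map defined on a neighbourhood in the whole space. -/
def SmoothOnSubset {E F : Type*} [NormedAddCommGroup E] [NormedSpace ℝ E]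
    [NormedAddCommGroup F] [NormedSpace ℝ F] (f : E → F) (s : Set E) : Prop :=
  ∀ x ∈ s, ∃ V : Set E, IsOpen V ∧ x ∈ V ∧ ∃ g : E → F, ContDiffOn ℝ ∞ g V ∧ EqOn f g (s ∩ V)

/-- `f` restricts to a diffeomorphism of `s` onto its image `f '' s`: it is injective on `s`,
smooth, and has a smooth inverse `f '' s → s`. -/
def IsDiffeoOntoImage {E F : Type*} [NormedAddCommGroup E] [NormedSpace ℝ E]
    [NormedAddCommGroup F] [NormedSpace ℝ F] (f : E → F) (s : Set E) : Prop :=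
  SmoothOnSubset f s ∧ ∃ g : F → E, LeftInvOn g f s ∧ SmoothOnSubset g (f '' s)

/-- The map `φ_n^{(2)}` parametrizing the double root piece is a diffeomorphism onto its image. -/
def DoubleRootDiffeo (p : PolyFamily) (T S : Set ℝ) (n : ℕ) : Prop :=
  if n = 2 then IsDiffeoOntoImage (phiSq n) (Ioi 0 ×ˢ S)
  else IsDiffeoOntoImage
    (fun y : ((ℝ × ℝ) × (Fin (n - 2 - 1) → ℝ)) × ℝ => phiRoot p n 2 y.1 y.2)
    (dom T (n - 2) ×ˢ S)

end PosPoly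

end

open PosPoly

noncomputable section

namespace PosPoly

/-! ### Polynomials and their coefficient vectors -/

/-! Everything rests on one fact, packaged as `IsChart`: the polynomials `p_k` parametrize,
bijectively and analytically in both directions, the polynomials of degree at most `k` that are
positive on `T` (and at infinity, if `T` is unbounded), and these form an open set of coefficient
vectors.

On the real line (`isChart_univ`) uniqueness is a Hermite–Biehler argument. The polynomial is `F ·
F̄` with `F = √α₁ E + i √α₂ O`, where `E` and `O` are the products of `X - γ_j` over the odd and the
even places. As the roots of `E` and `O` interlace, all roots of `F` lie in the open lower half
plane, so the factorization, and with it `E`, `O` and `α`, can be recovered (`hermiteBiehler_inj`,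
`pUniv_injOn`). The differential is injective by counting zeros, so the inverse function theorem
makes the image open and the inverse analytic. A compactness argument makes the image relatively
closed in the convex set of positive polynomials, hence all of it. The half line follows through `t
↦ t² + a`, where uniqueness forces the roots to be symmetric (`isChart_Ici`), and the interval
through a Möbius substitution (`isChart_Icc`).

A boundary point of the cone is a nonnegative polynomial that is not positive. It has an interior
root, which is double, or a root at an endpoint, or a vanishing leading coefficient. Splitting off
the corresponding factor leaves a nonnegative quotient. If the quotient is positive, its chart
places the polynomial in one of the pieces; otherwise the quotient is itself degenerate, and such
products form families with at most `n - 1` parameters, which are null for `n`-dimensional Hausdorff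
measure (`thin_degeneratePolys`, `frontier_posCone_ae_eq`).

The parametrizations of the pieces are inverted by dividing by the known linear factor, or by first
recovering the double root as a simple zero of the derivative (`IsChart.isDiffeoOntoImage_sq_mul`).
-/

/-- The polynomial with a given coefficient vector. -/
def toPoly {k : ℕ} (c : Coeffs k) : ℝ[X] := ∑ j : Fin (k + 1), C (c j) * X ^ (j : ℕ)

lemma coeff_toPoly {k : ℕ} (c : Coeffs k) (i : ℕ) :
    (toPoly c).coeff i = if h : i < k + 1 then c ⟨i, h⟩ else 0 := by
  simp only [toPoly, finsetSum_coeff, coeff_C_mul, coeff_X_pow, mul_ite, mul_one, mul_zero]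
  split_ifs with h
  · rw [Finset.sum_eq_single ⟨i, h⟩] <;> grind
  · exact Finset.sum_eq_zero fun j _ => if_neg (by have := j.2; omega)

lemma natDegree_toPoly_le {k : ℕ} (c : Coeffs k) : (toPoly c).natDegree ≤ k := by
  rw [natDegree_le_iff_coeff_eq_zero]
  intro i hi
  rw [coeff_toPoly, dif_neg (by omega)]

lemma eval_toPoly {k : ℕ} (c : Coeffs k) (t : ℝ) :
    (toPoly c).eval t = ∑ j : Fin (k + 1), c j * t ^ (j : ℕ) := by
  simp [toPoly, eval_finsetSum]

lemma coeffVec_apply (k : ℕ) (p : ℝ[X]) (j : Fin (k + 1)) : coeffVec k p j = p.coeff j := rfl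

lemma coeffVec_toPoly {k : ℕ} (c : Coeffs k) : coeffVec k (toPoly c) = c := by
  ext j
  rw [coeffVec_apply, coeff_toPoly, dif_pos j.2]

lemma toPoly_coeffVec {k : ℕ} {p : ℝ[X]} (hp : p.natDegree ≤ k) : toPoly (coeffVec k p) = p := by
  ext i
  rw [coeff_toPoly]
  split_ifs with h
  · rfl
  · exact (coeff_eq_zero_of_natDegree_lt (by omega)).symm

lemma coeffVec_neg (k : ℕ) (p : ℝ[X]) : coeffVec k (-p) = -coeffVec k p := by
  ext j
  simp [coeffVec_apply]

lemma coeffVec_injOn (k : ℕ) : InjOn (coeffVec k) {p | p.natDegree ≤ k} := fun p hp q hq h => by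
  rw [← toPoly_coeffVec hp, h, toPoly_coeffVec hq]

/-! ### Analytic families of polynomials -/

section CoeffSmooth
variable {E : Type*} [NormedAddCommGroup E] [NormedSpace ℝ E]

/-- All coefficients of the family `f` are analytic at `x`. -/
def CoeffSmoothAt (f : E → ℝ[X]) (x : E) : Prop :=
  ∀ i, ContDiffAt ℝ ω (fun y => (f y).coeff i) x

variable {f g : E → ℝ[X]} {x : E}

lemma coeffSmoothAt_const (p : ℝ[X]) : CoeffSmoothAt (fun _ : E => p) x :=
  fun _ => contDiffAt_const

lemma CoeffSmoothAt.C {r : E → ℝ} (hr : ContDiffAt ℝ ω r x) :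
    CoeffSmoothAt (fun y => Polynomial.C (r y)) x := by
  intro i
  simp only [coeff_C]
  split_ifs
  · exact hr
  · exact contDiffAt_const

lemma CoeffSmoothAt.add (hf : CoeffSmoothAt f x) (hg : CoeffSmoothAt g x) :
    CoeffSmoothAt (fun y => f y + g y) x := fun i => by
  simpa only [coeff_add] using (hf i).add (hg i)

lemma CoeffSmoothAt.sub (hf : CoeffSmoothAt f x) (hg : CoeffSmoothAt g x) :
    CoeffSmoothAt (fun y => f y - g y) x := fun i => by
  simpa only [coeff_sub] using (hf i).sub (hg i)

lemma CoeffSmoothAt.mul (hf : CoeffSmoothAt f x) (hg : CoeffSmoothAt g x) :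
    CoeffSmoothAt (fun y => f y * g y) x := fun i => by
  simp only [coeff_mul]
  exact ContDiffAt.sum fun j _ => (hf j.1).mul (hg j.2)

lemma CoeffSmoothAt.pow (hf : CoeffSmoothAt f x) (m : ℕ) :
    CoeffSmoothAt (fun y => f y ^ m) x := by
  induction m with
  | zero => simpa using coeffSmoothAt_const 1
  | succ m ih => simpa only [pow_succ] using ih.mul hf

lemma CoeffSmoothAt.prod {ι : Type*} (s : Finset ι) {f : ι → E → ℝ[X]}
    (hf : ∀ i ∈ s, CoeffSmoothAt (f i) x) : CoeffSmoothAt (fun y => ∏ i ∈ s, f i y) x := by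
  classical
  induction s using Finset.induction_on with
  | empty => simpa using coeffSmoothAt_const 1
  | insert i s hi ih =>
    simp only [Finset.prod_insert hi]
    exact (hf i (by simp)).mul (ih fun j hj => hf j (by simp [hj]))

lemma CoeffSmoothAt.sum {ι : Type*} (s : Finset ι) {f : ι → E → ℝ[X]}
    (hf : ∀ i ∈ s, CoeffSmoothAt (f i) x) : CoeffSmoothAt (fun y => ∑ i ∈ s, f i y) x := by
  intro i
  simp only [finsetSum_coeff]
  exact ContDiffAt.sum fun j hj => hf j hj i

lemma CoeffSmoothAt.comp {F : Type*} [NormedAddCommGroup F] [NormedSpace ℝ F] {h : F → E} {y : F}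
    (hf : CoeffSmoothAt f (h y)) (hh : ContDiffAt ℝ ω h y) : CoeffSmoothAt (fun z => f (h z)) y :=
  fun i => (hf i).comp y hh

lemma CoeffSmoothAt.coeffVec (hf : CoeffSmoothAt f x) (n : ℕ) :
    ContDiffAt ℝ ω (fun y => coeffVec n (f y)) x :=
  contDiffAt_euclidean.2 fun j => hf j

lemma CoeffSmoothAt.toPoly {k : ℕ} {h : E → Coeffs k} (hh : ContDiffAt ℝ ω h x) :
    CoeffSmoothAt (fun y => toPoly (h y)) x := by
  intro i
  simp only [coeff_toPoly]
  split_ifs with hi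
  · exact contDiffAt_euclidean.1 hh _
  · exact contDiffAt_const

/-- Substituting a fixed polynomial. -/
lemma CoeffSmoothAt.toPoly_comp {k : ℕ} {h : E → Coeffs k} (hh : ContDiffAt ℝ ω h x) (q : ℝ[X]) :
    CoeffSmoothAt (fun y => (PosPoly.toPoly (h y)).comp q) x := by
  simp only [PosPoly.toPoly, Polynomial.sum_comp, mul_comp, C_comp, X_pow_comp]
  exact CoeffSmoothAt.sum _ fun j _ =>
    (CoeffSmoothAt.C (contDiffAt_euclidean.1 hh j)).mul (coeffSmoothAt_const _)

/-- Synthetic division is analytic in the polynomial and in the point. -/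
lemma CoeffSmoothAt.divByMonic {k : ℕ} (hf : CoeffSmoothAt f x) (hk : ∀ y, (f y).natDegree ≤ k)
    {r : E → ℝ} (hr : ContDiffAt ℝ ω r x) :
    CoeffSmoothAt (fun y => f y /ₘ (X - Polynomial.C (r y))) x := by
  intro i
  -- The natural upper limit of the sum is the degree of `f y`, which may jump with `y`. Padding
  -- with zero coefficients up to `k` makes the index set constant.
  have : ∀ y, (f y /ₘ (X - Polynomial.C (r y))).coeff i =
      ∑ j ∈ Finset.Icc (i + 1) k, r y ^ (j - (i + 1)) * (f y).coeff j := by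
    intro y
    rw [coeff_divByMonic_X_sub_C]
    refine Finset.sum_subset (Finset.Icc_subset_Icc_right (hk y)) fun j hj hj' => ?_
    rw [coeff_eq_zero_of_natDegree_lt, mul_zero]
    simp only [Finset.mem_Icc] at hj hj'
    omega
  simp only [this]
  exact ContDiffAt.sum fun j _ => (hr.pow _).mul (hf j)

end CoeffSmooth

lemma continuous_eval_toPoly {k : ℕ} :
    Continuous fun x : Coeffs k × ℝ => (toPoly x.1).eval x.2 := by
  simp only [eval_toPoly]
  fun_prop

/-! ### Diffeomorphisms onto images -/

section Diffeo
variable {E F : Type*} [NormedAddCommGroup E] [NormedSpace ℝ E]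
    [NormedAddCommGroup F] [NormedSpace ℝ F]

/-- Working with `ω` lets a hypothesis at a single point suffice: analyticity spreads to a
neighbourhood, whereas `ContDiffAt ℝ ∞` at a point gives neighbourhoods that may shrink with the
order. -/
lemma smoothOnSubset_of_eventuallyEq {f : E → F} {s : Set E}
    (h : ∀ x ∈ s, ∃ g : E → F, ContDiffAt ℝ ω g x ∧ f =ᶠ[𝓝[s] x] g) : SmoothOnSubset f s := by
  intro x hx
  obtain ⟨g, hg, hfg⟩ := h x hx
  have h1 : ∀ᶠ y in 𝓝 x, ContDiffAt ℝ ω g y := hg.eventually (by simp)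
  rw [EventuallyEq, eventually_nhdsWithin_iff] at hfg
  obtain ⟨V, hV, hVo, hxV⟩ := eventually_nhds_iff.1 (h1.and hfg)
  refine ⟨V, hVo, hxV, g, fun y hy => ((hV y hy).1.of_le le_top).contDiffWithinAt, ?_⟩
  exact fun y hy => (hV y hy.2).2 hy.1

/-- The inverse `g` only has to agree on the image with an analytic germ at each point. This leaves
room for an inverse defined by choice, as happens for the double root. -/
lemma isDiffeoOntoImage_of_inverse {f : E → F} {s : Set E} (hf : ∀ x ∈ s, ContDiffAt ℝ ω f x)
    (g : F → E) (hgf : ∀ x ∈ s, g (f x) = x)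
    (hg : ∀ x ∈ s, ∃ h : F → E, ContDiffAt ℝ ω h (f x) ∧ g =ᶠ[𝓝[f '' s] f x] h) :
    IsDiffeoOntoImage f s := by
  refine ⟨smoothOnSubset_of_eventuallyEq fun x hx => ⟨f, hf x hx, EventuallyEq.rfl⟩, g, hgf, ?_⟩
  apply smoothOnSubset_of_eventuallyEq
  rintro _ ⟨x, hx, rfl⟩
  exact hg x hx

end Diffeo

/-! ### Charts of the set of positive polynomials -/

/-- Polynomials of degree at most `k` which are positive on `T`, and at infinity if `T` is
unbounded. -/
def PosPolys (T : Set ℝ) (k : ℕ) : Set ℝ[X] :=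
  {p | p.natDegree ≤ k ∧ (∀ t ∈ T, 0 < p.eval t) ∧ (Bornology.IsBounded T ∨ 0 < p.coeff k)}

/-- `f` is an analytic parametrization of `PosPolys T k` by `s` with analytic inverse. -/
structure IsChart {E : Type*} [NormedAddCommGroup E] [NormedSpace ℝ E] (T : Set ℝ) (k : ℕ)
    (f : E → ℝ[X]) (s : Set E) : Prop where
  smooth : ∀ x, CoeffSmoothAt f x
  bijOn : BijOn f s (PosPolys T k)
  isOpen : IsOpen {c : Coeffs k | toPoly c ∈ PosPolys T k}
  exists_inverse : ∃ g : Coeffs k → E, ∀ x ∈ s,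
    ContDiffAt ℝ ω g (coeffVec k (f x)) ∧ g (coeffVec k (f x)) = x

section Generic
variable {E : Type*} [NormedAddCommGroup E] [NormedSpace ℝ E] {T : Set ℝ} {k : ℕ}
    {f : E → ℝ[X]} {s : Set E}

/-- For `k < n` the image lies in a proper subspace; forgetting the coefficients above `k` extends
the inverse to an open subset of the ambient space. -/
lemma IsChart.isDiffeoOntoImage (hf : IsChart T k f s) {n : ℕ} (hkn : k ≤ n) :
    IsDiffeoOntoImage (fun x => coeffVec n (f x)) s := by
  obtain ⟨g, hg⟩ := hf.exists_inverse
  have key : ∀ x ∈ s, coeffVec k (toPoly (coeffVec n (f x))) = coeffVec k (f x) := fun x hx => by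
    rw [toPoly_coeffVec ((hf.bijOn.mapsTo hx).1.trans hkn)]
  refine isDiffeoOntoImage_of_inverse (fun x _ => (hf.smooth x).coeffVec n)
    (fun c => g (coeffVec k (toPoly c))) (fun x hx => ?_) (fun x hx => ⟨_, ?_, EventuallyEq.rfl⟩)
  · rw [key x hx, (hg x hx).2]
  · refine ContDiffAt.comp _ ?_ ((CoeffSmoothAt.toPoly contDiffAt_id).coeffVec k)
    rw [key x hx]
    exact (hg x hx).1

lemma natDegree_pow_mul_le {k : ℕ} (a : ℝ) (i : ℕ) {q : ℝ[X]} (hq : q.natDegree ≤ k) :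
    ((X - C a) ^ i * q).natDegree ≤ i + k := by
  refine natDegree_mul_le.trans (add_le_add ?_ hq)
  exact natDegree_pow_le.trans (by simp)

lemma mul_divByMonic_X_sub_C (a : ℝ) (q : ℝ[X]) : ((X - C a) * q) /ₘ (X - C a) = q :=
  mul_divByMonic_cancel_left q (monic_X_sub_C a)

/-- Synthetic division by `X - a` is defined for every polynomial, also for those that do not vanish
at `a`, so it extends the inverse off the image. -/
lemma IsChart.isDiffeoOntoImage_mul (hf : IsChart T k f s) {n : ℕ} (hkn : k + 1 ≤ n) (a : ℝ) :
    IsDiffeoOntoImage (fun x => coeffVec n ((X - C a) ^ 1 * f x)) s := by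
  obtain ⟨g, hg⟩ := hf.exists_inverse
  have key : ∀ x ∈ s, coeffVec k (toPoly (coeffVec n ((X - C a) ^ 1 * f x)) /ₘ (X - C a)) =
      coeffVec k (f x) := fun x hx => by
    rw [toPoly_coeffVec ((natDegree_pow_mul_le a 1 (hf.bijOn.mapsTo hx).1).trans (by omega)),
      pow_one, mul_divByMonic_X_sub_C]
  refine isDiffeoOntoImage_of_inverse
    (fun x _ => ((coeffSmoothAt_const _).mul (hf.smooth x)).coeffVec n)
    (fun c => g (coeffVec k (toPoly c /ₘ (X - C a)))) (fun x hx => ?_)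
    (fun x hx => ⟨_, ?_, EventuallyEq.rfl⟩)
  · rw [key x hx, (hg x hx).2]
  · refine ContDiffAt.comp _ ?_ (((CoeffSmoothAt.toPoly contDiffAt_id).divByMonic
      (fun c => natDegree_toPoly_le _) contDiffAt_const).coeffVec k)
    rw [key x hx]
    exact (hg x hx).1

end Generic

/-! ### The double root piece -/

/-- The roots of the polynomials near one of full degree are uniformly bounded. -/
lemma exists_root_bound {n : ℕ} (c₀ : Coeffs n) (h : (toPoly c₀).coeff n ≠ 0) :
    ∃ R : ℝ, ∀ᶠ c in 𝓝 c₀, ∀ t, (toPoly c).eval t = 0 → |t| ≤ R := by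
  -- This is the reversed polynomial in `s = 1 / t`. At `s = 0` it equals the leading coefficient,
  -- so it has no zeros near `(c₀, 0)`, which excludes large `t`.
  have hcont : Continuous fun x : Coeffs n × ℝ =>
      ∑ j : Fin (n + 1), x.1 j * x.2 ^ (n - (j : ℕ)) := by fun_prop
  have h0 : (∑ j : Fin (n + 1), c₀ j * (0 : ℝ) ^ (n - (j : ℕ))) ≠ 0 := by
    rw [Finset.sum_eq_single (Fin.last n)]
    · simpa [coeff_toPoly, Fin.last] using h
    · intro j _ hj
      have : (j : ℕ) ≠ n := fun h' => hj (Fin.ext h')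
      rw [zero_pow (by have := j.2; omega), mul_zero]
    · simp
  have hev : ∀ᶠ x : Coeffs n × ℝ in 𝓝 (c₀, 0),
      (∑ j : Fin (n + 1), x.1 j * x.2 ^ (n - (j : ℕ))) ≠ 0 :=
    hcont.continuousAt.eventually_ne h0
  rw [nhds_prod_eq, eventually_prod_iff] at hev
  obtain ⟨pa, hpa, pb, hpb, hp⟩ := hev
  obtain ⟨δ, hδ, hb⟩ := Metric.eventually_nhds_iff.1 hpb
  refine ⟨δ⁻¹, hpa.mono fun c hc t ht => ?_⟩
  by_contra! hlt
  have htpos : 0 < |t| := (inv_pos.2 hδ).trans hlt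
  have ht0 : t ≠ 0 := abs_pos.1 htpos
  have hpb' : pb t⁻¹ := hb (by
    rw [dist_zero_right, norm_inv, Real.norm_eq_abs]
    exact inv_lt_of_inv_lt₀ hδ hlt)
  apply hp hc hpb'
  rw [eval_toPoly] at ht
  have : (∑ j : Fin (n + 1), c j * t⁻¹ ^ (n - (j : ℕ))) =
      t⁻¹ ^ n * ∑ j : Fin (n + 1), c j * t ^ (j : ℕ) := by
    rw [Finset.mul_sum]
    refine Finset.sum_congr rfl fun j _ => ?_
    have hj : (j : ℕ) ≤ n := by have := j.2; omega
    have hpow : t⁻¹ ^ n = t⁻¹ ^ (n - (j : ℕ)) * t⁻¹ ^ (j : ℕ) := by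
      rw [← pow_add, Nat.sub_add_cancel hj]
    rw [hpow]
    have : t⁻¹ ^ (j : ℕ) * t ^ (j : ℕ) = 1 := by rw [← mul_pow, inv_mul_cancel₀ ht0, one_pow]
    linear_combination -(c j * t⁻¹ ^ (n - (j : ℕ))) * this
  simp only at this ⊢
  rw [this, ht, mul_zero]

/-- If `γ₀` is the only root in the closed set `T` of a polynomial, which has full degree if `T` is
unbounded, then the roots in `T` of nearby polynomials are close to `γ₀`. -/
lemma tendsto_root {n : ℕ} {T : Set ℝ} (hT : IsClosed T) (c₀ : Coeffs n) {γ₀ : ℝ}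
    (hlead : Bornology.IsBounded T ∨ (toPoly c₀).coeff n ≠ 0)
    (huniq : ∀ t ∈ T, (toPoly c₀).eval t = 0 → t = γ₀) {l : Filter (Coeffs n)} (hl : l ≤ 𝓝 c₀)
    {r : Coeffs n → ℝ} (hr : ∀ᶠ c in l, r c ∈ T ∧ (toPoly c).eval (r c) = 0) :
    Tendsto r l (𝓝 γ₀) := by
  obtain ⟨R, hR⟩ : ∃ R : ℝ, ∀ᶠ c in 𝓝 c₀, ∀ t ∈ T, (toPoly c).eval t = 0 → |t| ≤ R := by
    rcases hlead with h | h
    · obtain ⟨R, hR⟩ := h.subset_closedBall 0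
      exact ⟨R, Eventually.of_forall fun c t ht _ => by simpa using hR ht⟩
    · obtain ⟨R, hR⟩ := exists_root_bound c₀ h
      exact ⟨R, hR.mono fun c hc t _ ht => hc t ht⟩
  rw [Metric.tendsto_nhds]
  intro ε hε
  -- The limit polynomial has no root on this compact set, and nonvanishing on a compact set
  -- survives small perturbations.
  have hK : IsCompact (T ∩ (Icc (-R) R \ Metric.ball γ₀ ε)) :=
    (isCompact_Icc.diff Metric.isOpen_ball).inter_left hT
  have hne : ∀ᶠ c in 𝓝 c₀, ∀ t ∈ T ∩ (Icc (-R) R \ Metric.ball γ₀ ε),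
      (toPoly c).eval t ≠ 0 := by
    refine hK.eventually_forall_of_forall_eventually fun t ht => ?_
    refine continuous_eval_toPoly.continuousAt.eventually_ne fun h => ht.2.2 ?_
    rw [huniq t ht.1 h]
    exact Metric.mem_ball_self hε
  filter_upwards [hr, hl hR, hl hne] with c h1 h2 h3
  by_contra h4
  exact h3 (r c) ⟨h1.1, abs_le.1 (h2 _ h1.1 h1.2), h4⟩ h1.2

lemma isInvertible_of_apply_one_ne_zero {L : ℝ →L[ℝ] ℝ} (h : L 1 ≠ 0) : L.IsInvertible := by
  refine ⟨ContinuousLinearEquiv.unitsEquivAut ℝ (Units.mk0 (L 1) h), ?_⟩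
  ext
  simp

/-- A simple root of the derivative of a polynomial depends analytically on the polynomial. -/
lemma exists_analytic_critical_point {n : ℕ} (c₀ : Coeffs n) (γ₀ : ℝ)
    (h1 : (derivative (toPoly c₀)).eval γ₀ = 0)
    (h2 : (derivative (derivative (toPoly c₀))).eval γ₀ ≠ 0) :
    ∃ ψ : Coeffs n → ℝ, ContDiffAt ℝ ω ψ c₀ ∧ ψ c₀ = γ₀ ∧
      ∀ᶠ v : Coeffs n × ℝ in 𝓝 (c₀, γ₀), (derivative (toPoly v.1)).eval v.2 = 0 → ψ v.1 = v.2 := by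
  -- The implicit function theorem is applied to the derivative: at a double root the `t`-derivative
  -- of the polynomial itself vanishes, while that of `F` is the second derivative.
  set F : Coeffs n × ℝ → ℝ := fun v => (derivative (toPoly v.1)).eval v.2 with hF
  have hsm : ContDiff ℝ ω F := by
    simp only [hF, toPoly, derivative_sum, eval_finsetSum, derivative_C_mul, derivative_X_pow,
      eval_mul, eval_C, eval_pow, eval_X]
    refine ContDiff.sum fun j _ => ContDiff.mul ?_ (contDiff_const.mul (contDiff_snd.pow _))
    exact (contDiff_euclidean.1 contDiff_id j).comp contDiff_fst
  have hder : fderiv ℝ F (c₀, γ₀) (0, 1) =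
      (derivative (derivative (toPoly c₀))).eval γ₀ := by
    have hA : HasFDerivAt F (fderiv ℝ F (c₀, γ₀)) (c₀, γ₀) :=
      (hsm.differentiable (by simp)).differentiableAt.hasFDerivAt
    have hB : HasDerivAt (fun t : ℝ => (c₀, t)) (0, 1) γ₀ :=
      (hasDerivAt_const _ _).prodMk (hasDerivAt_id _)
    exact (hA.comp_hasDerivAt γ₀ hB).unique ((derivative (toPoly c₀)).hasDerivAt γ₀)
  have hinv : (fderiv ℝ F (c₀, γ₀) ∘L .inr ℝ (Coeffs n) ℝ).IsInvertible := by
    apply isInvertible_of_apply_one_ne_zero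
    simpa [hder] using h2
  have hat : ContDiffAt ℝ ω F (c₀, γ₀) := hsm.contDiffAt
  refine ⟨hat.implicitFunction (by simp) hinv, hat.contDiffAt_implicitFunction _ hinv,
    hat.implicitFunction_apply_self _ hinv, ?_⟩
  filter_upwards [hat.eventually_apply_eq_iff_implicitFunction (by simp) hinv] with v hv hv'
  exact hv.1 (by simp only [hF, hv', h1])

variable {E : Type*} [NormedAddCommGroup E] [NormedSpace ℝ E] {T : Set ℝ} {k : ℕ}
    {f : E → ℝ[X]} {s : Set E}

lemma natDegree_sq_mul_le {k n : ℕ} (hkn : k + 2 = n) (γ : ℝ) {q : ℝ[X]} (hq : q.natDegree ≤ k) :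
    ((X - C γ) ^ 2 * q).natDegree ≤ n :=
  (natDegree_pow_mul_le γ 2 hq).trans (by omega)

lemma coeff_sq_mul {k n : ℕ} (hkn : k + 2 = n) (γ : ℝ) {q : ℝ[X]} (hq : q.natDegree ≤ k) :
    ((X - C γ) ^ 2 * q).coeff n = q.coeff k := by
  rw [← hkn, add_comm, coeff_mul_add_eq_of_natDegree_le (natDegree_pow_le.trans (by simp)) hq]
  have h : ((X - C γ) ^ 2).natDegree = 2 := by simp
  have h' : ((X - C γ) ^ 2).coeff 2 = 1 := by
    have := ((monic_X_sub_C γ).pow 2).coeff_natDegree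
    rwa [h] at this
  rw [h', one_mul]

/-- Since `q > 0` on `T`, the point `γ` is the only root of `(X - γ)² q` in `T`, and two divisions
then give `q`. The second derivative at `γ` is `2 q(γ) ≠ 0`, so the critical point is analytic in
the coefficients. This works at endpoints of `T` as well, which is why `S` may contain them. -/
theorem IsChart.isDiffeoOntoImage_sq_mul (hf : IsChart T k f s) (hT : IsClosed T) {S : Set ℝ}
    (hS : S ⊆ T) {n : ℕ} (hkn : k + 2 = n) :
    IsDiffeoOntoImage (fun y : E × ℝ => coeffVec n ((X - C y.2) ^ 2 * f y.1)) (s ×ˢ S) := by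
  classical
  obtain ⟨g, hg⟩ := hf.exists_inverse
  set Φ : E × ℝ → Coeffs n := fun y => coeffVec n ((X - C y.2) ^ 2 * f y.1) with hΦ
  have hpoly : ∀ y ∈ s ×ˢ S, toPoly (Φ y) = (X - C y.2) ^ 2 * f y.1 := fun y hy =>
    toPoly_coeffVec (natDegree_sq_mul_le hkn _ (hf.bijOn.mapsTo hy.1).1)
  have huniq : ∀ y ∈ s ×ˢ S, ∀ t ∈ T, (toPoly (Φ y)).eval t = 0 → t = y.2 := by
    intro y hy t ht h
    rw [hpoly y hy] at h
    have := (hf.bijOn.mapsTo hy.1).2.1 t ht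
    simpa [this.ne', sub_eq_zero] using h
  -- Only values on the image matter, where a root in `T` exists and is unique; the default `0` is
  -- never used there.
  set r : Coeffs n → ℝ := fun c =>
    if h : ∃ t ∈ T, (toPoly c).eval t = 0 then h.choose else 0 with hr
  have hrΦ : ∀ y ∈ s ×ˢ S, r (Φ y) = y.2 := by
    intro y hy
    have hex : ∃ t ∈ T, (toPoly (Φ y)).eval t = 0 := ⟨y.2, hS hy.2, by simp [hpoly y hy]⟩
    simp only [hr, dif_pos hex]
    exact huniq y hy _ hex.choose_spec.1 hex.choose_spec.2
  set quot : Coeffs n → ℝ → Coeffs k := fun c t =>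
    coeffVec k (toPoly c /ₘ (X - C t) /ₘ (X - C t)) with hquot
  have hquotΦ : ∀ y ∈ s ×ˢ S, quot (Φ y) y.2 = coeffVec k (f y.1) := by
    intro y hy
    simp only [hquot]
    rw [hpoly y hy, pow_two, mul_assoc, mul_divByMonic_X_sub_C, mul_divByMonic_X_sub_C]
  refine isDiffeoOntoImage_of_inverse (fun y _ => ?_) (fun c => (g (quot c (r c)), r c))
    (fun y hy => ?_) (fun y hy => ?_)
  · refine CoeffSmoothAt.coeffVec (CoeffSmoothAt.mul ?_ ?_) n
    · exact ((coeffSmoothAt_const _).sub (CoeffSmoothAt.C contDiffAt_snd)).pow 2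
    · exact (hf.smooth y.1).comp contDiffAt_fst
  · rw [hrΦ y hy, hquotΦ y hy, (hg _ hy.1).2]
  · have h1 : (derivative (toPoly (Φ y))).eval y.2 = 0 := by
      rw [hpoly y hy]
      simp [derivative_pow]
    have h2 : (derivative (derivative (toPoly (Φ y)))).eval y.2 ≠ 0 := by
      rw [hpoly y hy]
      simp [derivative_pow, ((hf.bijOn.mapsTo hy.1).2.1 y.2 (hS hy.2)).ne']
    obtain ⟨ψ, hψ, hψ0, hψr⟩ := exists_analytic_critical_point _ _ h1 h2
    refine ⟨fun c => (g (quot c (ψ c)), ψ c), ContDiffAt.prodMk ?_ hψ, ?_⟩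
    · refine ContDiffAt.comp (g := g) (f := fun c => quot c (ψ c)) _ ?_ ?_
      · rw [hψ0, hquotΦ y hy]
        exact (hg _ hy.1).1
      · refine CoeffSmoothAt.coeffVec ?_ k
        refine CoeffSmoothAt.divByMonic (k := n) ?_ (fun c => ?_) hψ
        · exact (CoeffSmoothAt.toPoly contDiffAt_id).divByMonic
            (fun c => natDegree_toPoly_le _) hψ
        · rw [natDegree_divByMonic _ (monic_X_sub_C _)]
          exact (Nat.sub_le _ _).trans (natDegree_toPoly_le c)
    -- The implicit function `ψ` recognizes only critical points close to `y.2`, so `r` must first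
    -- be shown to be continuous along the image.
    · have hlim : Tendsto r (𝓝[Φ '' (s ×ˢ S)] Φ y) (𝓝 y.2) := by
        refine tendsto_root hT (Φ y) ?_ (huniq y hy) nhdsWithin_le_nhds ?_
        · refine (hf.bijOn.mapsTo hy.1).2.2.imp_right fun h => ?_
          rw [hpoly y hy, coeff_sq_mul hkn _ (hf.bijOn.mapsTo hy.1).1]
          exact h.ne'
        · filter_upwards [self_mem_nhdsWithin]
          rintro _ ⟨z, hz, rfl⟩
          rw [hrΦ z hz, hpoly z hz]
          exact ⟨hS hz.2, by simp⟩
      have hpair : Tendsto (fun c => (c, r c)) (𝓝[Φ '' (s ×ˢ S)] Φ y) (𝓝 (Φ y, y.2)) :=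
        (tendsto_id.mono_left nhdsWithin_le_nhds).prodMk_nhds hlim
      filter_upwards [hpair.eventually hψr, self_mem_nhdsWithin]
      rintro _ hc ⟨z, hz, rfl⟩
      have : ψ (Φ z) = r (Φ z) := hc (by rw [hrΦ z hz, hpoly z hz]; simp [derivative_pow])
      rw [this]

/-! ### Injective analytic maps with injective derivative -/

section LocalInverse
variable {E F : Type*} [NormedAddCommGroup E] [NormedSpace ℝ E] [FiniteDimensional ℝ E]
    [NormedAddCommGroup F] [NormedSpace ℝ F] [FiniteDimensional ℝ F]

/-- Equal dimensions turn the injective derivative into an isomorphism, so local analytic inverses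
exist. Global injectivity forces the set-theoretic inverse to coincide with each of them near the
corresponding value. -/
theorem exists_analytic_inverse {f : E → F} {U : Set E} (hU : IsOpen U) (hinj : InjOn f U)
    (hf : ∀ x ∈ U, ContDiffAt ℝ ω f x)
    (hdim : Module.finrank ℝ E = Module.finrank ℝ F)
    (hder : ∀ x ∈ U, ∀ v, fderiv ℝ f x v = 0 → v = 0) :
    IsOpen (f '' U) ∧ ∃ g : F → E, ∀ x ∈ U, ContDiffAt ℝ ω g (f x) ∧ g (f x) = x := by
  have : CompleteSpace E := FiniteDimensional.complete ℝ E
  have hequiv : ∀ x ∈ U, ∃ L : E ≃L[ℝ] F, HasFDerivAt f (L : E →L[ℝ] F) x := by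
    intro x hx
    have hker : Function.Injective (fderiv ℝ f x : E →ₗ[ℝ] F) := by
      rw [← LinearMap.ker_eq_bot, LinearMap.ker_eq_bot']
      exact hder x hx
    refine ⟨(LinearEquiv.ofInjectiveOfFinrankEq _ hker hdim).toContinuousLinearEquiv, ?_⟩
    have h := ((hf x hx).differentiableAt (by simp)).hasFDerivAt
    convert! h using 1
  refine ⟨?_, ?_⟩
  · rw [isOpen_iff_mem_nhds]
    rintro _ ⟨x, hx, rfl⟩
    obtain ⟨L, hL⟩ := hequiv x hx
    have := ((hf x hx).hasStrictFDerivAt' hL (by simp)).map_nhds_eq_of_equiv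
    rw [← this]
    exact image_mem_map (hU.mem_nhds hx)
  · classical
    rcases U.eq_empty_or_nonempty with rfl | ⟨x₀, -⟩
    · exact ⟨fun _ => 0, by simp⟩
    have : Nonempty E := ⟨x₀⟩
    refine ⟨Function.invFunOn f U, fun x hx => ⟨?_, hinj.leftInvOn_invFunOn hx⟩⟩
    obtain ⟨L, hL⟩ := hequiv x hx
    have hli := (hf x hx).to_localInverse hL (by simp)
    refine hli.congr_of_eventuallyEq ?_
    have hstr := (hf x hx).hasStrictFDerivAt' hL (by simp)
    have h1 : ∀ᶠ y in 𝓝 (f x), f ((hf x hx).localInverse hL (by simp) y) = y :=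
      hstr.eventually_right_inverse
    have h2 : ∀ᶠ y in 𝓝 (f x), (hf x hx).localInverse hL (by simp) y ∈ U := by
      apply hli.continuousAt.eventually_mem
      rw [ContDiffAt.localInverse_apply_image]
      exact hU.mem_nhds hx
    filter_upwards [h1, h2] with y hy1 hy2
    conv_lhs => rw [← hy1]
    exact hinj.leftInvOn_invFunOn hy2

end LocalInverse

/-! ### Products of linear factors -/

/-- `∏_{j ∈ s} (X - γ_j)`. -/
def linProd {ι : Type*} (s : Finset ι) (γ : ι → ℝ) : ℝ[X] := ∏ j ∈ s, (X - C (γ j))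

/-- The even values of the index. -/
abbrev evens (m : ℕ) : Finset (Fin m) := Finset.univ.filter fun j => Even (j : ℕ)

/-- The odd values of the index. -/
abbrev odds (m : ℕ) : Finset (Fin m) := Finset.univ.filter fun j => Odd (j : ℕ)

lemma oddProd_eq_sq {m : ℕ} (γ : Fin m → ℝ) : oddProd γ = linProd (evens m) γ ^ 2 :=
  Finset.prod_pow _ _ _

lemma evenProd_eq_sq {m : ℕ} (γ : Fin m → ℝ) : evenProd γ = linProd (odds m) γ ^ 2 :=
  Finset.prod_pow _ _ _

section LinProd
variable {ι : Type*} (s : Finset ι) (γ : ι → ℝ)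

lemma linProd_monic : (linProd s γ).Monic := monic_prod_of_monic _ _ fun _ _ => monic_X_sub_C _

lemma natDegree_linProd : (linProd s γ).natDegree = s.card := by
  rw [linProd, natDegree_prod_of_monic _ _ fun _ _ => monic_X_sub_C _]
  simp

lemma eval_linProd (t : ℝ) : (linProd s γ).eval t = ∏ j ∈ s, (t - γ j) := by
  simp [linProd, eval_prod]

lemma eval_linProd_eq_zero {s : Finset ι} {γ : ι → ℝ} {t : ℝ} :
    (linProd s γ).eval t = 0 ↔ ∃ j ∈ s, γ j = t := by
  simp only [eval_linProd, Finset.prod_eq_zero_iff, sub_eq_zero, eq_comm (a := t)]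

lemma natDegree_sum_C_mul_linProd_le [DecidableEq ι] (δ : ι → ℝ) :
    (∑ i ∈ s, C (δ i) * linProd (s.erase i) γ).natDegree ≤ s.card :=
  natDegree_sum_le_of_forall_le _ _ fun i _ => (natDegree_C_mul_le _ _).trans (by
    rw [natDegree_linProd]
    exact Finset.card_le_card (Finset.erase_subset _ _))

/-- The differential of `(α, γ) ↦ α ∏ (X - γ_j)` is injective. -/
lemma eq_zero_of_linearized_eq_zero [DecidableEq ι] {s : Finset ι} {γ : ι → ℝ} (hγ : InjOn γ s)
    {d a : ℝ} (ha : a ≠ 0) {δ : ι → ℝ}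
    (h : C d * linProd s γ + C a * ∑ i ∈ s, C (δ i) * linProd (s.erase i) γ = 0) :
    d = 0 ∧ ∀ i ∈ s, δ i = 0 := by
  have hδ : ∀ i ∈ s, δ i = 0 := by
    intro i hi
    -- At `γ i` every summand vanishes except the one with the factor at `i` erased.
    have h1 := congrArg (eval (γ i)) h
    rw [eval_add, eval_mul, eval_linProd_eq_zero.2 ⟨i, hi, rfl⟩, mul_zero, zero_add, eval_mul,
      eval_finsetSum, Finset.sum_eq_single i, eval_mul, eval_C, eval_C, eval_zero] at h1
    · have h2 : (linProd (s.erase i) γ).eval (γ i) ≠ 0 := by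
        rw [Ne, eval_linProd_eq_zero]
        rintro ⟨j, hj, hji⟩
        exact Finset.ne_of_mem_erase hj (hγ (Finset.mem_of_mem_erase hj) hi hji)
      simpa [ha, h2] using h1
    · intro j _ hj
      rw [eval_mul, eval_linProd_eq_zero.2 ⟨i, Finset.mem_erase.2 ⟨hj.symm, hi⟩, rfl⟩, mul_zero]
    · exact fun h => absurd hi h
  refine ⟨?_, hδ⟩
  rw [Finset.sum_eq_zero fun i hi => by rw [hδ i hi, C_0, zero_mul], mul_zero, add_zero] at h
  have := (mul_eq_zero.1 h).resolve_right (linProd_monic s γ).ne_zero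
  simpa using this

/-- The differential of `(α, γ, β, η) ↦ α ∏ (X - γ_j)² + β ∏ (X - η_j)²` is injective where
the `γ_j` and the `η_j` are distinct, if there are fewer `η`s. -/
lemma eq_zero_of_linearized_sq_eq_zero [DecidableEq ι] {s u : Finset ι} {γ : ι → ℝ}
    (hγ : Function.Injective γ) (hsu : Disjoint s u) (hcard : u.card < s.card)
    {d a e b : ℝ} (ha : a ≠ 0) (hb : b ≠ 0) {δ : ι → ℝ}
    (h : linProd s γ * (C d * linProd s γ + C a * ∑ i ∈ s, C (δ i) * linProd (s.erase i) γ) +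
      linProd u γ * (C e * linProd u γ + C b * ∑ i ∈ u, C (δ i) * linProd (u.erase i) γ) = 0) :
    (d = 0 ∧ ∀ i ∈ s, δ i = 0) ∧ e = 0 ∧ ∀ i ∈ u, δ i = 0 := by
  set V := C e * linProd u γ + C b * ∑ i ∈ u, C (δ i) * linProd (u.erase i) γ with hV
  have hVdeg : V.natDegree ≤ u.card :=
    natDegree_add_le_of_degree_le
      ((natDegree_C_mul_le _ _).trans (natDegree_linProd u γ).le)
      ((natDegree_C_mul_le _ _).trans (natDegree_sum_C_mul_linProd_le u γ δ))
  have hV0 : V = 0 := by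
    -- At each `γ i` with `i ∈ s` the first summand vanishes and the product over `u` does not, so
    -- `V` has `s.card` zeros, more than its degree allows.
    refine eq_zero_of_natDegree_lt_card_of_eval_eq_zero' V (s.image γ) ?_ ?_
    · intro t ht
      obtain ⟨i, hi, rfl⟩ := Finset.mem_image.1 ht
      have h1 := congrArg (eval (γ i)) h
      rw [eval_add, eval_mul, eval_linProd_eq_zero.2 ⟨i, hi, rfl⟩, zero_mul, zero_add, eval_mul,
        eval_zero] at h1
      refine (mul_eq_zero.1 h1).resolve_left fun h2 => ?_
      obtain ⟨j, hj, hji⟩ := eval_linProd_eq_zero.1 h2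
      rw [hγ hji] at hj
      exact Finset.disjoint_left.1 hsu hi hj
    · rw [Finset.card_image_of_injective _ hγ]
      omega
  rw [hV0, mul_zero, add_zero] at h
  exact ⟨eq_zero_of_linearized_eq_zero hγ.injOn ha
    ((mul_eq_zero.1 h).resolve_left (linProd_monic s γ).ne_zero),
    eq_zero_of_linearized_eq_zero hγ.injOn hb hV0⟩

lemma hasDerivAt_linProd [DecidableEq ι] (δ : ι → ℝ) (t : ℝ) :
    HasDerivAt (fun r : ℝ => ∏ j ∈ s, (t - (γ j + r * δ j)))
      (-∑ i ∈ s, δ i * (linProd (s.erase i) γ).eval t) 0 := by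
  have h : ∀ i ∈ s, HasDerivAt (fun r : ℝ => t - (γ i + r * δ i)) (-δ i) 0 := fun i _ => by
    simpa using (((hasDerivAt_id (0 : ℝ)).mul_const (δ i)).const_add (γ i)).const_sub t
  convert! HasDerivAt.fun_finsetProd h using 1
  rw [← Finset.sum_neg_distrib]
  refine Finset.sum_congr rfl fun i _ => ?_
  simp [eval_linProd, mul_comm]

end LinProd

/-! ### Indices of a given parity -/

lemma prod_evens {M : Type*} [CommMonoid M] (g : ℕ → M) (N : ℕ) :
    ∏ j ∈ evens N, g j = ∏ i ∈ Finset.range ((N + 1) / 2), g (2 * i) := by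
  rw [Finset.prod_filter]
  induction N with
  | zero => simp
  | succ N ih =>
    rw [Fin.prod_univ_castSucc]
    simp only [Fin.val_castSucc, Fin.val_last]
    rw [ih]
    split_ifs with h
    · obtain ⟨r, rfl⟩ := h
      rw [show (r + r + 1 + 1) / 2 = r + 1 by omega, show (r + r + 1) / 2 = r by omega,
        Finset.prod_range_succ, two_mul]
    · rw [Nat.not_even_iff_odd] at h
      obtain ⟨r, rfl⟩ := h
      rw [show (2 * r + 1 + 1 + 1) / 2 = (2 * r + 1 + 1) / 2 by omega, mul_one]

lemma prod_odds {M : Type*} [CommMonoid M] (g : ℕ → M) (N : ℕ) :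
    ∏ j ∈ odds N, g j = ∏ i ∈ Finset.range (N / 2), g (2 * i + 1) := by
  rw [Finset.prod_filter]
  induction N with
  | zero => simp
  | succ N ih =>
    rw [Fin.prod_univ_castSucc]
    simp only [Fin.val_castSucc, Fin.val_last]
    rw [ih]
    split_ifs with h
    · obtain ⟨r, rfl⟩ := h
      rw [show (2 * r + 1 + 1) / 2 = r + 1 by omega, show (2 * r + 1) / 2 = r by omega,
        Finset.prod_range_succ]
    · rw [Nat.not_odd_iff_even] at h
      obtain ⟨r, rfl⟩ := h
      rw [show (r + r + 1) / 2 = (r + r) / 2 by omega, mul_one]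

lemma card_evens (N : ℕ) : (evens N).card = (N + 1) / 2 := by
  -- With all factors equal to `ofAdd 1` the product counts its factors.
  have := prod_evens (fun _ => Multiplicative.ofAdd 1) N
  simpa [← ofAdd_nsmul] using this

lemma card_odds (N : ℕ) : (odds N).card = N / 2 := by
  have := prod_odds (fun _ => Multiplicative.ofAdd 1) N
  simpa [← ofAdd_nsmul] using this

lemma disjoint_evens_odds (N : ℕ) : Disjoint (evens N) (odds N) := by
  rw [Finset.disjoint_filter]
  exact fun j _ h => Nat.not_odd_iff_even.2 h

/-! ### The real line: the parametrization takes values in the positive polynomials -/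

lemma coeffSmoothAt_linProd_sq {E : Type*} [NormedAddCommGroup E] [NormedSpace ℝ E] {ι : Type*}
    (s : Finset ι) {γ : E → ι → ℝ} {x : E} (hγ : ∀ i, ContDiffAt ℝ ω (fun y => γ y i) x) :
    CoeffSmoothAt (fun y => linProd s (γ y) ^ 2) x :=
  (CoeffSmoothAt.prod s fun i _ => (coeffSmoothAt_const X).sub (CoeffSmoothAt.C (hγ i))).pow 2

section Univ
variable {k : ℕ}

lemma pUniv_eq (α : ℝ × ℝ) (γ : Fin (k - 1) → ℝ) : pUniv k α γ =
    C α.1 * linProd (evens (k - 1)) γ ^ 2 + C α.2 * linProd (odds (k - 1)) γ ^ 2 := by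
  rw [pUniv, oddProd_eq_sq, evenProd_eq_sq]

lemma coeffSmoothAt_pUniv (x : (ℝ × ℝ) × (Fin (k - 1) → ℝ)) :
    CoeffSmoothAt (fun x : (ℝ × ℝ) × (Fin (k - 1) → ℝ) => pUniv k x.1 x.2) x := by
  simp only [pUniv_eq]
  have hγ : ∀ i, ContDiffAt ℝ ω (fun y : (ℝ × ℝ) × (Fin (k - 1) → ℝ) => y.2 i) x := fun i => by
    fun_prop
  exact ((CoeffSmoothAt.C (by fun_prop)).mul (coeffSmoothAt_linProd_sq _ hγ)).add
    ((CoeffSmoothAt.C (by fun_prop)).mul (coeffSmoothAt_linProd_sq _ hγ))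

lemma natDegree_pUniv_le (hk : Even k) (α : ℝ × ℝ) (γ : Fin (k - 1) → ℝ) :
    (pUniv k α γ).natDegree ≤ k := by
  rw [pUniv_eq]
  refine natDegree_add_le_of_degree_le ((natDegree_C_mul_le _ _).trans ?_)
    ((natDegree_C_mul_le _ _).trans ?_)
  all_goals
    rw [natDegree_pow, natDegree_linProd]
    first | rw [card_evens] | rw [card_odds]
    grind

/-- Among `k - 1` places, `k / 2` are odd and one fewer are even, so only the first squared product
reaches degree `k`. -/
lemma coeff_pUniv (hk : Even k) (hk2 : 2 ≤ k) (α : ℝ × ℝ) (γ : Fin (k - 1) → ℝ) :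
    (pUniv k α γ).coeff k = α.1 := by
  have h1 : (linProd (evens (k - 1)) γ ^ 2).natDegree = k := by
    rw [natDegree_pow, natDegree_linProd, card_evens]
    grind
  have h2 : (linProd (odds (k - 1)) γ ^ 2).natDegree < k := by
    rw [natDegree_pow, natDegree_linProd, card_odds]
    grind
  have h3 := ((linProd_monic (evens (k - 1)) γ).pow 2).coeff_natDegree
  rw [h1] at h3
  rw [pUniv_eq, coeff_add, coeff_C_mul, coeff_C_mul, h3, coeff_eq_zero_of_natDegree_lt h2]
  ring

lemma eval_pUniv (α : ℝ × ℝ) (γ : Fin (k - 1) → ℝ) (t : ℝ) : (pUniv k α γ).eval t =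
    α.1 * ((linProd (evens (k - 1)) γ).eval t) ^ 2 +
      α.2 * ((linProd (odds (k - 1)) γ).eval t) ^ 2 := by
  simp [pUniv_eq]

/-- The two products have no common root. -/
lemma eval_linProd_ne_zero_or {N : ℕ} {γ : Fin N → ℝ} (hγ : Function.Injective γ) (t : ℝ) :
    (linProd (evens N) γ).eval t ≠ 0 ∨ (linProd (odds N) γ).eval t ≠ 0 := by
  by_contra! h
  obtain ⟨i, hi, rfl⟩ := eval_linProd_eq_zero.1 h.1
  obtain ⟨j, hj, hji⟩ := eval_linProd_eq_zero.1 h.2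
  rw [hγ hji] at hj
  exact Finset.disjoint_left.1 (disjoint_evens_odds N) hi hj

lemma pUniv_mem (hk : Even k) (hk2 : 2 ≤ k) {x : (ℝ × ℝ) × (Fin (k - 1) → ℝ)}
    (hx : x ∈ dom univ k) : pUniv k x.1 x.2 ∈ PosPolys univ k := by
  obtain ⟨⟨h1, h2⟩, -, hγ⟩ := hx
  simp only [mem_Ioi] at h1 h2
  refine ⟨natDegree_pUniv_le hk _ _, fun t _ => ?_, Or.inr (by rwa [coeff_pUniv hk hk2])⟩
  rw [eval_pUniv]
  rcases eval_linProd_ne_zero_or hγ.injective t with h | h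
  · have := mul_pos h1 (sq_pos_of_ne_zero h)
    positivity
  · have := mul_pos h2 (sq_pos_of_ne_zero h)
    positivity

/-! ### The real line: injectivity of the differential -/

lemma eq_zero_of_fderiv_pUniv (hk : Even k) (hk2 : 2 ≤ k) {x : (ℝ × ℝ) × (Fin (k - 1) → ℝ)}
    (hx : x ∈ dom univ k) {v : (ℝ × ℝ) × (Fin (k - 1) → ℝ)}
    (hv : fderiv ℝ (fun x : (ℝ × ℝ) × (Fin (k - 1) → ℝ) => coeffVec k (pUniv k x.1 x.2)) x v = 0) :
    v = 0 := by
  classical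
  obtain ⟨⟨h1, h2⟩, -, hγ⟩ := hx
  simp only [mem_Ioi] at h1 h2
  have hdiff := (((coeffSmoothAt_pUniv x).coeffVec k).differentiableAt (by simp)).hasFDerivAt
  have hcurve : HasDerivAt (fun r : ℝ => x + r • v) v 0 := by
    simpa using ((hasDerivAt_id (0 : ℝ)).smul_const v).const_add x
  -- Evaluation at `t` turns the vanishing vector derivative into a scalar one along the line `x + r
  -- v`, where the product rule applies.
  have hcoeff : ∀ t : ℝ, HasDerivAt
      (fun r : ℝ => (pUniv k (x + r • v).1 (x + r • v).2).eval t) 0 0 := by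
    intro t
    have h0 : HasDerivAt (fun r : ℝ => coeffVec k (pUniv k (x + r • v).1 (x + r • v).2))
        (0 : Coeffs k) 0 := by
      rw [← hv]
      have hx0 : x = x + (0 : ℝ) • v := by simp
      rw [hx0] at hdiff
      exact hdiff.comp_hasDerivAt 0 hcurve |>.congr_deriv (by rw [← hx0])
    have h3 : ∀ r : ℝ, (pUniv k (x + r • v).1 (x + r • v).2).eval t =
        ∑ j : Fin (k + 1), coeffVec k (pUniv k (x + r • v).1 (x + r • v).2) j * t ^ (j : ℕ) := by
      intro r
      rw [← eval_toPoly, toPoly_coeffVec (natDegree_pUniv_le hk _ _)]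
    simp only [h3]
    have h4 : ∀ j : Fin (k + 1), HasDerivAt
        (fun r : ℝ => coeffVec k (pUniv k (x + r • v).1 (x + r • v).2) j * t ^ (j : ℕ)) 0 0 := by
      intro j
      have h5 := (EuclideanSpace.proj (𝕜 := ℝ) j).hasFDerivAt.comp_hasDerivAt 0 h0
      simpa using h5.mul_const (t ^ (j : ℕ))
    simpa using HasDerivAt.fun_sum (u := Finset.univ) fun j _ => h4 j
  -- The factor `-2` collects the derivative of the square and the sign of `γ` in `X - γ`.
  have key : linProd (evens (k - 1)) x.2 * (C v.1.1 * linProd (evens (k - 1)) x.2 +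
        C (-2 * x.1.1) * ∑ i ∈ evens (k - 1), C (v.2 i) * linProd ((evens (k - 1)).erase i) x.2) +
      linProd (odds (k - 1)) x.2 * (C v.1.2 * linProd (odds (k - 1)) x.2 +
        C (-2 * x.1.2) * ∑ i ∈ odds (k - 1), C (v.2 i) * linProd ((odds (k - 1)).erase i) x.2)
      = 0 := by
    refine Polynomial.funext fun t => ?_
    have hA := hasDerivAt_linProd (evens (k - 1)) x.2 v.2 t
    have hB := hasDerivAt_linProd (odds (k - 1)) x.2 v.2 t
    have ha : HasDerivAt (fun r : ℝ => x.1.1 + r * v.1.1) v.1.1 0 := by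
      simpa using ((hasDerivAt_id (0 : ℝ)).mul_const v.1.1).const_add x.1.1
    have hb : HasDerivAt (fun r : ℝ => x.1.2 + r * v.1.2) v.1.2 0 := by
      simpa using ((hasDerivAt_id (0 : ℝ)).mul_const v.1.2).const_add x.1.2
    have hder := (ha.mul (hA.pow 2)).add (hb.mul (hB.pow 2))
    have heq := (hcoeff t).unique (by
      convert! hder using 1
      funext r
      simp [eval_pUniv, eval_linProd])
    simp only [eval_add, eval_mul, eval_C, eval_zero, eval_finsetSum]
    simp only [zero_mul, add_zero, Pi.pow_apply, ← eval_linProd] at heq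
    rw [heq]
    push_cast
    ring
  have := eq_zero_of_linearized_sq_eq_zero hγ.injective (disjoint_evens_odds (k - 1))
    (by rw [card_evens, card_odds]; grind) (by linarith) (by linarith) key
  refine Prod.ext (Prod.ext this.1.1 this.2.1) (funext fun j => ?_)
  rcases Nat.even_or_odd (j : ℕ) with hj | hj
  · exact this.1.2 j (by simpa using hj)
  · exact this.2.2 j (by simpa using hj)

end Univ

/-! ### The real line: injectivity -/

/-- Interlacing: the quotient of the two products maps the upper half plane into itself. -/
lemma exists_interlacing_repr (σ : ℕ → ℝ) (r : ℕ) (hσ : ∀ j < 2 * r, σ j < σ (j + 1)) {z : ℂ}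
    (hz : 0 < z.im) : ∃ x y : ℝ, 0 ≤ x ∧ 0 < y ∧
      ∏ i ∈ Finset.range (r + 1), (z - σ (2 * i)) =
        (x + y * (z - σ (2 * r))) * ∏ i ∈ Finset.range r, (z - σ (2 * i + 1)) := by
  induction r with
  | zero => exact ⟨0, 1, le_rfl, one_pos, by simp⟩
  | succ r ih =>
    obtain ⟨x, y, hx, hy, h⟩ := ih fun j hj => hσ j (by omega)
    have h1 := hσ (2 * r) (by omega)
    have h2 := hσ (2 * r + 1) (by omega)
    set u : ℂ := z - σ (2 * r + 1) with hu
    have hnu : 0 < Complex.normSq u := by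
      rw [Complex.normSq_pos]
      intro h0
      have := congrArg Complex.im h0
      simp [hu] at this
      exact hz.ne' this
    set p := σ (2 * r + 1) - σ (2 * r) with hp
    set q := σ (2 * (r + 1)) - σ (2 * r + 1) with hq
    have hp0 : 0 < p := sub_pos.2 h1
    have hq0 : 0 < q := sub_pos.2 h2
    have hm : z - σ (2 * r) = u + p := by simp [hu, hp]
    have hn : z - σ (2 * (r + 1)) = u - q := by simp [hu, hq]
    have hx' : 0 ≤ x + y * p := by positivity
    -- These come from `(u - q) / u = |u - q|² / |u|² + (q / |u|²) (u - q)`, multiplied by `x + y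
    -- p`; the rest of the old quotient adds `y (u - q)`.
    refine ⟨(x + y * p) * (Complex.normSq (u - q) / Complex.normSq u),
      (x + y * p) * (q / Complex.normSq u) + y,
      mul_nonneg hx' (div_nonneg (Complex.normSq_nonneg _) hnu.le), by positivity, ?_⟩
    rw [Finset.prod_range_succ, h, Finset.prod_range_succ _ r, ← hu, hm, hn]
    have hid : (x + y * p + y * u : ℂ) * (u - q) =
        (((x + y * p) * (Complex.normSq (u - q) / Complex.normSq u) : ℝ) +
          ((x + y * p) * (q / Complex.normSq u) + y : ℝ) * (u - q)) * u := by
      have hne : (Complex.normSq u : ℂ) ≠ 0 := by exact_mod_cast hnu.ne'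
      have hc : (Complex.normSq (u - q) : ℂ) = (u - q) * ((starRingEnd ℂ) u - q) := by
        rw [Complex.normSq_eq_conj_mul_self, map_sub, Complex.conj_ofReal, mul_comm]
      have hc' : (Complex.normSq u : ℂ) = (starRingEnd ℂ) u * u :=
        Complex.normSq_eq_conj_mul_self
      push_cast
      field_simp
      rw [hc, hc']
      ring
    linear_combination (∏ i ∈ Finset.range r, (z - σ (2 * i + 1))) * hid

/-- Extension of a tuple by zero. -/
def extendZero {N : ℕ} (γ : Fin N → ℝ) (j : ℕ) : ℝ := if h : j < N then γ ⟨j, h⟩ else 0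

lemma extendZero_val {N : ℕ} (γ : Fin N → ℝ) (j : Fin N) : extendZero γ j = γ j := by
  simp [extendZero]

/-- The Hermite–Biehler polynomial `√α₁ ∏ (X - γ_{2j-1}) + i ε √α₂ ∏ (X - γ_{2j})`. -/
def hermiteBiehler {N : ℕ} (ε : ℝ) (α : ℝ × ℝ) (γ : Fin N → ℝ) : ℂ[X] :=
  C (√α.1 : ℂ) * (linProd (evens N) γ).map (algebraMap ℝ ℂ) +
    C (Complex.I * ε * √α.2) * (linProd (odds N) γ).map (algebraMap ℝ ℂ)

lemma eval_hermiteBiehler {N : ℕ} (ε : ℝ) (α : ℝ × ℝ) (γ : Fin N → ℝ) (z : ℂ) :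
    (hermiteBiehler ε α γ).eval z = √α.1 * aeval z (linProd (evens N) γ) +
      Complex.I * ε * √α.2 * aeval z (linProd (odds N) γ) := by
  simp [hermiteBiehler]

lemma eval_hermiteBiehler_ofReal {N : ℕ} (ε : ℝ) (α : ℝ × ℝ) (γ : Fin N → ℝ) (t : ℝ) :
    (hermiteBiehler ε α γ).eval (t : ℂ) =
      ((√α.1 * (linProd (evens N) γ).eval t : ℝ) : ℂ) +
        ((ε * √α.2 * (linProd (odds N) γ).eval t : ℝ) : ℂ) * Complex.I := by
  have h : ∀ p : ℝ[X], aeval (t : ℂ) p = ((p.eval t : ℝ) : ℂ) := fun p => by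
    simpa using aeval_algebraMap_apply ℂ t p
  rw [eval_hermiteBiehler, h, h]
  push_cast
  ring

/-- Changing the sign of `ε` conjugates the coefficients, hence reflects the roots in the real axis.
-/
lemma eval_hermiteBiehler_neg {N : ℕ} (ε : ℝ) (α : ℝ × ℝ) (γ : Fin N → ℝ) (z : ℂ) :
    (hermiteBiehler (-ε) α γ).eval z =
      (starRingEnd ℂ) ((hermiteBiehler ε α γ).eval ((starRingEnd ℂ) z)) := by
  simp [eval_hermiteBiehler, aeval_conj]

lemma hermiteBiehler_mul {N : ℕ} {α : ℝ × ℝ} (h1 : 0 ≤ α.1) (h2 : 0 ≤ α.2) (γ : Fin N → ℝ) :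
    hermiteBiehler 1 α γ * hermiteBiehler (-1) α γ =
      (C α.1 * linProd (evens N) γ ^ 2 + C α.2 * linProd (odds N) γ ^ 2).map (algebraMap ℝ ℂ) := by
  refine Polynomial.funext fun z => ?_
  have e1 : ((√α.1 : ℝ) : ℂ) ^ 2 = α.1 := by exact_mod_cast Real.sq_sqrt h1
  have e2 : ((√α.2 : ℝ) : ℂ) ^ 2 = α.2 := by exact_mod_cast Real.sq_sqrt h2
  simp only [eval_mul, eval_hermiteBiehler, eval_map_algebraMap, map_add, map_mul, map_pow,
    aeval_C, Complex.coe_algebraMap, ← e1, ← e2]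
  push_cast
  linear_combination (-(aeval z (linProd (odds N) γ)) ^ 2 * (√α.2 : ℂ) ^ 2) * Complex.I_sq

/-- All roots of the Hermite–Biehler polynomial lie in the open lower half plane. -/
lemma eval_hermiteBiehler_ne_zero {r : ℕ} {α : ℝ × ℝ} (h1 : 0 < α.1) (h2 : 0 < α.2)
    {γ : Fin (2 * r + 1) → ℝ} (hγ : StrictMono γ) {z : ℂ} (hz : 0 ≤ z.im) :
    (hermiteBiehler 1 α γ).eval z ≠ 0 := by
  have s1 := Real.sqrt_pos.2 h1
  have s2 := Real.sqrt_pos.2 h2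
  rcases hz.eq_or_lt with hz | hz
  · have hzr : z = (z.re : ℂ) := Complex.ext rfl (by simp [hz])
    rw [hzr, eval_hermiteBiehler_ofReal]
    intro h
    have hre := congrArg Complex.re h
    have him := congrArg Complex.im h
    simp [s1.ne', s2.ne'] at hre him
    rcases eval_linProd_ne_zero_or hγ.injective z.re with h' | h'
    exacts [h' hre, h' him]
  · have hσ : ∀ j < 2 * r, extendZero γ j < extendZero γ (j + 1) := by
      intro j hj
      rw [extendZero, dif_pos (by omega), extendZero, dif_pos (by omega)]
      exact hγ (by simp [Fin.lt_def])
    obtain ⟨x, y, hx, hy, h⟩ := exists_interlacing_repr (extendZero γ) r hσ hz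
    have hF : aeval z (linProd (evens (2 * r + 1)) γ) =
        ∏ i ∈ Finset.range (r + 1), (z - extendZero γ (2 * i)) := by
      have := prod_evens (fun j => z - (extendZero γ j : ℂ)) (2 * r + 1)
      rw [show (2 * r + 1 + 1) / 2 = r + 1 by omega] at this
      rw [← this]
      simp [linProd, extendZero_val]
    have hG : aeval z (linProd (odds (2 * r + 1)) γ) =
        ∏ i ∈ Finset.range r, (z - extendZero γ (2 * i + 1)) := by
      have := prod_odds (fun j => z - (extendZero γ j : ℂ)) (2 * r + 1)
      rw [show (2 * r + 1) / 2 = r by omega] at this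
      rw [← this]
      simp [linProd, extendZero_val]
    have hG0 : aeval z (linProd (odds (2 * r + 1)) γ) ≠ 0 := by
      rw [hG, Finset.prod_ne_zero_iff]
      intro i _ h0
      have := congrArg Complex.im h0
      simp at this
      exact hz.ne' this
    rw [eval_hermiteBiehler, hF, h, ← hG]
    intro h0
    have h3 : (√α.1 * (x + y * (z - extendZero γ (2 * r))) + Complex.I * √α.2 : ℂ) = 0 := by
      refine (mul_eq_zero.1 ?_).resolve_right hG0
      push_cast at h0
      linear_combination h0
    -- The imaginary part is `√α.1 * y * z.im + √α.2`, a sum of positive terms.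
    have h4 := congrArg Complex.im h3
    simp at h4
    have : 0 < √α.1 * (y * z.im) := by positivity
    linarith

lemma natDegree_hermiteBiehler {r : ℕ} {α : ℝ × ℝ} (h1 : 0 < α.1) (γ : Fin (2 * r + 1) → ℝ) :
    (hermiteBiehler 1 α γ).natDegree = r + 1 ∧
      (hermiteBiehler 1 α γ).leadingCoeff = (√α.1 : ℝ) := by
  have s1 : ((√α.1 : ℝ) : ℂ) ≠ 0 := by exact_mod_cast (Real.sqrt_pos.2 h1).ne'
  have hd1 : ((linProd (evens (2 * r + 1)) γ).map (algebraMap ℝ ℂ)).natDegree = r + 1 := by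
    rw [natDegree_map, natDegree_linProd, card_evens]
    omega
  have hd2 : ((linProd (odds (2 * r + 1)) γ).map (algebraMap ℝ ℂ)).natDegree = r := by
    rw [natDegree_map, natDegree_linProd, card_odds]
    omega
  have hd3 : (C (√α.1 : ℂ) * (linProd (evens (2 * r + 1)) γ).map (algebraMap ℝ ℂ)).natDegree =
      r + 1 := by rw [natDegree_C_mul s1, hd1]
  have hlt : (C (Complex.I * (1 : ℝ) * √α.2) *
      (linProd (odds (2 * r + 1)) γ).map (algebraMap ℝ ℂ)).natDegree <
      (C (√α.1 : ℂ) * (linProd (evens (2 * r + 1)) γ).map (algebraMap ℝ ℂ)).natDegree := by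
    rw [hd3]
    exact (natDegree_C_mul_le _ _).trans_lt (by omega)
  refine ⟨(natDegree_add_eq_left_of_natDegree_lt hlt).trans hd3, ?_⟩
  rw [hermiteBiehler, leadingCoeff_add_of_degree_lt' (degree_lt_degree hlt), leadingCoeff_mul,
    leadingCoeff_C, ((linProd_monic _ γ).map _).leadingCoeff, mul_one]

/-- One factor has its roots below the real axis and the conjugate of the other has them above, so
the two are coprime. Hence the first divides the second; equal degrees and leading coefficients give
equality. -/
lemma hermiteBiehler_inj {r : ℕ} {α β : ℝ × ℝ} (h1 : 0 < α.1) (h2 : 0 < α.2) (h3 : 0 < β.1)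
    (h4 : 0 < β.2) {γ η : Fin (2 * r + 1) → ℝ} (hγ : StrictMono γ) (hη : StrictMono η)
    (h11 : α.1 = β.1)
    (h : C α.1 * linProd (evens (2 * r + 1)) γ ^ 2 + C α.2 * linProd (odds (2 * r + 1)) γ ^ 2 =
      C β.1 * linProd (evens (2 * r + 1)) η ^ 2 + C β.2 * linProd (odds (2 * r + 1)) η ^ 2) :
    hermiteBiehler 1 α γ = hermiteBiehler 1 β η := by
  have hcop : IsCoprime (hermiteBiehler 1 α γ) (hermiteBiehler (-1) β η) := by
    rw [isCoprime_iff_aeval_ne_zero_of_isAlgClosed ℂ ℂ]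
    intro z
    simp only [coe_aeval_eq_eval]
    rcases le_total 0 z.im with hz | hz
    · exact Or.inl (eval_hermiteBiehler_ne_zero h1 h2 hγ hz)
    · right
      rw [eval_hermiteBiehler_neg, Ne, map_eq_zero]
      exact eval_hermiteBiehler_ne_zero h3 h4 hη (by simpa using hz)
  have hdvd : hermiteBiehler 1 α γ ∣ hermiteBiehler 1 β η := by
    refine hcop.dvd_of_dvd_mul_right ?_
    rw [hermiteBiehler_mul h3.le h4.le, ← h, ← hermiteBiehler_mul h1.le h2.le]
    exact dvd_mul_right _ _
  obtain ⟨hd, hl⟩ := natDegree_hermiteBiehler h1 γ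
  obtain ⟨hd', hl'⟩ := natDegree_hermiteBiehler h3 η
  refine eq_of_dvd_of_natDegree_le_of_leadingCoeff hdvd (by omega) ?_
  rw [hl, hl', h11]

/-- Real and imaginary parts on the real axis separate the two products. Their zeros together form
the range of `γ`, and a strictly increasing tuple is determined by its range. -/
theorem pUniv_injOn {k : ℕ} (hk : Even k) (hk2 : 2 ≤ k) :
    InjOn (fun x : (ℝ × ℝ) × (Fin (k - 1) → ℝ) => pUniv k x.1 x.2) (dom univ k) := by
  rintro ⟨α, γ⟩ ⟨⟨h1, h2⟩, -, hγ⟩ ⟨β, η⟩ ⟨⟨h3, h4⟩, -, hη⟩ h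
  simp only [mem_Ioi] at h1 h2 h3 h4 h hγ hη
  have h11 : α.1 = β.1 := by rw [← coeff_pUniv hk hk2 α γ, h, coeff_pUniv hk hk2]
  rw [pUniv_eq, pUniv_eq] at h
  obtain ⟨r, hr⟩ : ∃ r, k - 1 = 2 * r + 1 := by
    obtain ⟨m, rfl⟩ := hk
    exact ⟨m - 1, by omega⟩
  clear hk hk2
  generalize k - 1 = N at *
  subst hr
  have hH := hermiteBiehler_inj h1 h2 h3 h4 hγ hη h11 h
  have hval : ∀ t : ℝ,
      √α.1 * (linProd (evens (2 * r + 1)) γ).eval t =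
        √β.1 * (linProd (evens (2 * r + 1)) η).eval t ∧
      √α.2 * (linProd (odds (2 * r + 1)) γ).eval t =
        √β.2 * (linProd (odds (2 * r + 1)) η).eval t := by
    intro t
    have := congrArg (eval (t : ℂ)) hH
    rw [eval_hermiteBiehler_ofReal, eval_hermiteBiehler_ofReal] at this
    have hre := congrArg Complex.re this
    have him := congrArg Complex.im this
    simp at hre him
    exact ⟨hre, him⟩
  have hrange : ∀ (α : ℝ × ℝ) (γ : Fin (2 * r + 1) → ℝ), 0 < α.1 → 0 < α.2 → range γ =
      {t | √α.1 * (linProd (evens (2 * r + 1)) γ).eval t = 0 ∨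
        √α.2 * (linProd (odds (2 * r + 1)) γ).eval t = 0} := by
    intro α γ h1 h2
    ext t
    have s1 := (Real.sqrt_pos.2 h1).ne'
    have s2 := (Real.sqrt_pos.2 h2).ne'
    simp only [mem_range, mem_ofPred_eq, mul_eq_zero, s1, s2, false_or, eval_linProd_eq_zero]
    constructor
    · rintro ⟨i, hi⟩
      rcases Nat.even_or_odd (i : ℕ) with h | h
      · exact Or.inl ⟨i, by simpa using h, hi⟩
      · exact Or.inr ⟨i, by simpa using h, hi⟩
    · rintro (⟨i, -, hi⟩ | ⟨i, -, hi⟩) <;> exact ⟨i, hi⟩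
  have hγη : γ = η := by
    rw [← StrictMono.range_inj hγ hη, hrange α γ h1 h2, hrange β η h3 h4]
    ext t
    simp only [mem_ofPred_eq, (hval t).1, (hval t).2]
  subst hγη
  have h22 : √α.2 = √β.2 := by
    -- The index `0` is even, so `γ 0` is a root of the other product and not of this one.
    have hne : (linProd (odds (2 * r + 1)) γ).eval (γ 0) ≠ 0 := by
      refine (eval_linProd_ne_zero_or hγ.injective (γ 0)).resolve_left fun hc => hc ?_
      exact eval_linProd_eq_zero.2 ⟨0, by simp, rfl⟩
    exact mul_right_cancel₀ hne (hval (γ 0)).2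
  rw [Real.sqrt_inj (le_of_lt h2) (le_of_lt h4)] at h22
  exact Prod.ext (Prod.ext h11 h22) rfl

/-! ### The real line: surjectivity -/

lemma convex_posPolys_univ (k : ℕ) : Convex ℝ {c : Coeffs k | toPoly c ∈ PosPolys univ k} := by
  have hns : ¬ Bornology.IsBounded (univ : Set ℝ) := by
    simpa using NormedSpace.unbounded_univ ℝ ℝ
  intro c hc d hd a b ha hb hab
  have hcomb : ∀ u v : ℝ, 0 < u → 0 < v → 0 < a * u + b * v := fun u v hu hv => by
    rcases ha.eq_or_lt with rfl | ha'
    · have : b = 1 := by linarith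
      subst this; linarith
    · have := mul_pos ha' hu
      have := mul_nonneg hb hv.le
      linarith
  refine ⟨natDegree_toPoly_le _, fun t ht => ?_, Or.inr ?_⟩
  · have := hcomb _ _ (hc.2.1 t ht) (hd.2.1 t ht)
    simp only [eval_toPoly, Finset.mul_sum] at this ⊢
    rw [← Finset.sum_add_distrib] at this
    convert! this using 2
    simp
    ring
  · have := hcomb _ _ (hc.2.2.resolve_left hns) (hd.2.2.resolve_left hns)
    simpa [coeff_toPoly] using this

/-- There is an integer at distance at least one from `N` given reals. -/
lemma exists_far_point {N : ℕ} (γ : Fin N → ℝ) :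
    ∃ i : Fin (N + 1), ∀ j, 1 ≤ |2 * (i : ℝ) - γ j| := by
  by_contra! h
  choose f hf using h
  -- Two of the `N + 1` even integers cannot both be at distance less than one from the same `γ j`;
  -- the pigeonhole principle then gives the contradiction.
  have hinj : Function.Injective f := by
    intro i i' hii
    have h1 := hf i
    have h2 := hf i'
    rw [← hii] at h2
    rw [abs_lt] at h1 h2
    have h3 : (i : ℝ) < i' + 1 := by linarith
    have h4 : (i' : ℝ) < i + 1 := by linarith
    have h3' : (i : ℕ) < i' + 1 := by exact_mod_cast h3
    have h4' : (i' : ℕ) < i + 1 := by exact_mod_cast h4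
    exact Fin.ext (by omega)
  simpa using Fintype.card_le_of_injective f hinj

/-- Limits of parameters may a priori lie on the boundary of the parameter set. If `b = 0`, the
polynomial vanishes at `γ 0`; if two consecutive entries coincide, their indices have opposite
parity and both products vanish there. -/
lemma pos_of_eval_pos {r : ℕ} {a b : ℝ} (hb : 0 ≤ b) {γ : Fin (2 * r + 1) → ℝ}
    (hγ : Monotone γ)
    (h : ∀ t, 0 < a * ((linProd (evens (2 * r + 1)) γ).eval t) ^ 2 +
      b * ((linProd (odds (2 * r + 1)) γ).eval t) ^ 2) :
    0 < b ∧ StrictMono γ := by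
  constructor
  · refine hb.lt_of_ne fun hb0 => ?_
    have := h (γ 0)
    rw [eval_linProd_eq_zero.2 ⟨0, by simp, rfl⟩, ← hb0] at this
    simp at this
  · rw [Fin.strictMono_iff_lt_succ]
    intro i
    refine (hγ (Fin.castSucc_le_succ i)).lt_of_ne fun heq => ?_
    have := h (γ i.castSucc)
    rcases Nat.even_or_odd (i : ℕ) with hi | hi
    · rw [eval_linProd_eq_zero.2 ⟨i.castSucc, by simpa using hi, rfl⟩,
        eval_linProd_eq_zero.2 ⟨i.succ, by simpa using hi.add_one, heq.symm⟩] at this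
      simp at this
    · rw [eval_linProd_eq_zero.2 ⟨i.succ, by simpa using hi.add_one, heq.symm⟩,
        eval_linProd_eq_zero.2 ⟨i.castSucc, by simpa using hi, rfl⟩] at this
      simp at this

lemma one_le_eval_linProd_sq {ι : Type*} {s : Finset ι} {γ : ι → ℝ} {t : ℝ}
    (h : ∀ j, 1 ≤ |t - γ j|) : 1 ≤ ((linProd s γ).eval t) ^ 2 := by
  rw [eval_linProd, ← Finset.prod_pow]
  exact Finset.one_le_prod fun j _ => (one_le_sq_iff_one_le_abs _).2 (h j)

lemma sq_le_eval_linProd_sq {ι : Type*} [DecidableEq ι] {s : Finset ι} {γ : ι → ℝ} {t : ℝ}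
    (h : ∀ j, 1 ≤ |t - γ j|) {i : ι} (hi : i ∈ s) :
    (t - γ i) ^ 2 ≤ ((linProd s γ).eval t) ^ 2 := by
  have h1 := one_le_eval_linProd_sq (s := s.erase i) h
  rw [eval_linProd] at h1
  rw [eval_linProd, ← Finset.mul_prod_erase s _ hi, mul_pow]
  exact le_mul_of_one_le_right (sq_nonneg _) h1

/-- At a test point at distance at least one from all roots both squared products are at least one,
which bounds `b` and the entries with even index. The first and last indices are even, so by
monotonicity the other entries are trapped. -/
lemma param_bound {r : ℕ} {a b κ M : ℝ} (hκ : 0 < κ) (ha : κ ≤ a) (hb : 0 ≤ b)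
    {γ : Fin (2 * r + 1) → ℝ} (hγ : Monotone γ)
    (h : ∀ i : Fin (2 * r + 2), a * ((linProd (evens (2 * r + 1)) γ).eval (2 * (i : ℝ))) ^ 2 +
      b * ((linProd (odds (2 * r + 1)) γ).eval (2 * (i : ℝ))) ^ 2 ≤ M) :
    b ≤ M ∧ ∀ j, |γ j| ≤ 2 * (2 * r + 2) + 1 + M / κ := by
  obtain ⟨i, hi⟩ := exists_far_point γ
  have hM := h i
  have hF := one_le_eval_linProd_sq (s := evens (2 * r + 1)) hi
  have hG := one_le_eval_linProd_sq (s := odds (2 * r + 1)) hi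
  have hi0 : (0 : ℝ) ≤ i := by positivity
  have hi1 : (i : ℝ) ≤ 2 * r + 2 := by exact_mod_cast i.2.le
  have ha0 : 0 < a := hκ.trans_le ha
  have hev : ∀ j ∈ evens (2 * r + 1), |γ j| ≤ 2 * (2 * r + 2) + 1 + M / κ := by
    intro j hj
    have h1 := sq_le_eval_linProd_sq hi hj
    have h2 : κ * (2 * (i : ℝ) - γ j) ^ 2 ≤ M := by
      have := mul_le_mul ha h1 (sq_nonneg _) ha0.le
      have := mul_nonneg hb (zero_le_one.trans hG)
      linarith
    have h3 : (2 * (i : ℝ) - γ j) ^ 2 ≤ M / κ := by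
      rw [le_div_iff₀ hκ]
      linarith
    have h4 : |2 * (i : ℝ) - γ j| ≤ 1 + (2 * (i : ℝ) - γ j) ^ 2 := by
      rw [← sq_abs]
      nlinarith [sq_nonneg (|2 * (i : ℝ) - γ j| - 1)]
    have h5 := abs_le.1 (h4.trans (add_le_add_right h3 1))
    rw [abs_le]
    constructor <;> linarith
  refine ⟨?_, fun j => ?_⟩
  · have := mul_nonneg ha0.le (zero_le_one.trans hF)
    have := le_mul_of_one_le_right hb hG
    linarith
  · have h0 := abs_le.1 (hev 0 (by simp))
    have h1 := abs_le.1 (hev (Fin.last _) (by simp))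
    exact abs_le.2 ⟨h0.1.trans (hγ (Fin.zero_le j)), (hγ (Fin.le_last j)).trans h1.2⟩

section Univ
variable {k : ℕ}

/-- Relative closedness: if the limit is positive, the parameters stay in a compact box, a limit of
them represents the limit polynomial, and positivity keeps that limit inside the parameter set. -/
lemma closure_image_inter_subset (hk : Even k) (hk2 : 2 ≤ k) :
    closure ((fun x => coeffVec k (pUniv k x.1 x.2)) '' dom univ k) ∩
      {c : Coeffs k | toPoly c ∈ PosPolys univ k} ⊆
    (fun x => coeffVec k (pUniv k x.1 x.2)) '' dom univ k := by
  rintro c ⟨hc, hpos⟩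
  obtain ⟨y, hy, hlim⟩ := mem_closure_iff_seq_limit.1 hc
  choose x hx hxy using hy
  have hcoeffk : 0 < (toPoly c).coeff k :=
    hpos.2.2.resolve_left (by simpa using NormedSpace.unbounded_univ ℝ ℝ)
  have htp : ∀ j, toPoly (y j) = pUniv k (x j).1 (x j).2 := fun j => by
    rw [← hxy, toPoly_coeffVec (natDegree_pUniv_le hk _ _)]
  have heval : ∀ t : ℝ, Tendsto (fun j => (toPoly (y j)).eval t) atTop (𝓝 ((toPoly c).eval t)) :=
    fun t => ((continuous_eval_toPoly.comp (Continuous.prodMk_left t)).tendsto c).comp hlim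
  have hα : Tendsto (fun j => (x j).1.1) atTop (𝓝 ((toPoly c).coeff k)) := by
    have h1 : ∀ j, (x j).1.1 = (toPoly (y j)).coeff k := fun j => by
      rw [htp, coeff_pUniv hk hk2]
    have h2 : Continuous fun d : Coeffs k => (toPoly d).coeff k := by
      simp only [coeff_toPoly, lt_add_one, dite_true]
      fun_prop
    simp only [h1]
    exact (h2.tendsto c).comp hlim
  obtain ⟨r, hr⟩ : ∃ r, k = 2 * r + 2 := by
    obtain ⟨m, rfl⟩ := hk
    exact ⟨m - 1, by omega⟩
  subst hr
  have hform : ∀ (x : (ℝ × ℝ) × (Fin (2 * r + 2 - 1) → ℝ)) (t : ℝ),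
      (pUniv (2 * r + 2) x.1 x.2).eval t =
        x.1.1 * ((linProd (evens (2 * r + 1)) x.2).eval t) ^ 2 +
        x.1.2 * ((linProd (odds (2 * r + 1)) x.2).eval t) ^ 2 := fun x t => eval_pUniv x.1 x.2 t
  set κ := (toPoly c).coeff (2 * r + 2) / 2 with hκ
  have hκ0 : 0 < κ := by positivity
  -- The limit has positive values at the test points, so `M` strictly exceeds each of them and
  -- bounds the approximating values eventually.
  set M := 1 + ∑ i : Fin (2 * r + 2), (toPoly c).eval (2 * (i : ℝ)) with hM
  have hMi : ∀ i : Fin (2 * r + 2), (toPoly c).eval (2 * (i : ℝ)) < M := fun i => by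
    have := Finset.single_le_sum (f := fun i : Fin (2 * r + 2) => (toPoly c).eval (2 * (i : ℝ)))
      (fun i _ => (hpos.2.1 (2 * (i : ℝ)) (mem_univ _)).le) (Finset.mem_univ i)
    linarith
  have hev : ∀ᶠ j in atTop, x j ∈ (Icc 0 ((toPoly c).coeff (2 * r + 2) + 1) ×ˢ Icc 0 M) ×ˢ
      {γ : Fin (2 * r + 2 - 1) → ℝ | ∀ i, γ i ∈
        Icc (-(2 * (2 * r + 2) + 1 + M / κ)) (2 * (2 * r + 2) + 1 + M / κ)} := by
    have h1 : ∀ᶠ j in atTop, κ < (x j).1.1 := hα.eventually_const_lt (by linarith)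
    have h2 : ∀ᶠ j in atTop, (x j).1.1 < (toPoly c).coeff (2 * r + 2) + 1 :=
      hα.eventually_lt_const (by linarith)
    have h3 : ∀ᶠ j in atTop, ∀ i : Fin (2 * r + 2), (toPoly (y j)).eval (2 * (i : ℝ)) < M :=
      eventually_all.2 fun i => (heval _).eventually_lt_const (hMi i)
    filter_upwards [h1, h2, h3] with j h1 h2 h3
    have hd := hx j
    have hb0 : 0 ≤ (x j).1.2 := le_of_lt hd.1.2
    have := param_bound (γ := (x j).2) hκ0 h1.le hb0 hd.2.2.monotone fun i => by
      rw [← hform, ← htp]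
      exact (h3 i).le
    exact ⟨⟨⟨(hκ0.trans h1).le, h2.le⟩, hb0, this.1⟩, fun i => abs_le.1 (this.2 i)⟩
  have hcomp : IsCompact ((Icc 0 ((toPoly c).coeff (2 * r + 2) + 1) ×ˢ Icc 0 M) ×ˢ
      {γ : Fin (2 * r + 2 - 1) → ℝ | ∀ i, γ i ∈
        Icc (-(2 * (2 * r + 2) + 1 + M / κ)) (2 * (2 * r + 2) + 1 + M / κ)}) :=
    (isCompact_Icc.prod isCompact_Icc).prod (isCompact_pi_infinite fun _ => isCompact_Icc)
  obtain ⟨z, hz, φ, hφ, hzlim⟩ := hcomp.tendsto_subseq' hev.frequently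
  have hzc : coeffVec (2 * r + 2) (pUniv (2 * r + 2) z.1 z.2) = c := by
    refine tendsto_nhds_unique ?_ (hlim.comp hφ.tendsto_atTop)
    have := (((coeffSmoothAt_pUniv z).coeffVec (2 * r + 2)).continuousAt.tendsto).comp hzlim
    refine this.congr fun j => ?_
    exact hxy (φ j)
  have hzp : toPoly c = pUniv (2 * r + 2) z.1 z.2 := by
    rw [← hzc, toPoly_coeffVec (natDegree_pUniv_le hk _ _)]
  have hz1 : 0 < z.1.1 := by
    rw [← coeff_pUniv hk hk2 z.1 z.2, ← hzp]
    exact hcoeffk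
  have hmono : Monotone z.2 := by
    intro i j hij
    refine le_of_tendsto_of_tendsto' (f := fun m => (x (φ m)).2 i) (g := fun m => (x (φ m)).2 j)
      (b := atTop) ?_ ?_ fun m => (hx (φ m)).2.2.monotone hij
    · exact ((continuous_apply i).comp continuous_snd).continuousAt.tendsto.comp hzlim
    · exact ((continuous_apply j).comp continuous_snd).continuousAt.tendsto.comp hzlim
  have := pos_of_eval_pos (γ := z.2) (a := z.1.1) hz.1.2.1 hmono fun t => by
    rw [← hform, ← hzp]
    exact hpos.2.1 t (mem_univ t)
  exact ⟨z, ⟨⟨hz1, this.1⟩, by simp, this.2⟩, hzc⟩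

lemma isOpen_strictMono (m : ℕ) : IsOpen {γ : Fin m → ℝ | StrictMono γ} := by
  have : {γ : Fin m → ℝ | StrictMono γ} =
      ⋂ i : Fin m, ⋂ j : Fin m, {γ | i < j → γ i < γ j} := by
    ext γ
    simp [StrictMono]
  rw [this]
  refine isOpen_iInter_of_finite fun i => isOpen_iInter_of_finite fun j => ?_
  by_cases h : i < j
  · simpa [h] using isOpen_lt (continuous_apply i) (continuous_apply j)
  · simp [h]

lemma isOpen_dom (T : Set ℝ) (k : ℕ) : IsOpen (dom T k) := by
  have h : Delta T (k - 1) = (univ.pi fun _ => interior T) ∩ {γ | StrictMono γ} := by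
    ext γ
    simp [Delta]
  refine (isOpen_Ioi.prod isOpen_Ioi).prod ?_
  rw [h]
  exact (isOpen_set_pi finite_univ fun _ _ => isOpen_interior).inter (isOpen_strictMono _)

/-- The image is nonempty, open and relatively closed in a convex set, so connectedness yields
surjectivity. -/
theorem isChart_univ (hk : Even k) (hk2 : 2 ≤ k) :
    IsChart univ k (fun x : (ℝ × ℝ) × (Fin (k - 1) → ℝ) => pUniv k x.1 x.2) (dom univ k) := by
  have hinj : InjOn (fun x : (ℝ × ℝ) × (Fin (k - 1) → ℝ) => coeffVec k (pUniv k x.1 x.2))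
      (dom univ k) := fun x hx y hy h =>
    pUniv_injOn hk hk2 hx hy
      (coeffVec_injOn k (natDegree_pUniv_le hk _ _) (natDegree_pUniv_le hk _ _) h)
  obtain ⟨hopen, g, hg⟩ := exists_analytic_inverse (isOpen_dom univ k) hinj
    (fun x _ => (coeffSmoothAt_pUniv x).coeffVec k)
    (by simp; omega)
    (fun x hx v hv => eq_zero_of_fderiv_pUniv hk hk2 hx hv)
  have hsub : (fun x : (ℝ × ℝ) × (Fin (k - 1) → ℝ) => coeffVec k (pUniv k x.1 x.2)) ''
      dom univ k ⊆ {c : Coeffs k | toPoly c ∈ PosPolys univ k} := by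
    rintro _ ⟨x, hx, rfl⟩
    simp only [mem_ofPred_eq]
    rw [toPoly_coeffVec (natDegree_pUniv_le hk _ _)]
    exact pUniv_mem hk hk2 hx
  have hne : (dom univ k).Nonempty := by
    refine ⟨((1, 1), fun i => (i : ℕ)), ⟨by simp, by simp⟩, by simp, fun i j hij => ?_⟩
    exact Nat.cast_lt.2 hij
  have hsurj : {c : Coeffs k | toPoly c ∈ PosPolys univ k} ⊆
      (fun x : (ℝ × ℝ) × (Fin (k - 1) → ℝ) => coeffVec k (pUniv k x.1 x.2)) '' dom univ k := by
    refine (convex_posPolys_univ k).isPreconnected.subset_of_closure_inter_subset hopen ?_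
      (closure_image_inter_subset hk hk2)
    rw [inter_eq_right.2 hsub]
    exact hne.image _
  refine ⟨coeffSmoothAt_pUniv, ⟨fun x hx => pUniv_mem hk hk2 hx, pUniv_injOn hk hk2, ?_⟩, ?_,
    g, hg⟩
  · intro p hp
    obtain ⟨x, hx, hxp⟩ := hsurj (show coeffVec k p ∈ {c : Coeffs k | toPoly c ∈ PosPolys univ k} by
      simp only [mem_ofPred_eq]
      rwa [toPoly_coeffVec hp.1])
    exact ⟨x, hx, coeffVec_injOn k (natDegree_pUniv_le hk _ _) hp.1 hxp⟩
  · rw [hsurj.antisymm hsub]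
    exact hopen

end Univ

/-! ### The half line -/

/-- Opposite entries pair up to `t² - s²`, and the central entry `0` contributes the factor `t` when
its index is selected. -/
lemma prod_symmetric (P : ℕ → Prop) [DecidablePred P] {m : ℕ}
    (hP : ∀ i < m, (P (m - 1 - i) ↔ P (m + 1 + i))) {s : ℕ → ℝ}
    (hs : ∀ i < m, s (m - 1 - i) = -s (m + 1 + i)) (h0 : s m = 0) (t : ℝ) :
    ∏ j ∈ Finset.range (2 * m + 1), (if P j then t - s j else 1) =
      (if P m then t else 1) *
        ∏ i ∈ Finset.range m, (if P (m + 1 + i) then t ^ 2 - s (m + 1 + i) ^ 2 else 1) := by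
  rw [show 2 * m + 1 = m + 1 + m by omega, Finset.prod_range_add, Finset.prod_range_succ,
    ← Finset.prod_range_reflect, h0, sub_zero, mul_comm (∏ j ∈ Finset.range m, _), mul_assoc,
    ← Finset.prod_mul_distrib]
  congr 1
  refine Finset.prod_congr rfl fun i hi => ?_
  have hi := Finset.mem_range.1 hi
  rw [if_congr (hP i hi) rfl rfl, hs i hi]
  split_ifs <;> ring

lemma prod_filter_fin {M : Type*} [CommMonoid M] (P : ℕ → Prop) [DecidablePred P] {N : ℕ}
    (g : ℕ → M) : ∏ j ∈ Finset.univ.filter (fun j : Fin N => P j), g j =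
      ∏ j ∈ Finset.range N, if P j then g j else 1 := by
  rw [Finset.prod_filter]
  exact Fin.prod_univ_eq_prod_range (fun j => if P j then g j else 1) N

lemma eval_linProd_evens {N : ℕ} (γ : Fin N → ℝ) (t : ℝ) : (linProd (evens N) γ).eval t =
    ∏ j ∈ Finset.range N, if Even j then t - extendZero γ j else 1 := by
  rw [eval_linProd, ← prod_filter_fin Even (fun j => t - extendZero γ j)]
  simp [extendZero_val]

lemma eval_linProd_odds {N : ℕ} (γ : Fin N → ℝ) (t : ℝ) : (linProd (odds N) γ).eval t =
    ∏ j ∈ Finset.range N, if Odd j then t - extendZero γ j else 1 := by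
  rw [eval_linProd, ← prod_filter_fin Odd (fun j => t - extendZero γ j)]
  simp [extendZero_val]

/-- The squares of the upper half of a tuple, translated by `a`. -/
def halfTuple (a : ℝ) {k : ℕ} (s : Fin (2 * k - 1) → ℝ) (i : Fin (k - 1)) : ℝ :=
  a + s ⟨k + i, by omega⟩ ^ 2

/-- The tuple of the roots `±√(γ_i - a)` and `0`. -/
def symTuple (a : ℝ) {k : ℕ} (γ : Fin (k - 1) → ℝ) (j : Fin (2 * k - 1)) : ℝ :=
  if (j : ℕ) + 1 < k then -√(extendZero γ (k - 2 - j) - a)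
  else if k ≤ (j : ℕ) then √(extendZero γ (j - k) - a) else 0

/-- The central root `0` has index `k - 1`, whose parity decides which product contains `t`;
squared, `t²` becomes the factor `X - a`. Index `i` of the upper half is index `k + i` of the whole
tuple, so parities swap for odd `k`. This explains the two forms of `pIci`. -/
lemma eval_pIci_comp {k : ℕ} (hk : 1 ≤ k) (a : ℝ) (α : ℝ × ℝ) {s : Fin (2 * k - 1) → ℝ}
    (hs : ∀ j, s j.rev = -s j) (t : ℝ) :
    (pIci a k α (halfTuple a s)).eval (t ^ 2 + a) = (pUniv (2 * k) α s).eval t := by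
  obtain ⟨m, rfl⟩ : ∃ m, k = m + 1 := ⟨k - 1, by omega⟩
  have hext : ∀ i < m, extendZero s (m - 1 - i) = -extendZero s (m + 1 + i) := by
    intro i hi
    rw [extendZero, dif_pos (by omega), extendZero, dif_pos (by omega), ← hs]
    congr 1
    ext
    simp
    omega
  have h0 : extendZero s m = 0 := by
    have : extendZero s m = -extendZero s m := by
      nth_rw 1 [extendZero]
      rw [dif_pos (by omega), extendZero, dif_pos (by omega), ← hs]
      congr 1
      ext
      simp
      omega
    linarith
  have hhalf : ∀ i < m, t ^ 2 + a - extendZero (halfTuple a s) i =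
      t ^ 2 - extendZero s (m + 1 + i) ^ 2 := by
    intro i hi
    rw [extendZero, dif_pos (by omega), extendZero, dif_pos (by omega), halfTuple]
    ring
  have hA := prod_symmetric Even (fun i _ => by grind) hext h0 t
  have hB := prod_symmetric Odd (fun i _ => by grind) hext h0 t
  rw [eval_pUniv, eval_linProd_evens, eval_linProd_odds]
  -- The lengths `2 * (m + 1) - 1` and `2 * m + 1` agree definitionally.
  change _ = α.1 * (∏ j ∈ Finset.range (2 * m + 1), _) ^ 2 +
    α.2 * (∏ j ∈ Finset.range (2 * m + 1), _) ^ 2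
  rw [hA, hB, pIci]
  rcases Nat.even_or_odd (m + 1) with hm | hm
  · have hm' : ¬ Even m := by grind
    have hm'' : Odd m := by grind
    rw [if_pos hm, oddProd_eq_sq, evenProd_eq_sq, if_neg hm', if_pos hm'']
    simp only [eval_add, eval_mul, eval_C, eval_pow, eval_linProd_evens, eval_linProd_odds,
      eval_sub, eval_X, add_tsub_cancel_right]
    have e1 : ∏ j ∈ Finset.range m, (if Even j then t ^ 2 + a - extendZero (halfTuple a s) j else 1)
        = ∏ i ∈ Finset.range m,
          if Even (m + 1 + i) then t ^ 2 - extendZero s (m + 1 + i) ^ 2 else 1 :=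
      Finset.prod_congr rfl fun i hi => by
        rw [hhalf i (Finset.mem_range.1 hi)]
        exact if_congr (by grind) rfl rfl
    have e2 : ∏ j ∈ Finset.range m, (if Odd j then t ^ 2 + a - extendZero (halfTuple a s) j else 1)
        = ∏ i ∈ Finset.range m,
          if Odd (m + 1 + i) then t ^ 2 - extendZero s (m + 1 + i) ^ 2 else 1 :=
      Finset.prod_congr rfl fun i hi => by
        rw [hhalf i (Finset.mem_range.1 hi)]
        exact if_congr (by grind) rfl rfl
    rw [e1, e2]
    ring
  · have hm1 : ¬ Even (m + 1) := by grind
    have hm' : Even m := by grind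
    have hm'' : ¬ Odd m := by grind
    rw [if_neg hm1, oddProd_eq_sq, evenProd_eq_sq, if_pos hm', if_neg hm'']
    simp only [eval_add, eval_mul, eval_C, eval_pow, eval_linProd_evens, eval_linProd_odds,
      eval_sub, eval_X, add_tsub_cancel_right]
    have e1 : ∏ j ∈ Finset.range m, (if Odd j then t ^ 2 + a - extendZero (halfTuple a s) j else 1)
        = ∏ i ∈ Finset.range m,
          if Even (m + 1 + i) then t ^ 2 - extendZero s (m + 1 + i) ^ 2 else 1 :=
      Finset.prod_congr rfl fun i hi => by
        rw [hhalf i (Finset.mem_range.1 hi)]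
        exact if_congr (by grind) rfl rfl
    have e2 : ∏ j ∈ Finset.range m, (if Even j then t ^ 2 + a - extendZero (halfTuple a s) j else 1)
        = ∏ i ∈ Finset.range m,
          if Odd (m + 1 + i) then t ^ 2 - extendZero s (m + 1 + i) ^ 2 else 1 :=
      Finset.prod_congr rfl fun i hi => by
        rw [hhalf i (Finset.mem_range.1 hi)]
        exact if_congr (by grind) rfl rfl
    rw [e1, e2]
    ring

lemma pIci_comp {k : ℕ} (hk : 1 ≤ k) (a : ℝ) (α : ℝ × ℝ) {s : Fin (2 * k - 1) → ℝ}
    (hs : ∀ j, s j.rev = -s j) :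
    (pIci a k α (halfTuple a s)).comp (X ^ 2 + C a) = pUniv (2 * k) α s := by
  refine Polynomial.funext fun t => ?_
  rw [← eval_pIci_comp hk a α hs]
  simp

lemma symTuple_rev (a : ℝ) {k : ℕ} (γ : Fin (k - 1) → ℝ) (j : Fin (2 * k - 1)) :
    symTuple a γ j.rev = -symTuple a γ j := by
  have h1 : (j.rev : ℕ) = 2 * k - 1 - (j + 1) := Fin.val_rev j
  have h2 := j.2
  simp only [symTuple, h1]
  rcases lt_trichotomy ((j : ℕ) + 1) k with h | h | h
  · rw [if_neg (by omega), if_pos (by omega), if_pos h, neg_neg]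
    congr 3
    omega
  · rw [if_neg (by omega), if_neg (by omega), if_neg (by omega), if_neg (by omega), neg_zero]
  · rw [if_pos (by omega), if_neg (by omega), if_pos (by omega)]
    congr 4
    omega

lemma halfTuple_symTuple (a : ℝ) {k : ℕ} {γ : Fin (k - 1) → ℝ} (hγ : ∀ i, a ≤ γ i) :
    halfTuple a (symTuple a γ) = γ := by
  funext i
  have hi := i.2
  rw [halfTuple, symTuple, if_neg (by simp only; omega), if_pos (by simp only; omega)]
  simp only [Nat.add_sub_cancel_left, extendZero_val]
  rw [Real.sq_sqrt (sub_nonneg.2 (hγ i))]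
  ring

lemma strictMono_symTuple (a : ℝ) {k : ℕ} {γ : Fin (k - 1) → ℝ} (hγ : ∀ i, a < γ i)
    (hmono : StrictMono γ) : StrictMono (symTuple a γ) := by
  have hpos : ∀ i < k - 1, 0 < √(extendZero γ i - a) := fun i hi => by
    rw [extendZero, dif_pos hi]
    exact Real.sqrt_pos.2 (sub_pos.2 (hγ _))
  have hlt : ∀ i j, i < j → j < k - 1 → √(extendZero γ i - a) < √(extendZero γ j - a) := by
    intro i j hij hj
    rw [extendZero, dif_pos (by omega), extendZero, dif_pos hj]
    apply Real.sqrt_lt_sqrt (sub_nonneg.2 (hγ _).le)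
    exact sub_lt_sub_right (hmono hij) a
  intro i j hij
  have hij' : (i : ℕ) < j := hij
  have hi := i.2
  have hj := j.2
  simp only [symTuple]
  split_ifs with h1 h2 h3 h4 h5 h6 h7
  · exact neg_lt_neg (hlt _ _ (by omega) (by omega))
  · have := hpos (k - 2 - i) (by omega)
    have := hpos (j - k) (by omega)
    linarith
  · have := hpos (k - 2 - i) (by omega)
    linarith
  · omega
  · exact hlt _ _ (by omega) (by omega)
  · omega
  · omega
  · exact hpos _ (by omega)
  · omega

/-- The values of `t² + a` fill exactly `[a, ∞)`; substitution doubles the degree and keeps the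
leading coefficient. -/
lemma comp_mem_posPolys_iff {k : ℕ} (a : ℝ) (p : ℝ[X]) :
    p.comp (X ^ 2 + C a) ∈ PosPolys univ (2 * k) ↔ p ∈ PosPolys (Ici a) k := by
  have hns : ¬ Bornology.IsBounded (univ : Set ℝ) := by
    simpa using NormedSpace.unbounded_univ ℝ ℝ
  have hns' : ¬ Bornology.IsBounded (Ici a) := fun h => not_bddAbove_Ici (a := a) h.bddAbove
  have hq : (X ^ 2 + C a : ℝ[X]).natDegree = 2 := natDegree_X_pow_add_C
  have hql : (X ^ 2 + C a : ℝ[X]).leadingCoeff = 1 := leadingCoeff_X_pow_add_C (by norm_num)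
  simp only [PosPolys, mem_ofPred_eq, hns, hns', false_or]
  have hdeg : (p.comp (X ^ 2 + C a)).natDegree ≤ 2 * k ↔ p.natDegree ≤ k := by
    rw [natDegree_comp, hq]
    omega
  rw [hdeg]
  refine and_congr_right fun hpk => and_congr ?_ ?_
  · simp only [eval_comp, eval_add, eval_pow, eval_X, eval_C, mem_univ, true_imp_iff, mem_Ici]
    constructor
    · intro h t ht
      have := h (√(t - a))
      rwa [Real.sq_sqrt (sub_nonneg.2 ht), sub_add_cancel] at this
    · intro h t
      exact h _ (le_add_of_nonneg_left (sq_nonneg t))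
  · have : (p.comp (X ^ 2 + C a)).coeff (2 * k) = p.coeff k := by
      rcases hpk.eq_or_lt with h | h
      · have := coeff_comp_degree_mul_degree (p := p) (q := X ^ 2 + C a) (by rw [hq]; norm_num)
        rw [hq, hql, h, one_pow, mul_one, mul_comm, leadingCoeff, h] at this
        exact this
      · rw [coeff_eq_zero_of_natDegree_lt h, coeff_eq_zero_of_natDegree_lt]
        rw [natDegree_comp, hq]
        omega
    rw [this]

/-- The length is odd, so reversal preserves the parity of each index and the reflected tuple fits
the same formula. -/
lemma eval_pUniv_rev {k : ℕ} (hk : 1 ≤ k) (α : ℝ × ℝ) (s : Fin (2 * k - 1) → ℝ) (t : ℝ) :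
    (pUniv (2 * k) α fun j => -s j.rev).eval t = (pUniv (2 * k) α s).eval (-t) := by
  have hval : ∀ j : Fin (2 * k - 1), (j.rev : ℕ) = 2 * k - 1 - (j + 1) := fun j => Fin.val_rev j
  have key : ∀ u : Finset (Fin (2 * k - 1)), (∀ j, j ∈ u ↔ Fin.revPerm j ∈ u) →
      (∏ j ∈ u, (t - -s j.rev)) ^ 2 = (∏ j ∈ u, (-t - s j)) ^ 2 := by
    intro u hu
    rw [← Finset.prod_pow, ← Finset.prod_pow]
    exact Finset.prod_equiv Fin.revPerm hu fun j _ => by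
      rw [Fin.revPerm_apply]
      ring
  rw [eval_pUniv, eval_pUniv]
  simp only [eval_linProd]
  rw [key _ fun j => ?_, key _ fun j => ?_]
  · have := hval j
    have := j.2
    simp only [Finset.mem_filter, Finset.mem_univ, true_and, Fin.revPerm_apply]
    grind
  · have := hval j
    have := j.2
    simp only [Finset.mem_filter, Finset.mem_univ, true_and, Fin.revPerm_apply]
    grind

section Ici
variable {k : ℕ} (a : ℝ)

lemma coeffSmoothAt_two_term {m : ℕ} (u v : ℝ[X]) (s t : Finset (Fin m))
    (x : (ℝ × ℝ) × (Fin m → ℝ)) : CoeffSmoothAt (fun x : (ℝ × ℝ) × (Fin m → ℝ) =>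
      C x.1.1 * u * linProd s x.2 ^ 2 + C x.1.2 * v * linProd t x.2 ^ 2) x := by
  have hγ : ∀ i, ContDiffAt ℝ ω (fun y : (ℝ × ℝ) × (Fin m → ℝ) => y.2 i) x := fun i => by
    fun_prop
  have h1 : CoeffSmoothAt (fun y : (ℝ × ℝ) × (Fin m → ℝ) => C y.1.1) x :=
    CoeffSmoothAt.C (by fun_prop)
  have h2 : CoeffSmoothAt (fun y : (ℝ × ℝ) × (Fin m → ℝ) => C y.1.2) x :=
    CoeffSmoothAt.C (by fun_prop)
  have h3 := (h1.mul (coeffSmoothAt_const u)).mul (coeffSmoothAt_linProd_sq s hγ)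
  have h4 := (h2.mul (coeffSmoothAt_const v)).mul (coeffSmoothAt_linProd_sq t hγ)
  exact h3.add h4

lemma coeffSmoothAt_pIci (x : (ℝ × ℝ) × (Fin (k - 1) → ℝ)) :
    CoeffSmoothAt (fun x : (ℝ × ℝ) × (Fin (k - 1) → ℝ) => pIci a k x.1 x.2) x := by
  simp only [pIci, oddProd_eq_sq, evenProd_eq_sq]
  by_cases hk : Even k
  · simpa only [if_pos hk, mul_one] using
      coeffSmoothAt_two_term 1 (X - C a) (evens (k - 1)) (odds (k - 1)) x
  · simpa only [if_neg hk, mul_one] using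
      coeffSmoothAt_two_term (X - C a) 1 (odds (k - 1)) (evens (k - 1)) x

lemma symTuple_mem_dom {x : (ℝ × ℝ) × (Fin (k - 1) → ℝ)} (hx : x ∈ dom (Ici a) k) :
    (x.1, symTuple a x.2) ∈ dom univ (2 * k) ∧ halfTuple a (symTuple a x.2) = x.2 := by
  obtain ⟨hα, hint, hmono⟩ := hx
  simp only [interior_Ici, mem_Ioi] at hint
  exact ⟨⟨hα, by simp, strictMono_symTuple a hint hmono⟩,
    halfTuple_symTuple a fun i => (hint i).le⟩

/-- The composite polynomial is even, so the reflected parameters represent it too; injectivity of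
the chart on the line makes the tuple symmetric. -/
lemma exists_symmetric_repr (hk : 1 ≤ k) {p : ℝ[X]} (hp : p ∈ PosPolys (Ici a) k) :
    ∃ x ∈ dom univ (2 * k), (∀ j, x.2 (Fin.rev j) = -x.2 j) ∧
      pUniv (2 * k) x.1 x.2 = p.comp (X ^ 2 + C a) := by
  have hchart := isChart_univ (k := 2 * k) (even_two_mul k) (by omega)
  obtain ⟨x, hx, hxp⟩ := hchart.bijOn.surjOn ((comp_mem_posPolys_iff a p).2 hp)
  refine ⟨x, hx, ?_, hxp⟩
  have hx' : (x.1, fun j => -x.2 (Fin.rev j)) ∈ dom univ (2 * k) :=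
    ⟨hx.1, by simp, fun i j hij => neg_lt_neg (hx.2.2 (Fin.rev_lt_rev.2 hij))⟩
  have heq := hchart.bijOn.injOn hx' hx (by
    refine Polynomial.funext fun t => ?_
    simp only at hxp ⊢
    rw [eval_pUniv_rev hk, hxp]
    simp)
  intro j
  have := congrFun (congrArg Prod.snd heq) j
  simp only at this
  linarith

lemma halfTuple_mem {s : Fin (2 * k - 1) → ℝ} (hs : ∀ j, s j.rev = -s j) (hmono : StrictMono s) :
    halfTuple a s ∈ Delta (Ici a) (k - 1) := by
  have hpos : ∀ i : Fin (k - 1), 0 < s ⟨k + i, by omega⟩ := by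
    intro i
    have hlt := hmono (show Fin.rev (⟨k + i, by omega⟩ : Fin (2 * k - 1)) < ⟨k + i, by omega⟩ by
      rw [Fin.lt_def, Fin.val_rev]
      simp only
      omega)
    rw [hs] at hlt
    linarith
  refine ⟨fun i => ?_, fun i j hij => ?_⟩
  · simpa [halfTuple] using pow_pos (hpos i) 2
  · have : s ⟨k + i, by omega⟩ < s ⟨k + j, by omega⟩ := hmono (by
      simp only [Fin.mk_lt_mk]
      have : (i : ℕ) < j := hij
      omega)
    exact add_lt_add_right (pow_lt_pow_left₀ this (hpos i).le two_ne_zero) a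

theorem isChart_Ici (hk : 1 ≤ k) :
    IsChart (Ici a) k (fun x : (ℝ × ℝ) × (Fin (k - 1) → ℝ) => pIci a k x.1 x.2)
      (dom (Ici a) k) := by
  have hchart := isChart_univ (k := 2 * k) (even_two_mul k) (by omega)
  have hcomp : ∀ x ∈ dom (Ici a) k, (pIci a k x.1 x.2).comp (X ^ 2 + C a) =
      pUniv (2 * k) x.1 (symTuple a x.2) := fun x hx => by
    rw [← pIci_comp hk a x.1 (symTuple_rev a x.2), (symTuple_mem_dom a hx).2]
  have hmaps : MapsTo (fun x : (ℝ × ℝ) × (Fin (k - 1) → ℝ) => pIci a k x.1 x.2)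
      (dom (Ici a) k) (PosPolys (Ici a) k) := fun x hx => by
    have h := hchart.bijOn.mapsTo (symTuple_mem_dom a hx).1
    simp only [← hcomp x hx] at h
    exact (comp_mem_posPolys_iff a _).1 h
  set L : Coeffs k → Coeffs (2 * k) := fun c => coeffVec (2 * k) ((toPoly c).comp (X ^ 2 + C a))
    with hL
  have hLs : ∀ c, ContDiffAt ℝ ω L c := fun c =>
    (CoeffSmoothAt.toPoly_comp contDiffAt_id (X ^ 2 + C a)).coeffVec (2 * k)
  refine ⟨coeffSmoothAt_pIci a, ⟨hmaps, ?_, ?_⟩, ?_, ?_⟩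
  · intro x hx y hy h
    have h' := congrArg (fun p : ℝ[X] => p.comp (X ^ 2 + C a)) h
    simp only [hcomp x hx, hcomp y hy] at h'
    have heq := hchart.bijOn.injOn (symTuple_mem_dom a hx).1 (symTuple_mem_dom a hy).1 h'
    obtain ⟨e1, e2⟩ := Prod.mk.inj heq
    refine Prod.ext e1 ?_
    rw [← (symTuple_mem_dom a hx).2, ← (symTuple_mem_dom a hy).2, e2]
  · intro p hp
    obtain ⟨x, hx, hsym, hxp⟩ := exists_symmetric_repr a hk hp
    refine ⟨(x.1, halfTuple a x.2), ⟨hx.1, halfTuple_mem a hsym hx.2.2⟩, ?_⟩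
    have h1 : (pIci a k x.1 (halfTuple a x.2)).comp (X ^ 2 + C a) = p.comp (X ^ 2 + C a) := by
      rw [pIci_comp hk a x.1 hsym, hxp]
    have h2 : (pIci a k x.1 (halfTuple a x.2) - p).comp (X ^ 2 + C a) = 0 := by
      rw [sub_comp, h1, sub_self]
    rcases comp_eq_zero_iff.1 h2 with h3 | ⟨-, h3⟩
    · exact sub_eq_zero.1 h3
    · have := congrArg natDegree h3
      rw [natDegree_X_pow_add_C, natDegree_C] at this
      omega
  · have : {c : Coeffs k | toPoly c ∈ PosPolys (Ici a) k} =
        L ⁻¹' {d | toPoly d ∈ PosPolys univ (2 * k)} := by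
      ext c
      simp only [mem_ofPred_eq, mem_preimage, hL]
      rw [toPoly_coeffVec, comp_mem_posPolys_iff]
      rw [natDegree_comp, natDegree_X_pow_add_C]
      have := natDegree_toPoly_le c
      omega
    rw [this]
    exact hchart.isOpen.preimage (continuous_iff_continuousAt.2 fun c => (hLs c).continuousAt)
  · obtain ⟨g, hg⟩ := hchart.exists_inverse
    -- The inverse squares roots of the pulled-back representation, so no square roots spoil
    -- analyticity.
    refine ⟨fun c => ((g (L c)).1, halfTuple a (g (L c)).2), fun x hx => ?_⟩
    have hLx : L (coeffVec k (pIci a k x.1 x.2)) =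
        coeffVec (2 * k) (pUniv (2 * k) x.1 (symTuple a x.2)) := by
      simp only [hL]
      rw [toPoly_coeffVec (hmaps hx).1, hcomp x hx]
    obtain ⟨hx1, hx2⟩ := symTuple_mem_dom a hx
    have hgL : ContDiffAt ℝ ω (fun c => g (L c)) (coeffVec k (pIci a k x.1 x.2)) := by
      refine ContDiffAt.comp _ ?_ (hLs _)
      rw [hLx]
      exact (hg _ hx1).1
    constructor
    · refine hgL.fst.prodMk (contDiffAt_pi.2 fun i => ?_)
      exact contDiffAt_const.add ((contDiffAt_pi.1 hgL.snd _).pow 2)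
    · simp only [hLx, (hg _ hx1).2, hx2]

end Ici

/-! ### The compact interval -/

/-- The polynomial `(1 + X)^k p((a + b X) / (1 + X))`. -/
def moebius (a b : ℝ) {k : ℕ} (c : Coeffs k) : ℝ[X] :=
  ∑ j : Fin (k + 1), C (c j) * ((C b * X + C a) ^ (j : ℕ) * (X + C 1) ^ (k - (j : ℕ)))

section Moebius
variable {k : ℕ} {a b : ℝ}

lemma natDegree_moebius_le (c : Coeffs k) : (moebius a b c).natDegree ≤ k := by
  refine natDegree_sum_le_of_forall_le _ _ fun j _ => (natDegree_C_mul_le _ _).trans ?_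
  have hj : (j : ℕ) + (k - j) ≤ k := by have := j.2; omega
  refine le_trans (natDegree_mul_le.trans (add_le_add ?_ ?_)) hj
  · exact natDegree_pow_le.trans ((Nat.mul_le_mul_left _ natDegree_linear_le).trans (mul_one _).le)
  · exact natDegree_pow_le.trans (by rw [natDegree_X_add_C, mul_one])

lemma coeff_moebius (c : Coeffs k) : (moebius a b c).coeff k = (toPoly c).eval b := by
  rw [moebius, finsetSum_coeff, eval_toPoly]
  refine Finset.sum_congr rfl fun j _ => ?_
  have hj : (j : ℕ) + (k - j) = k := by have := j.2; omega
  rw [coeff_C_mul]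
  congr 1
  have h1 : ((C b * X + C a) ^ (j : ℕ)).natDegree ≤ (j : ℕ) :=
    natDegree_pow_le.trans ((Nat.mul_le_mul_left _ natDegree_linear_le).trans (mul_one _).le)
  have h2 : ((X + C (1 : ℝ)) ^ (k - (j : ℕ))).natDegree ≤ k - j :=
    natDegree_pow_le.trans (by rw [natDegree_X_add_C, mul_one])
  have h3 := coeff_mul_add_eq_of_natDegree_le h1 h2
  rw [hj] at h3
  have h4 := coeff_pow_of_natDegree_le (m := j) (natDegree_linear_le (a := b) (b := a))
  have h5 := coeff_pow_of_natDegree_le (m := k - j) (natDegree_X_add_C (1 : ℝ)).le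
  rw [mul_one] at h4 h5
  rw [h3, h4, h5]
  simp [coeff_one]

lemma eval_moebius (c : Coeffs k) {s : ℝ} (hs : 1 + s ≠ 0) :
    (moebius a b c).eval s = (1 + s) ^ k * (toPoly c).eval ((a + b * s) / (1 + s)) := by
  rw [moebius, eval_finsetSum, eval_toPoly, Finset.mul_sum]
  refine Finset.sum_congr rfl fun j _ => ?_
  have hj : (1 + s) ^ k = (1 + s) ^ (k - (j : ℕ)) * (1 + s) ^ (j : ℕ) := by
    rw [← pow_add]
    congr 1
    have := j.2
    omega
  simp only [eval_mul, eval_C, eval_pow, eval_add, eval_X]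
  rw [hj, div_pow]
  field_simp
  ring

lemma eval_moebius' (hab : a < b) (c : Coeffs k) {t : ℝ} (ht : t < b) :
    (moebius a b c).eval ((t - a) / (b - t)) =
      ((b - a) / (b - t)) ^ k * (toPoly c).eval t := by
  have h1 : b - t ≠ 0 := (sub_pos.2 ht).ne'
  have h2 : b - a ≠ 0 := (sub_pos.2 hab).ne'
  have h3 : 1 + (t - a) / (b - t) = (b - a) / (b - t) := by
    field_simp
    ring
  rw [eval_moebius c (by rw [h3]; exact div_ne_zero h2 h1), h3]
  congr 2
  field_simp
  ring

/-- The substitution maps `[0, ∞)` onto `[a, b)`, and the missing value at `b` is the coefficient of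
degree `k`. -/
lemma moebius_mem_iff (hab : a < b) (c : Coeffs k) :
    moebius a b c ∈ PosPolys (Ici 0) k ↔ toPoly c ∈ PosPolys (Icc a b) k := by
  have hns : ¬ Bornology.IsBounded (Ici (0 : ℝ)) := fun h => not_bddAbove_Ici (a := (0 : ℝ)) h.bddAbove
  simp only [PosPolys, mem_ofPred_eq, natDegree_moebius_le, natDegree_toPoly_le, true_and, hns,
    false_or, coeff_moebius, Metric.isBounded_Icc, true_or, and_true]
  constructor
  · rintro ⟨h1, h2⟩ t ht
    rcases ht.2.eq_or_lt with rfl | htb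
    · exact h2
    · have h := h1 ((t - a) / (b - t)) (div_nonneg (sub_nonneg.2 ht.1) (sub_pos.2 htb).le)
      rw [eval_moebius' hab c htb] at h
      exact pos_of_mul_pos_right h
        (pow_nonneg (div_nonneg (sub_pos.2 hab).le (sub_pos.2 htb).le) _)
  · intro h
    refine ⟨fun s hs => ?_, h b ⟨hab.le, le_rfl⟩⟩
    have hs0 : (0 : ℝ) ≤ s := hs
    have hs1 : 0 < 1 + s := by linarith
    rw [eval_moebius c hs1.ne']
    refine mul_pos (pow_pos hs1 _) (h _ ⟨?_, ?_⟩)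
    · rw [le_div_iff₀ hs1]
      nlinarith
    · rw [div_le_iff₀ hs1]
      nlinarith

lemma moebius_injective (hab : a < b) : Function.Injective (moebius a b (k := k)) := by
  intro c d h
  rw [← coeffVec_toPoly c, ← coeffVec_toPoly d]
  congr 1
  refine eq_of_infinite_eval_eq _ _ ((Iio_infinite b).mono fun t ht => ?_)
  have h1 := eval_moebius' hab c (mem_Iio.1 ht)
  rw [h, eval_moebius' hab d (mem_Iio.1 ht)] at h1
  exact (mul_left_cancel₀ (pow_ne_zero _
    (div_ne_zero (sub_pos.2 hab).ne' (sub_pos.2 (mem_Iio.1 ht)).ne')) h1).symm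

variable (a b)

/-- `∏_{j ∈ u} (b - a) / (1 + σ_j)`. -/
def moebiusWeight {ι : Type*} (u : Finset ι) (σ : ι → ℝ) : ℝ := ∏ j ∈ u, (b - a) / (1 + σ j)

/-- The factors which the Möbius substitution produces in the two terms of `pIcc`. -/
def moebiusScale {k : ℕ} (σ : Fin (k - 1) → ℝ) : ℝ × ℝ :=
  if Even k then
    (moebiusWeight a b (evens (k - 1)) σ ^ 2, (b - a) ^ 2 * moebiusWeight a b (odds (k - 1)) σ ^ 2)
  else ((b - a) * moebiusWeight a b (odds (k - 1)) σ ^ 2,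
    (b - a) * moebiusWeight a b (evens (k - 1)) σ ^ 2)

/-- The parameters on `[a, b]` which correspond to given parameters on `[0, ∞)`. -/
def moebiusParam {k : ℕ} (z : (ℝ × ℝ) × (Fin (k - 1) → ℝ)) : (ℝ × ℝ) × (Fin (k - 1) → ℝ) :=
  ((z.1.1 / (moebiusScale a b z.2).1, z.1.2 / (moebiusScale a b z.2).2),
    fun i => (a + b * z.2 i) / (1 + z.2 i))

/-- The inverse of `moebiusParam`. -/
def moebiusParamInv {k : ℕ} (x : (ℝ × ℝ) × (Fin (k - 1) → ℝ)) : (ℝ × ℝ) × (Fin (k - 1) → ℝ) :=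
  ((x.1.1 * (moebiusScale a b fun i => (x.2 i - a) / (b - x.2 i)).1,
    x.1.2 * (moebiusScale a b fun i => (x.2 i - a) / (b - x.2 i)).2),
    fun i => (x.2 i - a) / (b - x.2 i))

variable {a b}

lemma moebiusWeight_pos (hab : a < b) {ι : Type*} (u : Finset ι) {σ : ι → ℝ} (hσ : ∀ i, 0 < σ i) :
    0 < moebiusWeight a b u σ :=
  Finset.prod_pos fun i _ => div_pos (sub_pos.2 hab) (by linarith [hσ i])

lemma moebiusScale_pos (hab : a < b) {σ : Fin (k - 1) → ℝ} (hσ : ∀ i, 0 < σ i) :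
    0 < (moebiusScale a b σ).1 ∧ 0 < (moebiusScale a b σ).2 := by
  have h1 := moebiusWeight_pos hab (evens (k - 1)) hσ
  have h2 := moebiusWeight_pos hab (odds (k - 1)) hσ
  have h3 := sub_pos.2 hab
  unfold moebiusScale
  split_ifs <;> constructor <;> positivity

lemma natDegree_pIcc_le (hk : 1 ≤ k) (α : ℝ × ℝ) (γ : Fin (k - 1) → ℝ) :
    (pIcc a b k α γ).natDegree ≤ k := by
  have hE : (linProd (evens (k - 1)) γ ^ 2).natDegree ≤ 2 * (k / 2) := by
    rw [natDegree_pow, natDegree_linProd, card_evens, Nat.sub_add_cancel hk]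
  have hO : (linProd (odds (k - 1)) γ ^ 2).natDegree ≤ 2 * ((k - 1) / 2) := by
    rw [natDegree_pow, natDegree_linProd, card_odds]
  have ha : (X - C a).natDegree ≤ 1 := natDegree_X_sub_C_le a
  have hb : (C b - X).natDegree ≤ 1 :=
    natDegree_sub_le_of_le ((natDegree_C b).le.trans zero_le_one) natDegree_X_le
  rw [pIcc, oddProd_eq_sq, evenProd_eq_sq]
  split_ifs with h
  · refine natDegree_add_le_of_degree_le ((natDegree_C_mul_le _ _).trans ?_) ?_
    · grind
    · rw [mul_assoc]
      refine (natDegree_C_mul_le _ _).trans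
        ((natDegree_mul_le.trans (add_le_add (natDegree_mul_le.trans (add_le_add ha hb)) hO)).trans ?_)
      grind
  · refine natDegree_add_le_of_degree_le ?_ ?_
    · rw [mul_assoc]
      refine (natDegree_C_mul_le _ _).trans ((natDegree_mul_le.trans (add_le_add ha hO)).trans ?_)
      grind
    · rw [mul_assoc]
      refine (natDegree_C_mul_le _ _).trans ((natDegree_mul_le.trans (add_le_add hb hE)).trans ?_)
      grind

lemma eval_linProd_moebius {ι : Type*} (u : Finset ι) {σ : ι → ℝ} (hσ : ∀ i, 0 < σ i) {s : ℝ}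
    (hs : 0 < 1 + s) : (linProd u fun i => (a + b * σ i) / (1 + σ i)).eval ((a + b * s) / (1 + s)) =
      moebiusWeight a b u σ * (linProd u σ).eval s / (1 + s) ^ u.card := by
  rw [eval_linProd, eval_linProd, moebiusWeight, ← Finset.prod_const, ← Finset.prod_mul_distrib,
    ← Finset.prod_div_distrib]
  refine Finset.prod_congr rfl fun i _ => ?_
  have h1 : 1 + σ i ≠ 0 := by linarith [hσ i]
  have h2 := hs.ne'
  field_simp
  ring

/-- Under the substitution `t - a`, `b - t` and `t - γ_i` become constant multiples of `s`, `1` and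
`s - σ_i`, each over `1 + s`. Each term of `pIcc` has exactly `k` such factors, so the denominators
cancel against `(1 + s)^k`; the constants form `moebiusScale`. -/
lemma moebius_pIcc (hk : 1 ≤ k) (hab : a < b) {z : (ℝ × ℝ) × (Fin (k - 1) → ℝ)}
    (hz : z ∈ dom (Ici 0) k) :
    moebius a b (coeffVec k (pIcc a b k (moebiusParam a b z).1 (moebiusParam a b z).2)) =
      pIci 0 k z.1 z.2 := by
  have hσ : ∀ i, 0 < z.2 i := by simpa using hz.2.1
  refine eq_of_infinite_eval_eq _ _ ((Ioi_infinite (0 : ℝ)).mono fun s hs => ?_)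
  have hs0 : 0 < s := hs
  have hs1 : 0 < 1 + s := by linarith
  have hE := eval_linProd_moebius (a := a) (b := b) (evens (k - 1)) hσ hs1
  have hO := eval_linProd_moebius (a := a) (b := b) (odds (k - 1)) hσ hs1
  have wE := (moebiusWeight_pos hab (evens (k - 1)) hσ).ne'
  have wO := (moebiusWeight_pos hab (odds (k - 1)) hσ).ne'
  have hba : b - a ≠ 0 := (sub_pos.2 hab).ne'
  have hta : (a + b * s) / (1 + s) - a = (b - a) * s / (1 + s) := by
    field_simp
    ring
  have htb : b - (a + b * s) / (1 + s) = (b - a) / (1 + s) := by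
    field_simp
    ring
  simp only [mem_ofPred_eq]
  rw [eval_moebius _ hs1.ne', toPoly_coeffVec (natDegree_pIcc_le hk _ _)]
  simp only [moebiusParam, moebiusScale, pIcc, pIci, oddProd_eq_sq, evenProd_eq_sq]
  split_ifs with h
  · obtain ⟨r, hr⟩ : ∃ r, k = 2 * r + 2 := by
      obtain ⟨m, rfl⟩ := h
      exact ⟨m - 1, by omega⟩
    have cE : (evens (k - 1)).card = r + 1 := by rw [card_evens]; omega
    have cO : (odds (k - 1)).card = r := by rw [card_odds]; omega
    have hpow : (1 + s) ^ k = ((1 + s) ^ r) ^ 2 * (1 + s) ^ 2 := by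
      rw [hr, ← pow_mul, ← pow_add, mul_comm]
    have hv : (1 + s) ^ r ≠ 0 := pow_ne_zero _ hs1.ne'
    rw [cE, pow_succ] at hE
    rw [cO] at hO
    simp only [eval_add, eval_mul, eval_C, eval_pow, eval_sub, eval_X, hE, hO, hta, htb, hpow,
      sub_zero]
    generalize (1 + s) ^ r = v at *
    field_simp
  · obtain ⟨r, hr⟩ : ∃ r, k = 2 * r + 1 := by
      obtain ⟨m, rfl⟩ := Nat.not_even_iff_odd.1 h
      exact ⟨m, rfl⟩
    have cE : (evens (k - 1)).card = r := by rw [card_evens]; omega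
    have cO : (odds (k - 1)).card = r := by rw [card_odds]; omega
    have hpow : (1 + s) ^ k = ((1 + s) ^ r) ^ 2 * (1 + s) := by
      rw [hr, ← pow_mul, ← pow_succ, mul_comm]
    have hv : (1 + s) ^ r ≠ 0 := pow_ne_zero _ hs1.ne'
    rw [cE] at hE
    rw [cO] at hO
    simp only [eval_add, eval_mul, eval_C, eval_pow, eval_sub, eval_X, hE, hO, hta, htb, hpow,
      sub_zero]
    generalize (1 + s) ^ r = v at *
    field_simp

lemma moebiusParam_mem (hab : a < b) {z : (ℝ × ℝ) × (Fin (k - 1) → ℝ)}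
    (hz : z ∈ dom (Ici 0) k) : moebiusParam a b z ∈ dom (Icc a b) k := by
  have hσ : ∀ i, 0 < z.2 i := by simpa using hz.2.1
  obtain ⟨h1, h2⟩ := moebiusScale_pos hab hσ
  have hba := sub_pos.2 hab
  have hpos : ∀ i, 0 < 1 + z.2 i := fun i => by linarith [hσ i]
  refine ⟨⟨div_pos hz.1.1 h1, div_pos hz.1.2 h2⟩, fun i => ?_, fun i j hij => ?_⟩
  · have := mul_pos hba (hσ i)
    rw [interior_Icc]
    constructor
    · simp only [moebiusParam]
      rw [lt_div_iff₀ (hpos i)]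
      linarith
    · simp only [moebiusParam]
      rw [div_lt_iff₀ (hpos i)]
      linarith
  · have h3 : z.2 i < z.2 j := hz.2.2 hij
    have := mul_pos hba (sub_pos.2 h3)
    simp only [moebiusParam]
    rw [div_lt_div_iff₀ (hpos i) (hpos j)]
    linarith

lemma moebiusParamInv_mem (hab : a < b) {x : (ℝ × ℝ) × (Fin (k - 1) → ℝ)}
    (hx : x ∈ dom (Icc a b) k) : moebiusParamInv a b x ∈ dom (Ici 0) k ∧
      moebiusParam a b (moebiusParamInv a b x) = x := by
  have hγ : ∀ i, a < x.2 i ∧ x.2 i < b := by simpa using hx.2.1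
  have hσ : ∀ i, 0 < (x.2 i - a) / (b - x.2 i) := fun i =>
    div_pos (sub_pos.2 (hγ i).1) (sub_pos.2 (hγ i).2)
  have hba := sub_pos.2 hab
  obtain ⟨h1, h2⟩ := moebiusScale_pos hab hσ
  refine ⟨⟨⟨mul_pos hx.1.1 h1, mul_pos hx.1.2 h2⟩, fun i => ?_, fun i j hij => ?_⟩, ?_⟩
  · simpa [moebiusParamInv] using hσ i
  · have h3 : x.2 i < x.2 j := hx.2.2 hij
    have := mul_pos hba (sub_pos.2 h3)
    simp only [moebiusParamInv]
    rw [div_lt_div_iff₀ (sub_pos.2 (hγ i).2) (sub_pos.2 (hγ j).2)]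
    linarith
  · refine Prod.ext (Prod.ext ?_ ?_) (funext fun i => ?_)
    · simp only [moebiusParam, moebiusParamInv]
      exact mul_div_cancel_right₀ _ h1.ne'
    · simp only [moebiusParam, moebiusParamInv]
      exact mul_div_cancel_right₀ _ h2.ne'
    · simp only [moebiusParam, moebiusParamInv]
      have h4 : b - x.2 i ≠ 0 := (sub_pos.2 (hγ i).2).ne'
      have h5 : 1 + (x.2 i - a) / (b - x.2 i) = (b - a) / (b - x.2 i) := by
        field_simp
        ring
      have := hba.ne'
      rw [h5]
      field_simp
      ring

lemma contDiffAt_moebiusParam (hab : a < b) {z : (ℝ × ℝ) × (Fin (k - 1) → ℝ)}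
    (hz : z ∈ dom (Ici 0) k) : ContDiffAt ℝ ω (moebiusParam a b (k := k)) z := by
  have hσ : ∀ i, 0 < z.2 i := by simpa using hz.2.1
  have hne : ∀ i, 1 + z.2 i ≠ 0 := fun i => by linarith [hσ i]
  obtain ⟨h1, h2⟩ := moebiusScale_pos hab hσ
  have hcoord : ∀ i, ContDiffAt ℝ ω (fun z : (ℝ × ℝ) × (Fin (k - 1) → ℝ) => z.2 i) z := fun i => by
    fun_prop
  have hw : ∀ u : Finset (Fin (k - 1)), ContDiffAt ℝ ω
      (fun z : (ℝ × ℝ) × (Fin (k - 1) → ℝ) => moebiusWeight a b u z.2) z := fun u =>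
    contDiffAt_prod fun i _ => contDiffAt_const.div (contDiffAt_const.add (hcoord i)) (hne i)
  have hs : ContDiffAt ℝ ω
      (fun z : (ℝ × ℝ) × (Fin (k - 1) → ℝ) => moebiusScale a b z.2) z := by
    unfold moebiusScale
    by_cases hk : Even k
    · simp only [if_pos hk]
      exact ((hw _).pow 2).prodMk (contDiffAt_const.mul ((hw _).pow 2))
    · simp only [if_neg hk]
      exact (contDiffAt_const.mul ((hw _).pow 2)).prodMk (contDiffAt_const.mul ((hw _).pow 2))
  refine ContDiffAt.prodMk (ContDiffAt.prodMk ?_ ?_) (contDiffAt_pi.2 fun i => ?_)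
  · exact contDiffAt_fst.fst.div hs.fst h1.ne'
  · exact contDiffAt_fst.snd.div hs.snd h2.ne'
  · exact (contDiffAt_const.add (contDiffAt_const.mul (hcoord i))).div
      (contDiffAt_const.add (hcoord i)) (hne i)

lemma coeffSmoothAt_pIcc (x : (ℝ × ℝ) × (Fin (k - 1) → ℝ)) :
    CoeffSmoothAt (fun x : (ℝ × ℝ) × (Fin (k - 1) → ℝ) => pIcc a b k x.1 x.2) x := by
  simp only [pIcc, oddProd_eq_sq, evenProd_eq_sq]
  by_cases hk : Even k
  · simpa only [if_pos hk, mul_one] using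
      coeffSmoothAt_two_term 1 ((X - C a) * (C b - X)) (evens (k - 1)) (odds (k - 1)) x
  · simpa only [if_neg hk, mul_one] using
      coeffSmoothAt_two_term (X - C a) (C b - X) (odds (k - 1)) (evens (k - 1)) x

theorem isChart_Icc (hab : a < b) (hk : 1 ≤ k) :
    IsChart (Icc a b) k (fun x : (ℝ × ℝ) × (Fin (k - 1) → ℝ) => pIcc a b k x.1 x.2)
      (dom (Icc a b) k) := by
  have hchart := isChart_Ici 0 hk
  have hdeg : ∀ x : (ℝ × ℝ) × (Fin (k - 1) → ℝ), (pIcc a b k x.1 x.2).natDegree ≤ k := fun x =>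
    natDegree_pIcc_le hk _ _
  have hM : ∀ x ∈ dom (Icc a b) k, moebius a b (coeffVec k (pIcc a b k x.1 x.2)) =
      pIci 0 k (moebiusParamInv a b x).1 (moebiusParamInv a b x).2 := fun x hx => by
    obtain ⟨h1, h2⟩ := moebiusParamInv_mem hab hx
    rw [← moebius_pIcc hk hab h1, h2]
  set L : Coeffs k → Coeffs k := fun c => coeffVec k (moebius a b c) with hL
  have hLs : ∀ c, ContDiffAt ℝ ω L c := fun c =>
    CoeffSmoothAt.coeffVec (CoeffSmoothAt.sum _ fun j _ =>
      (CoeffSmoothAt.C (contDiffAt_euclidean.1 contDiffAt_id j)).mul (coeffSmoothAt_const _)) k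
  refine ⟨coeffSmoothAt_pIcc, ⟨fun x hx => ?_, ?_, ?_⟩, ?_, ?_⟩
  · have h := hchart.bijOn.mapsTo (moebiusParamInv_mem hab hx).1
    simp only [← hM x hx] at h
    rw [moebius_mem_iff hab, toPoly_coeffVec (hdeg x)] at h
    exact h
  · intro x hx y hy h
    have h' := congrArg (fun p : ℝ[X] => moebius a b (coeffVec k p)) h
    simp only [hM x hx, hM y hy] at h'
    have heq := hchart.bijOn.injOn (moebiusParamInv_mem hab hx).1 (moebiusParamInv_mem hab hy).1 h'
    rw [← (moebiusParamInv_mem hab hx).2, heq, (moebiusParamInv_mem hab hy).2]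
  · intro p hp
    have hp' : moebius a b (coeffVec k p) ∈ PosPolys (Ici 0) k := by
      rwa [moebius_mem_iff hab, toPoly_coeffVec hp.1]
    obtain ⟨z, hz, hzp⟩ := hchart.bijOn.surjOn hp'
    refine ⟨moebiusParam a b z, moebiusParam_mem hab hz, ?_⟩
    refine coeffVec_injOn k (hdeg _) hp.1 (moebius_injective hab ?_)
    rw [moebius_pIcc hk hab hz]
    exact hzp
  · have : {c : Coeffs k | toPoly c ∈ PosPolys (Icc a b) k} =
        L ⁻¹' {d | toPoly d ∈ PosPolys (Ici 0) k} := by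
      ext c
      simp only [mem_ofPred_eq, mem_preimage, hL]
      rw [toPoly_coeffVec (natDegree_moebius_le c), moebius_mem_iff hab]
    rw [this]
    exact hchart.isOpen.preimage (continuous_iff_continuousAt.2 fun c => (hLs c).continuousAt)
  · obtain ⟨g, hg⟩ := hchart.exists_inverse
    refine ⟨fun c => moebiusParam a b (g (L c)), fun x hx => ?_⟩
    obtain ⟨hx1, hx2⟩ := moebiusParamInv_mem hab hx
    have hLx : L (coeffVec k (pIcc a b k x.1 x.2)) =
        coeffVec k (pIci 0 k (moebiusParamInv a b x).1 (moebiusParamInv a b x).2) := by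
      simp only [hL]
      rw [hM x hx]
    obtain ⟨hg1, hg2⟩ := hg _ hx1
    have hgL : ContDiffAt ℝ ω (fun c => g (L c)) (coeffVec k (pIcc a b k x.1 x.2)) := by
      refine ContDiffAt.comp _ ?_ (hLs _)
      rw [hLx]
      exact hg1
    constructor
    · refine ContDiffAt.comp (g := moebiusParam a b) (f := fun c => g (L c)) _ ?_ hgL
      rw [hLx, hg2]
      exact contDiffAt_moebiusParam hab hx1
    · simp only [hLx]
      rw [hg2, hx2]

end Moebius

/-! ### Thin sets of polynomials -/

/-- The set `A` of polynomials is covered by countably many analytic families with `d`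
parameters. -/
def Thin (d : ℕ) (A : Set ℝ[X]) : Prop :=
  ∃ (ι : Type) (_ : Countable ι) (f : ι → (Fin d → ℝ) → ℝ[X]),
    (∀ i x, CoeffSmoothAt (f i) x) ∧ A ⊆ ⋃ i, range (f i)

lemma Thin.mono {d : ℕ} {A B : Set ℝ[X]} (hB : Thin d B) (h : A ⊆ B) : Thin d A := by
  obtain ⟨ι, hι, f, hf, hBf⟩ := hB
  exact ⟨ι, hι, f, hf, h.trans hBf⟩

lemma Thin.iUnion {d : ℕ} {κ : Type} [Countable κ] {A : κ → Set ℝ[X]} (h : ∀ i, Thin d (A i)) :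
    Thin d (⋃ i, A i) := by
  choose ι hι f hf hA using h
  refine ⟨Σ i, ι i, inferInstance, fun p => f p.1 p.2, fun p => hf p.1 p.2, ?_⟩
  refine iUnion_subset fun i p hp => ?_
  obtain ⟨j, hj⟩ := mem_iUnion.1 (hA i hp)
  exact mem_iUnion.2 ⟨⟨i, j⟩, hj⟩

lemma Thin.union {d : ℕ} {A B : Set ℝ[X]} (hA : Thin d A) (hB : Thin d B) : Thin d (A ∪ B) := by
  rw [union_eq_iUnion]
  exact Thin.iUnion fun b => by cases b <;> assumption

lemma thin_degree_lt (d : ℕ) : Thin d {p | p.degree < d} := by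
  refine ⟨Unit, inferInstance, fun _ c => ∑ j : Fin d, C (c j) * X ^ (j : ℕ), fun _ x => ?_, ?_⟩
  · exact CoeffSmoothAt.sum _ fun j _ =>
      (CoeffSmoothAt.C (contDiffAt_pi.1 contDiffAt_id j)).mul (coeffSmoothAt_const _)
  · intro p hp
    refine mem_iUnion.2 ⟨(), fun j => p.coeff j, ?_⟩
    simp only
    rw [Fin.sum_univ_eq_sum_range (fun j => C (p.coeff j) * X ^ j) d]
    ext i
    simp only [finsetSum_coeff, coeff_C_mul, coeff_X_pow, mul_ite, mul_one, mul_zero,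
      Finset.sum_ite_eq, Finset.mem_range]
    split_ifs with h
    · rfl
    · exact ((degree_lt_iff_coeff_zero p d).1 hp i (not_lt.1 h)).symm

lemma Thin.mul_left {d : ℕ} {A : Set ℝ[X]} (hA : Thin d A) (w : ℝ[X]) :
    Thin d ((fun q => w * q) '' A) := by
  obtain ⟨ι, hι, f, hf, hAf⟩ := hA
  refine ⟨ι, hι, fun i x => w * f i x, fun i x => (coeffSmoothAt_const w).mul (hf i x), ?_⟩
  rintro _ ⟨q, hq, rfl⟩
  obtain ⟨i, x, rfl⟩ := mem_iUnion.1 (hAf hq)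
  exact mem_iUnion.2 ⟨i, x, rfl⟩

lemma Thin.sq_mul {d : ℕ} {A : Set ℝ[X]} (hA : Thin d A) :
    Thin (d + 1) {p | ∃ γ : ℝ, ∃ q ∈ A, p = (X - C γ) ^ 2 * q} := by
  obtain ⟨ι, hι, f, hf, hAf⟩ := hA
  refine ⟨ι, hι, fun i x => (X - C (x 0)) ^ 2 * f i (Fin.tail x), fun i x => ?_, ?_⟩
  · refine CoeffSmoothAt.mul (CoeffSmoothAt.pow ((coeffSmoothAt_const _).sub
      (CoeffSmoothAt.C (contDiffAt_pi.1 contDiffAt_id 0))) 2) ?_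
    exact CoeffSmoothAt.comp (hf i (Fin.tail x))
      (contDiffAt_pi.2 fun j => contDiffAt_pi.1 contDiffAt_id j.succ)
  · rintro _ ⟨γ, q, hq, rfl⟩
    obtain ⟨i, x, rfl⟩ := mem_iUnion.1 (hAf hq)
    exact mem_iUnion.2 ⟨i, Fin.cons γ x, by simp⟩

/-- A `C¹` image of `ℝ^d` has Hausdorff dimension at most `d`, and countable unions of null sets are
null. -/
lemma Thin.hausdorffMeasure_eq_zero {d n : ℕ} {A : Set ℝ[X]} (hA : Thin d A) (hdn : d < n) :
    Measure.hausdorffMeasure (n : ℝ) (coeffVec n '' A) = 0 := by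
  obtain ⟨ι, hι, f, hf, hAf⟩ := hA
  have h : ∀ i, Measure.hausdorffMeasure (n : ℝ) (range fun x => coeffVec n (f i x)) = 0 := by
    intro i
    have hs : ContDiff ℝ 1 fun x => coeffVec n (f i x) :=
      contDiff_iff_contDiffAt.2 fun x => ((hf i x).coeffVec n).of_le le_top
    have hlt : dimH (range fun x => coeffVec n (f i x)) < ((n : NNReal) : ENNReal) := by
      refine hs.dimH_range_le.trans_lt ?_
      simpa using hdn
    exact_mod_cast hausdorffMeasure_of_dimH_lt hlt
  refine measure_mono_null ?_ (measure_iUnion_null h)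
  rintro _ ⟨p, hp, rfl⟩
  obtain ⟨i, x, rfl⟩ := mem_iUnion.1 (hAf hp)
  exact mem_iUnion.2 ⟨i, x, rfl⟩

/-! ### Nonnegative polynomials -/

/-- Polynomials of degree at most `k` which are nonnegative on `T`. -/
def NonnegPolys (T : Set ℝ) (k : ℕ) : Set ℝ[X] := {p | p.natDegree ≤ k ∧ ∀ t ∈ T, 0 ≤ p.eval t}

lemma mem_posCone_iff {T : Set ℝ} {n : ℕ} (c : Coeffs n) :
    c ∈ posCone T n ↔ toPoly c ∈ NonnegPolys T n := by
  simp [posCone, NonnegPolys, natDegree_toPoly_le, eval_toPoly]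

lemma coeffVec_mem_posCone {T : Set ℝ} {n : ℕ} {p : ℝ[X]} (hp : p ∈ NonnegPolys T n) :
    coeffVec n p ∈ posCone T n := by
  rwa [mem_posCone_iff, toPoly_coeffVec hp.1]

lemma isClosed_posCone (T : Set ℝ) (n : ℕ) : IsClosed (posCone T n) := by
  have : posCone T n = ⋂ t ∈ T, {c | 0 ≤ ∑ j : Fin (n + 1), c j * t ^ (j : ℕ)} := by
    ext c
    simp [posCone]
  rw [this]
  exact isClosed_biInter fun t _ => isClosed_le continuous_const (by fun_prop)

/-- A polynomial nonnegative near one of its roots has a double root there. -/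
lemma exists_eq_sq_mul {T : Set ℝ} {p : ℝ[X]} (hp : ∀ t ∈ T, 0 ≤ p.eval t) {γ : ℝ}
    (hγ : γ ∈ interior T) (h0 : p.eval γ = 0) : ∃ q, p = (X - C γ) ^ 2 * q := by
  obtain ⟨r, hr⟩ := dvd_iff_isRoot.2 h0
  have hmin : IsLocalMin (fun t => p.eval t) γ := by
    filter_upwards [mem_interior_iff_mem_nhds.1 hγ] with t ht
    rw [h0]
    exact hp t ht
  have hd := hmin.hasDerivAt_eq_zero (p.hasDerivAt γ)
  rw [hr] at hd
  simp at hd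
  obtain ⟨q, hq⟩ := dvd_iff_isRoot.2 hd
  exact ⟨q, by rw [hr, hq]; ring⟩

lemma natDegree_le_of_natDegree_mul_le {k d : ℕ} {w q : ℝ[X]} (hw : w.degree = d) (hp : (w * q).natDegree ≤ k + d) :
    q.natDegree ≤ k := by
  have hw0 : w ≠ 0 := fun h => by rw [h, degree_zero] at hw; exact absurd hw (by simp)
  by_cases hq : q = 0
  · simp [hq]
  · rw [natDegree_mul hw0 hq, natDegree_eq_of_degree_eq_some hw] at hp
    omega

/-- Away from `γ` one divides by `w > 0`; at `γ`, an accumulation point of `T`, continuity gives the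
sign. -/
lemma nonneg_of_mul_nonneg {T : Set ℝ} {w q : ℝ[X]} {γ : ℝ} (hγ : γ ∈ closure (T \ {γ}))
    (hw : ∀ t ∈ T, t ≠ γ → 0 < w.eval t) (h : ∀ t ∈ T, 0 ≤ (w * q).eval t) :
    ∀ t ∈ T, 0 ≤ q.eval t := by
  have h1 : ∀ t ∈ T \ {γ}, 0 ≤ q.eval t := fun t ht => by
    have h2 := h t ht.1
    rw [eval_mul] at h2
    exact nonneg_of_mul_nonneg_right h2 (hw t ht.1 ht.2)
  intro t ht
  by_cases htγ : t = γ
  · rw [htγ]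
    exact closure_minimal h1 (isClosed_le continuous_const q.continuous) hγ
  · exact h1 t ⟨ht, htγ⟩

lemma mem_closure_diff_of_mem_interior {T : Set ℝ} {γ : ℝ} (hγ : γ ∈ interior T) :
    γ ∈ closure (T \ {γ}) := by
  rw [mem_closure_iff_frequently]
  have h1 : ∀ᶠ t in 𝓝[≠] γ, t ∈ T :=
    nhdsWithin_le_nhds (mem_interior_iff_mem_nhds.1 hγ)
  exact ((h1.and self_mem_nhdsWithin).frequently).filter_mono nhdsWithin_le_nhds

lemma degree_lt_of_coeff_eq_zero {p : ℝ[X]} {k : ℕ} (h : p.natDegree ≤ k) (h0 : p.coeff k = 0) :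
    p.degree < k := by
  rw [degree_lt_iff_coeff_zero]
  intro m hm
  rcases hm.eq_or_lt with rfl | hm
  · exact h0
  · exact coeff_eq_zero_of_natDegree_lt (h.trans_lt hm)

/-- A leading coefficient of a polynomial nonnegative at `+∞` is nonnegative. -/
lemma coeff_nonneg_of_nonneg {a : ℝ} {k : ℕ} {p : ℝ[X]} (hp : p ∈ NonnegPolys (Ici a) k) :
    0 ≤ p.coeff k := by
  by_contra! h
  have hdeg : p.natDegree = k := hp.1.antisymm (le_natDegree_of_ne_zero h.ne)
  have hlead : p.leadingCoeff = p.coeff k := by rw [leadingCoeff, hdeg]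
  rcases Nat.eq_zero_or_pos k with rfl | hk
  · have := hp.2 a self_mem_Ici
    rw [eq_C_of_natDegree_eq_zero hdeg, eval_C] at this
    linarith
  · have := p.tendsto_atBot_of_leadingCoeff_nonpos
      (natDegree_pos_iff_degree_pos.1 (by omega)) (by rw [hlead]; exact h.le)
    obtain ⟨t, h1, h2⟩ := ((this.eventually_lt_atBot 0).and (eventually_ge_atTop a)).exists
    exact absurd (hp.2 t h2) (not_le.2 h1)

/-- Nonnegative polynomials which are not positive. -/
def DegeneratePolys (T : Set ℝ) (k : ℕ) : Set ℝ[X] := NonnegPolys T k \ PosPolys T k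

lemma exists_root_or_coeff_eq_zero {T : Set ℝ} {k : ℕ}
    (hlead : ∀ p ∈ NonnegPolys T k, Bornology.IsBounded T ∨ 0 ≤ p.coeff k) {p : ℝ[X]}
    (hp : p ∈ DegeneratePolys T k) :
    (∃ t ∈ T, p.eval t = 0) ∨ (¬ Bornology.IsBounded T ∧ p.coeff k = 0) := by
  by_contra! h
  refine hp.2 ⟨hp.1.1, fun t ht => (hp.1.2 t ht).lt_of_ne (h.1 t ht).symm, ?_⟩
  by_cases hT : Bornology.IsBounded T
  · exact Or.inl hT
  · exact Or.inr (((hlead p hp.1).resolve_left hT).lt_of_ne (h.2 hT).symm)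

/-- The degenerate polynomials of degree at most `k` depend on `k` parameters only. -/
theorem thin_degeneratePolys {T : Set ℝ} {k : ℕ}
    (hlead : ∀ p ∈ NonnegPolys T k, Bornology.IsBounded T ∨ 0 ≤ p.coeff k)
    (hT : (T \ interior T).Countable) : Thin k (DegeneratePolys T k) := by
  have : Countable ↥(T \ interior T) := hT.to_subtype
  have h1 : Thin k (⋃ b : ↥(T \ interior T),
      (fun q => (X - C (b : ℝ)) * q) '' {q : ℝ[X] | q.degree < k}) :=
    Thin.iUnion fun b => (thin_degree_lt k).mul_left _
  -- One parameter for `γ` and `k - 1` for `q`. For `k = 0` the truncated subtraction would cost one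
  -- parameter too many, hence the clause `1 ≤ k`.
  have h2 : Thin k {p : ℝ[X] | 1 ≤ k ∧ ∃ γ : ℝ, ∃ q ∈ {q : ℝ[X] | q.degree < (k - 1 : ℕ)},
      p = (X - C γ) ^ 2 * q} := by
    rcases Nat.eq_zero_or_pos k with rfl | hk
    · exact (thin_degree_lt 0).mono fun p hp => absurd hp.1 (by norm_num)
    · have := (thin_degree_lt (k - 1)).sq_mul
      rw [Nat.sub_add_cancel hk] at this
      exact this.mono fun p hp => hp.2
  refine ((thin_degree_lt k).union (h1.union h2)).mono fun p hp => ?_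
  -- Degree below `k` already means `k` parameters; otherwise the degree is exactly `k`, which fixes
  -- that of the quotient.
  by_cases hpk : p.degree < k
  · exact Or.inl hpk
  right
  have hcoeff : p.coeff k ≠ 0 := fun h0 => hpk (degree_lt_of_coeff_eq_zero hp.1.1 h0)
  have hdeg : p.natDegree = k := hp.1.1.antisymm (le_natDegree_of_ne_zero hcoeff)
  have hp0 : p ≠ 0 := fun h => by simp [h] at hcoeff
  rcases exists_root_or_coeff_eq_zero hlead hp with ⟨t, ht, h0⟩ | ⟨-, h0⟩
  · by_cases hti : t ∈ interior T
    · right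
      obtain ⟨q, rfl⟩ := exists_eq_sq_mul hp.1.2 hti h0
      have hq0 : q ≠ 0 := right_ne_zero_of_mul hp0
      rw [natDegree_mul (left_ne_zero_of_mul hp0) hq0, natDegree_pow, natDegree_X_sub_C] at hdeg
      refine ⟨by omega, t, q, ?_, rfl⟩
      rw [mem_ofPred_eq, degree_eq_natDegree hq0, Nat.cast_lt]
      omega
    · left
      obtain ⟨q, rfl⟩ := dvd_iff_isRoot.2 h0
      have hq0 : q ≠ 0 := right_ne_zero_of_mul hp0
      rw [natDegree_mul (left_ne_zero_of_mul hp0) hq0, natDegree_X_sub_C] at hdeg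
      refine mem_iUnion.2 ⟨⟨t, ht, hti⟩, q, ?_, rfl⟩
      rw [mem_ofPred_eq, degree_eq_natDegree hq0, Nat.cast_lt]
      omega
  · exact absurd h0 hcoeff

/-! ### The boundary of the cone -/

lemma notMem_interior_of_sub_smul {E : Type*} [NormedAddCommGroup E] [NormedSpace ℝ E] {K : Set E}
    {c : E} (v : E) (h : ∀ ε > (0 : ℝ), c - ε • v ∉ K) : c ∉ interior K := by
  intro hc
  have hlim : Tendsto (fun ε : ℝ => c - ε • v) (𝓝[>] 0) (𝓝 c) := by
    have : Tendsto (fun ε : ℝ => c - ε • v) (𝓝 0) (𝓝 (c - (0 : ℝ) • v)) :=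
      Continuous.tendsto (by fun_prop) 0
    rw [zero_smul, sub_zero] at this
    exact this.mono_left nhdsWithin_le_nhds
  obtain ⟨ε, h1, h2⟩ := ((hlim.eventually (mem_interior_iff_mem_nhds.1 hc)).and
    self_mem_nhdsWithin).exists
  exact h ε h2 h1

lemma toPoly_sub_smul {n : ℕ} {p v : ℝ[X]} (hp : p.natDegree ≤ n) (hv : v.natDegree ≤ n) (ε : ℝ) :
    toPoly (coeffVec n p - ε • coeffVec n v) = p - C ε * v := by
  rw [← toPoly_coeffVec (p := p - C ε * v) (k := n)]
  · congr 1
    ext j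
    simp [coeffVec_apply]
  · exact (natDegree_sub_le_of_le hp ((natDegree_C_mul_le _ _).trans hv)).trans (max_self n).le

lemma notMem_interior_of_root {T : Set ℝ} {n : ℕ} {p : ℝ[X]} (hp : p.natDegree ≤ n) {t : ℝ}
    (ht : t ∈ T) (h0 : p.eval t = 0) : coeffVec n p ∉ interior (posCone T n) := by
  refine notMem_interior_of_sub_smul (coeffVec n 1) fun ε hε h => ?_
  rw [mem_posCone_iff, toPoly_sub_smul hp (by simp)] at h
  have := h.2 t ht
  simp only [mul_one, eval_sub, eval_C, h0] at this
  linarith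

/-- Subtracting `ε X^n` makes the leading coefficient negative, which nonnegativity near `+∞`
forbids. -/
lemma notMem_interior_of_coeff {a : ℝ} {n : ℕ} {p : ℝ[X]} (hp : p.natDegree ≤ n)
    (h0 : p.coeff n = 0) : coeffVec n p ∉ interior (posCone (Ici a) n) := by
  refine notMem_interior_of_sub_smul (coeffVec n (X ^ n)) fun ε hε h => ?_
  rw [mem_posCone_iff, toPoly_sub_smul hp (by simp)] at h
  have := coeff_nonneg_of_nonneg h
  simp only [coeff_sub, h0, coeff_C_mul, coeff_X_pow_self] at this
  linarith

/-- Positive polynomials form an open subset of the cone, so boundary points are degenerate and lie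
in `U` or in the null set `A`; conversely all of `U` is boundary. -/
theorem frontier_posCone_ae_eq {T : Set ℝ} {n : ℕ} (hn : 1 ≤ n)
    (hopen : IsOpen {c : Coeffs n | toPoly c ∈ PosPolys T n}) {U A : Set ℝ[X]}
    (hU : ∀ p ∈ U, p ∈ NonnegPolys T n ∧ coeffVec n p ∉ interior (posCone T n))
    (hcover : DegeneratePolys T n ⊆ U ∪ A) (hA : Thin (n - 1) A) :
    frontier (posCone T n) =ᵐ[Measure.hausdorffMeasure (n : ℝ)] (coeffVec n '' U : Set (Coeffs n))
    := by
  rw [(isClosed_posCone T n).frontier_eq, ae_eq_set]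
  constructor
  · refine measure_mono_null ?_ (hA.hausdorffMeasure_eq_zero (by omega : n - 1 < n))
    rintro c ⟨⟨hc, hci⟩, hcU⟩
    have hnot : toPoly c ∉ PosPolys T n := by
      intro h
      refine hci (interior_maximal ?_ hopen h)
      intro d hd
      rw [mem_posCone_iff]
      exact ⟨hd.1, fun t ht => (hd.2.1 t ht).le⟩
    rcases hcover ⟨(mem_posCone_iff c).1 hc, hnot⟩ with h | h
    · exact absurd ⟨_, h, coeffVec_toPoly c⟩ hcU
    · exact ⟨_, h, coeffVec_toPoly c⟩
  · have : coeffVec n '' U \ (posCone T n \ interior (posCone T n)) = ∅ := by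
      rw [sdiff_eq_empty]
      rintro _ ⟨p, hp, rfl⟩
      exact ⟨coeffVec_mem_posCone (hU p hp).1, (hU p hp).2⟩
    rw [this, measure_empty]

/-! ### The pieces of the boundary -/

/-- Products `(X - γ)² q` with `γ ∈ S` and `q` positive. -/
def DoubleRootPolys (T S : Set ℝ) (k : ℕ) : Set ℝ[X] :=
  {p | ∃ γ ∈ S, ∃ q ∈ PosPolys T k, p = (X - C γ) ^ 2 * q}

/-- This serves `n = 2`, where the cofactor of the squared linear factor is a constant with one
parameter instead of a polynomial `p_0`. -/
lemma isChart_const {T : Set ℝ} (hT : T.Nonempty) :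
    IsChart T 0 (fun α : ℝ => (C α : ℝ[X])) (Ioi 0) := by
  have hmem : ∀ α : ℝ, (C α : ℝ[X]) ∈ PosPolys T 0 ↔ 0 < α := by
    intro α
    refine ⟨fun h => ?_, fun h => ⟨by simp, by simpa using fun _ _ => h, Or.inr (by simpa using h)⟩⟩
    obtain ⟨t, ht⟩ := hT
    simpa using h.2.1 t ht
  refine ⟨fun x => CoeffSmoothAt.C contDiffAt_id, ⟨fun α hα => (hmem α).2 hα,
    fun α _ β _ h => C_injective h, fun p hp => ?_⟩, ?_, fun c => c 0, fun α _ => ⟨?_, ?_⟩⟩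
  · have h := eq_C_of_natDegree_le_zero hp.1
    rw [h] at hp ⊢
    exact ⟨_, (hmem _).1 hp, rfl⟩
  · have : {c : Coeffs 0 | toPoly c ∈ PosPolys T 0} = {c | 0 < c 0} := by
      ext c
      rw [mem_ofPred_eq, mem_ofPred_eq, ← hmem]
      simp [toPoly]
    rw [this]
    exact isOpen_lt continuous_const (by fun_prop)
  · exact contDiffAt_euclidean.1 contDiffAt_id 0
  · simp [coeffVec_apply]

section Pieces
variable {T : Set ℝ} {n : ℕ}

lemma IsChart.image_sq_mul {E : Type*} [NormedAddCommGroup E] [NormedSpace ℝ E] {k : ℕ}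
    {f : E → ℝ[X]} {s : Set E} (hf : IsChart T k f s) (S : Set ℝ) (n : ℕ) :
    (fun y : E × ℝ => coeffVec n ((X - C y.2) ^ 2 * f y.1)) '' (s ×ˢ S) =
      coeffVec n '' DoubleRootPolys T S k := by
  ext c
  constructor
  · rintro ⟨y, hy, rfl⟩
    exact ⟨_, ⟨y.2, hy.2, f y.1, hf.bijOn.mapsTo hy.1, rfl⟩, rfl⟩
  · rintro ⟨_, ⟨γ, hγ, q, hq, rfl⟩, rfl⟩
    obtain ⟨x, hx, rfl⟩ := hf.bijOn.surjOn hq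
    exact ⟨(x, γ), ⟨hx, hγ⟩, rfl⟩

lemma IsChart.image_mul {E : Type*} [NormedAddCommGroup E] [NormedSpace ℝ E] {k : ℕ}
    {f : E → ℝ[X]} {s : Set E} (hf : IsChart T k f s) (w : ℝ[X]) (n : ℕ) :
    (fun x => coeffVec n (w * f x)) '' s = coeffVec n '' ((fun q => w * q) '' PosPolys T k) := by
  rw [← hf.bijOn.image_eq, image_image, image_image]

theorem doubleRoot_of_isChart (hn : 2 ≤ n) {p : PolyFamily} (hT : IsClosed T) (hne : T.Nonempty)
    {S : Set ℝ} (hS : S ⊆ T)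
    (h : n ≠ 2 → IsChart T (n - 2)
      (fun x : (ℝ × ℝ) × (Fin (n - 2 - 1) → ℝ) => p (n - 2) x.1 x.2) (dom T (n - 2))) :
    DoubleRootDiffeo p T S n ∧
      doubleRootPiece p T S n = coeffVec n '' DoubleRootPolys T S (n - 2) := by
  have hkn : n - 2 + 2 = n := by omega
  rw [DoubleRootDiffeo, doubleRootPiece]
  split_ifs with h2
  · subst h2
    exact ⟨(isChart_const hne).isDiffeoOntoImage_sq_mul hT hS hkn,
      (isChart_const hne).image_sq_mul S 2⟩
  · exact ⟨(h h2).isDiffeoOntoImage_sq_mul hT hS hkn, (h h2).image_sq_mul S n⟩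

lemma disjoint_image_coeffVec {A B : Set ℝ[X]} (hA : ∀ p ∈ A, p.natDegree ≤ n)
    (hB : ∀ p ∈ B, p.natDegree ≤ n) (h : ∀ p ∈ A, p ∉ B) :
    Disjoint (coeffVec n '' A) (coeffVec n '' B) := by
  rw [Set.disjoint_left]
  rintro _ ⟨p, hp, rfl⟩ ⟨q, hq, hqp⟩
  rw [coeffVec_injOn n (hB q hq) (hA p hp) hqp] at hq
  exact h p hp hq

lemma natDegree_doubleRootPolys_le (hn : 2 ≤ n) {S : Set ℝ} :
    ∀ p ∈ DoubleRootPolys T S (n - 2), p.natDegree ≤ n := by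
  rintro _ ⟨γ, -, q, hq, rfl⟩
  exact natDegree_sq_mul_le (by omega) γ hq.1

lemma natDegree_linear_mul_le (hn : 1 ≤ n) {w : ℝ[X]} (hw : w.natDegree ≤ 1) :
    ∀ p ∈ (fun q => w * q) '' PosPolys T (n - 1), p.natDegree ≤ n := by
  rintro _ ⟨q, hq, rfl⟩
  exact (natDegree_mul_le.trans (add_le_add hw hq.1)).trans (by omega)

lemma doubleRootPolys_nonneg (hn : 2 ≤ n) {S : Set ℝ} (hS : S ⊆ T) {p : ℝ[X]}
    (hp : p ∈ DoubleRootPolys T S (n - 2)) :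
    p ∈ NonnegPolys T n ∧ coeffVec n p ∉ interior (posCone T n) := by
  have hdeg := natDegree_doubleRootPolys_le hn p hp
  obtain ⟨γ, hγ, q, hq, rfl⟩ := hp
  refine ⟨⟨hdeg, fun t ht => ?_⟩, notMem_interior_of_root hdeg (hS hγ) (by simp)⟩
  have := hq.2.1 t ht
  simp only [eval_mul, eval_pow]
  positivity

lemma linear_mul_nonneg (hn : 1 ≤ n) {w : ℝ[X]} (hw : w.natDegree ≤ 1) {a : ℝ} (ha : a ∈ T)
    (hwa : w.eval a = 0) (hwT : ∀ t ∈ T, t ≠ a → 0 < w.eval t) {p : ℝ[X]}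
    (hp : p ∈ (fun q => w * q) '' PosPolys T (n - 1)) :
    p ∈ NonnegPolys T n ∧ coeffVec n p ∉ interior (posCone T n) := by
  have hdeg := natDegree_linear_mul_le hn hw p hp
  obtain ⟨q, hq, rfl⟩ := hp
  refine ⟨⟨hdeg, fun t ht => ?_⟩, notMem_interior_of_root hdeg ha (by simp [hwa])⟩
  rw [eval_mul]
  refine mul_nonneg ?_ (hq.2.1 t ht).le
  by_cases h : t = a
  · rw [h, hwa]
  · exact (hwT t ht h).le

/-- With a positive cofactor, `w r` has `a` as its only root in `T`, and the root is simple. So the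
pieces stay disjoint even when `a ∈ S`. -/
lemma doubleRootPolys_notMem_linear {S : Set ℝ} (hS : S ⊆ T) {w : ℝ[X]} {a c : ℝ} (hc : c ≠ 0)
    (ha : a ∈ T) (hw : w = C c * (X - C a)) {k l : ℕ} {p : ℝ[X]}
    (hp : p ∈ DoubleRootPolys T S k) : p ∉ (fun q => w * q) '' PosPolys T l := by
  obtain ⟨γ, hγ, q, hq, rfl⟩ := hp
  rintro ⟨r, hr, h⟩
  simp only at h
  by_cases hγa : γ = a
  · subst hγa
    have h1 : (X - C γ) * (C c * r) = (X - C γ) * ((X - C γ) * q) := by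
      rw [hw] at h
      linear_combination h
    have h2 := congrArg (eval γ) (mul_left_cancel₀ (X_sub_C_ne_zero γ) h1)
    have := (hr.2.1 γ ha).ne'
    simp [hc, this] at h2
  · have h2 := congrArg (eval γ) h
    have := (hr.2.1 γ (hS hγ)).ne'
    simp [hw, hc, this, sub_eq_zero, hγa] at h2

/-- A nonnegative polynomial with an interior root lies in the double root piece, or in a set of
smaller dimension. -/
lemma mem_of_interior_root (hn : 2 ≤ n) {p : ℝ[X]} (hp : p ∈ NonnegPolys T n) {t : ℝ}
    (ht : t ∈ interior T) (h0 : p.eval t = 0) :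
    p ∈ DoubleRootPolys T (interior T) (n - 2) ∪
      {p | ∃ γ : ℝ, ∃ q ∈ DegeneratePolys T (n - 2), p = (X - C γ) ^ 2 * q} := by
  obtain ⟨q, rfl⟩ := exists_eq_sq_mul hp.2 ht h0
  have hdeg : q.natDegree ≤ n - 2 := by
    refine natDegree_le_of_natDegree_mul_le (d := 2) (by simp [degree_pow]) (hp.1.trans (by omega))
  have hq : q ∈ NonnegPolys T (n - 2) := by
    refine ⟨hdeg, nonneg_of_mul_nonneg (mem_closure_diff_of_mem_interior ht) ?_ hp.2⟩
    intro s _ hs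
    have := sub_ne_zero.2 hs
    simp only [eval_pow, eval_sub, eval_X, eval_C]
    positivity
  by_cases hq' : q ∈ PosPolys T (n - 2)
  · exact Or.inl ⟨t, ht, q, hq', rfl⟩
  · exact Or.inr ⟨t, q, ⟨hq, hq'⟩, rfl⟩

/-- A nonnegative polynomial with a root at an endpoint lies in the piece of that endpoint, or in a
set of smaller dimension. -/
lemma mem_of_linear_dvd (hn : 1 ≤ n) {p w : ℝ[X]} (hp : p ∈ NonnegPolys T n)
    (hw : w.degree = (1 : ℕ)) {a : ℝ} (ha : a ∈ closure (T \ {a}))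
    (hwT : ∀ t ∈ T, t ≠ a → 0 < w.eval t) (hdvd : w ∣ p) :
    p ∈ (fun q => w * q) '' PosPolys T (n - 1) ∪
      (fun q => w * q) '' DegeneratePolys T (n - 1) := by
  obtain ⟨q, rfl⟩ := hdvd
  have hq : q ∈ NonnegPolys T (n - 1) :=
    ⟨natDegree_le_of_natDegree_mul_le hw (hp.1.trans (by omega)), nonneg_of_mul_nonneg ha hwT hp.2⟩
  by_cases hq' : q ∈ PosPolys T (n - 1)
  · exact Or.inl ⟨q, hq', rfl⟩
  · exact Or.inr ⟨q, ⟨hq, hq'⟩, rfl⟩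

lemma thin_sq_mul_degenerate (hn : 2 ≤ n)
    (hlead : ∀ k, ∀ p ∈ NonnegPolys T k, Bornology.IsBounded T ∨ 0 ≤ p.coeff k)
    (hT : (T \ interior T).Countable) :
    Thin (n - 1) {p | ∃ γ : ℝ, ∃ q ∈ DegeneratePolys T (n - 2), p = (X - C γ) ^ 2 * q} := by
  have := (thin_degeneratePolys (hlead (n - 2)) hT).sq_mul
  rwa [show n - 2 + 1 = n - 1 by omega] at this

end Pieces

/-! ### The three cases -/

lemma degree_C_sub_X (b : ℝ) : (C b - X : ℝ[X]).degree = (1 : ℕ) := by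
  rw [← neg_sub, degree_neg, degree_X_sub_C]
  rfl

lemma C_sub_X_eq (b : ℝ) : (C b - X : ℝ[X]) = C (-1) * (X - C b) := by
  simp

lemma rightPiece_eq {p : PolyFamily} {T : Set ℝ} {b : ℝ} {n : ℕ} (h : IsChart T (n - 1)
    (fun x : (ℝ × ℝ) × (Fin (n - 1 - 1) → ℝ) => p (n - 1) x.1 x.2) (dom T (n - 1))) :
    rightPiece p T b n = coeffVec n '' ((fun q => (C b - X) * q) '' PosPolys T (n - 1)) := by
  rw [← h.image_mul]
  refine image_congr fun x _ => ?_
  simp only [phiRoot]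
  rw [← coeffVec_neg]
  congr 1
  ring

lemma leftPiece_eq {p : PolyFamily} {T : Set ℝ} {a : ℝ} {n : ℕ} (h : IsChart T (n - 1)
    (fun x : (ℝ × ℝ) × (Fin (n - 1 - 1) → ℝ) => p (n - 1) x.1 x.2) (dom T (n - 1))) :
    leftPiece p T a n = coeffVec n '' ((fun q => (X - C a) * q) '' PosPolys T (n - 1)) := by
  rw [← h.image_mul]
  refine image_congr fun x _ => ?_
  simp only [phiRoot, pow_one]

lemma doubleRootPolys_mono {T S S' : Set ℝ} (h : S ⊆ S') (k : ℕ) :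
    DoubleRootPolys T S k ⊆ DoubleRootPolys T S' k := by
  rintro p ⟨γ, hγ, hq⟩
  exact ⟨γ, h hγ, hq⟩

theorem boundary_Icc {n : ℕ} (hn : 2 ≤ n) {a b : ℝ} (hab : a < b) {S : Set ℝ}
    (hS : S = interior (Icc a b) ∨ S = Icc a b) :
    frontier (posCone (Icc a b) n) =ᵐ[Measure.hausdorffMeasure (n : ℝ)]
        (doubleRootPiece (pIcc a b) (Icc a b) S n ∪ leftPiece (pIcc a b) (Icc a b) a n ∪
          rightPiece (pIcc a b) (Icc a b) b n : Set (Coeffs n)) ∧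
      Disjoint (doubleRootPiece (pIcc a b) (Icc a b) S n) (leftPiece (pIcc a b) (Icc a b) a n) ∧
      Disjoint (doubleRootPiece (pIcc a b) (Icc a b) S n) (rightPiece (pIcc a b) (Icc a b) b n) ∧
      Disjoint (leftPiece (pIcc a b) (Icc a b) a n) (rightPiece (pIcc a b) (Icc a b) b n) ∧
      IsDiffeoOntoImage (phi (pIcc a b) n n) (dom (Icc a b) n) ∧
      DoubleRootDiffeo (pIcc a b) (Icc a b) S n ∧
      IsDiffeoOntoImage (fun x => phiRoot (pIcc a b) n 1 x a) (dom (Icc a b) (n - 1)) ∧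
      IsDiffeoOntoImage (fun x => phiRoot (pIcc a b) n 1 x b) (dom (Icc a b) (n - 1)) := by
  have hST : S ⊆ Icc a b := by
    rcases hS with rfl | rfl
    exacts [interior_subset, subset_rfl]
  -- Only `interior T ⊆ S ⊆ T` is used: the upper bound puts the piece inside the boundary, the
  -- lower one makes it large enough to catch interior roots.
  have hiS : interior (Icc a b) ⊆ S := by
    rcases hS with rfl | rfl
    exacts [subset_rfl, interior_subset]
  have ha : a ∈ Icc a b := left_mem_Icc.2 hab.le
  have hb : b ∈ Icc a b := right_mem_Icc.2 hab.le
  have hchart := isChart_Icc (k := n) hab (by omega)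
  have hchart1 := isChart_Icc (k := n - 1) hab (by omega)
  obtain ⟨hD, hDeq⟩ := doubleRoot_of_isChart (p := pIcc a b) hn isClosed_Icc ⟨a, ha⟩ hST
    fun h => isChart_Icc (k := n - 2) hab (by omega)
  have hwa : ∀ t ∈ Icc a b, t ≠ a → 0 < (X - C a : ℝ[X]).eval t := fun t ht hta => by
    simpa using lt_of_le_of_ne ht.1 hta.symm
  have hwb : ∀ t ∈ Icc a b, t ≠ b → 0 < (C b - X : ℝ[X]).eval t := fun t ht htb => by
    simpa using lt_of_le_of_ne ht.2 htb
  have da : (X - C a : ℝ[X]).natDegree ≤ 1 := natDegree_X_sub_C_le a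
  have db : (C b - X : ℝ[X]).natDegree ≤ 1 := (natDegree_eq_of_degree_eq_some (degree_C_sub_X b)).le
  have hlead : ∀ k, ∀ p ∈ NonnegPolys (Icc a b) k,
      Bornology.IsBounded (Icc a b) ∨ 0 ≤ p.coeff k := fun k p _ => Or.inl (Metric.isBounded_Icc a b)
  have hends : Icc a b \ interior (Icc a b) ⊆ {a, b} := by
    rintro t ⟨ht, hti⟩
    rw [interior_Icc] at hti
    by_contra! h
    simp only [mem_insert_iff, mem_singleton_iff, not_or] at h
    exact hti ⟨lt_of_le_of_ne ht.1 (Ne.symm h.1), lt_of_le_of_ne ht.2 h.2⟩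
  have hcount : (Icc a b \ interior (Icc a b)).Countable := (toFinite {a, b}).countable.mono hends
  rw [hDeq, leftPiece_eq hchart1, rightPiece_eq hchart1, ← image_union, ← image_union]
  refine ⟨?_, ?_, ?_, ?_, hchart.isDiffeoOntoImage le_rfl, hD,
    hchart1.isDiffeoOntoImage_mul (by omega) a, hchart1.isDiffeoOntoImage_mul (by omega) b⟩
  · refine frontier_posCone_ae_eq (by omega) hchart.isOpen ?_ ?_
      (((thin_sq_mul_degenerate hn hlead hcount).union
        ((thin_degeneratePolys (hlead (n - 1)) hcount).mul_left (X - C a))).union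
        ((thin_degeneratePolys (hlead (n - 1)) hcount).mul_left (C b - X)))
    · rintro p ((hp | hp) | hp)
      · exact doubleRootPolys_nonneg hn hST hp
      · exact linear_mul_nonneg (by omega) da ha (by simp) hwa hp
      · exact linear_mul_nonneg (by omega) db hb (by simp) hwb hp
    · intro p hp
      rcases exists_root_or_coeff_eq_zero (hlead n) hp with ⟨t, ht, h0⟩ | ⟨h, -⟩
      · by_cases hti : t ∈ interior (Icc a b)
        · rcases mem_of_interior_root hn hp.1 hti h0 with h | h
          · exact Or.inl (Or.inl (Or.inl (doubleRootPolys_mono hiS _ h)))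
          · exact Or.inr (Or.inl (Or.inl h))
        · rcases hends ⟨ht, hti⟩ with rfl | htb
          · have hcl : t ∈ closure (Icc t b \ {t}) := by
              rw [Icc_sdiff_left, closure_Ioc hab.ne]
              exact ha
            rcases mem_of_linear_dvd (by omega) hp.1 (degree_X_sub_C t) hcl hwa
              (dvd_iff_isRoot.2 h0) with h | h
            · exact Or.inl (Or.inl (Or.inr h))
            · exact Or.inr (Or.inl (Or.inr h))
          · obtain rfl : t = b := htb
            have hcl : t ∈ closure (Icc a t \ {t}) := by
              rw [Icc_sdiff_right, closure_Ico hab.ne]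
              exact hb
            have hdvd : C t - X ∣ p := by
              rw [← neg_sub, neg_dvd]
              exact dvd_iff_isRoot.2 h0
            rcases mem_of_linear_dvd (by omega) hp.1 (degree_C_sub_X t) hcl hwb hdvd with h | h
            · exact Or.inl (Or.inr h)
            · exact Or.inr (Or.inr h)
      · exact absurd (Metric.isBounded_Icc a b) h
  · exact disjoint_image_coeffVec (natDegree_doubleRootPolys_le hn)
      (natDegree_linear_mul_le (by omega) da)
      fun p hp => doubleRootPolys_notMem_linear hST one_ne_zero ha (by simp) hp
  · exact disjoint_image_coeffVec (natDegree_doubleRootPolys_le hn)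
      (natDegree_linear_mul_le (by omega) db)
      fun p hp => doubleRootPolys_notMem_linear hST (by norm_num) hb (C_sub_X_eq b) hp
  · refine disjoint_image_coeffVec (natDegree_linear_mul_le (by omega) da)
      (natDegree_linear_mul_le (by omega) db) ?_
    rintro _ ⟨q, hq, rfl⟩ ⟨r, hr, h⟩
    -- At `a` the left piece vanishes, while `(b - a) r(a)` does not.
    have h1 := congrArg (eval a) h
    have := (hr.2.1 a ha).ne'
    simp [this, sub_eq_zero, hab.ne'] at h1

theorem boundary_Ici {n : ℕ} (hn : 2 ≤ n) (a : ℝ) {S : Set ℝ}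
    (hS : S = interior (Ici a) ∨ S = Ici a) :
    frontier (posCone (Ici a) n) =ᵐ[Measure.hausdorffMeasure (n : ℝ)]
        (doubleRootPiece (pIci a) (Ici a) S n ∪ leftPiece (pIci a) (Ici a) a n ∪
          lowDegreePiece (pIci a) (Ici a) n : Set (Coeffs n)) ∧
      Disjoint (doubleRootPiece (pIci a) (Ici a) S n) (leftPiece (pIci a) (Ici a) a n) ∧
      Disjoint (doubleRootPiece (pIci a) (Ici a) S n) (lowDegreePiece (pIci a) (Ici a) n) ∧
      Disjoint (leftPiece (pIci a) (Ici a) a n) (lowDegreePiece (pIci a) (Ici a) n) ∧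
      IsDiffeoOntoImage (phi (pIci a) n n) (dom (Ici a) n) ∧
      DoubleRootDiffeo (pIci a) (Ici a) S n ∧
      IsDiffeoOntoImage (fun x => phiRoot (pIci a) n 1 x a) (dom (Ici a) (n - 1)) ∧
      IsDiffeoOntoImage (phi (pIci a) n (n - 1)) (dom (Ici a) (n - 1)) := by
  have hST : S ⊆ Ici a := by
    rcases hS with rfl | rfl
    exacts [interior_subset, subset_rfl]
  have hiS : interior (Ici a) ⊆ S := by
    rcases hS with rfl | rfl
    exacts [subset_rfl, interior_subset]
  have ha : a ∈ Ici a := self_mem_Ici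
  have hns : ¬ Bornology.IsBounded (Ici a) := fun h => not_bddAbove_Ici (a := a) h.bddAbove
  have hchart := isChart_Ici a (k := n) (by omega)
  have hchart1 := isChart_Ici a (k := n - 1) (by omega)
  obtain ⟨hD, hDeq⟩ := doubleRoot_of_isChart (p := pIci a) hn isClosed_Ici ⟨a, ha⟩ hST
    fun h => isChart_Ici a (k := n - 2) (by omega)
  have hlow : lowDegreePiece (pIci a) (Ici a) n = coeffVec n '' PosPolys (Ici a) (n - 1) := by
    rw [← hchart1.bijOn.image_eq, image_image]
    rfl
  have hwa : ∀ t ∈ Ici a, t ≠ a → 0 < (X - C a : ℝ[X]).eval t := fun t ht hta => by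
    simpa using lt_of_le_of_ne ht hta.symm
  have da : (X - C a : ℝ[X]).natDegree ≤ 1 := natDegree_X_sub_C_le a
  have hlead : ∀ k, ∀ p ∈ NonnegPolys (Ici a) k, Bornology.IsBounded (Ici a) ∨ 0 ≤ p.coeff k :=
    fun k p hp => Or.inr (coeff_nonneg_of_nonneg hp)
  have hends : Ici a \ interior (Ici a) ⊆ {a} := by
    rintro t ⟨ht, hti⟩
    rw [interior_Ici, mem_Ioi, not_lt] at hti
    exact hti.antisymm ht
  have hcount : (Ici a \ interior (Ici a)).Countable := (countable_singleton a).mono hends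
  have hlowdeg : ∀ p ∈ PosPolys (Ici a) (n - 1), p.natDegree < n := fun p hp => by
    have := hp.1
    omega
  rw [hDeq, leftPiece_eq hchart1, hlow, ← image_union, ← image_union]
  refine ⟨?_, ?_, ?_, ?_, hchart.isDiffeoOntoImage le_rfl, hD,
    hchart1.isDiffeoOntoImage_mul (by omega) a, hchart1.isDiffeoOntoImage (by omega)⟩
  · refine frontier_posCone_ae_eq (by omega) hchart.isOpen ?_ ?_
      (((thin_sq_mul_degenerate hn hlead hcount).union
        ((thin_degeneratePolys (hlead (n - 1)) hcount).mul_left (X - C a))).union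
        (thin_degeneratePolys (hlead (n - 1)) hcount))
    · rintro p ((hp | hp) | hp)
      · exact doubleRootPolys_nonneg hn hST hp
      · exact linear_mul_nonneg (by omega) da ha (by simp) hwa hp
      · have hdeg := hlowdeg p hp
        exact ⟨⟨hdeg.le, fun t ht => (hp.2.1 t ht).le⟩,
          notMem_interior_of_coeff hdeg.le (coeff_eq_zero_of_natDegree_lt hdeg)⟩
    · intro p hp
      rcases exists_root_or_coeff_eq_zero (hlead n) hp with ⟨t, ht, h0⟩ | ⟨-, h0⟩
      · by_cases hti : t ∈ interior (Ici a)
        · rcases mem_of_interior_root hn hp.1 hti h0 with h | h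
          · exact Or.inl (Or.inl (Or.inl (doubleRootPolys_mono hiS _ h)))
          · exact Or.inr (Or.inl (Or.inl h))
        · obtain rfl : t = a := hends ⟨ht, hti⟩
          have hcl : t ∈ closure (Ici t \ {t}) := by
            rw [Ici_sdiff_left, closure_Ioi]
            exact ha
          rcases mem_of_linear_dvd (by omega) hp.1 (degree_X_sub_C t) hcl hwa
            (dvd_iff_isRoot.2 h0) with h | h
          · exact Or.inl (Or.inl (Or.inr h))
          · exact Or.inr (Or.inl (Or.inr h))
      -- A root at infinity: the polynomial itself, seen in degree `n - 1`, plays the part of the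
      -- quotient.
      · have hdeg : p.natDegree ≤ n - 1 := by
          have := (degree_lt_iff_coeff_zero p n).1 (degree_lt_of_coeff_eq_zero hp.1.1 h0)
          rw [natDegree_le_iff_coeff_eq_zero]
          exact fun m hm => this m (by omega)
        by_cases hpos : p ∈ PosPolys (Ici a) (n - 1)
        · exact Or.inl (Or.inr hpos)
        · exact Or.inr (Or.inr ⟨⟨hdeg, hp.1.2⟩, hpos⟩)
  · exact disjoint_image_coeffVec (natDegree_doubleRootPolys_le hn)
      (natDegree_linear_mul_le (by omega) da)
      fun p hp => doubleRootPolys_notMem_linear hST one_ne_zero ha (by simp) hp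
  · refine disjoint_image_coeffVec (natDegree_doubleRootPolys_le hn)
      (fun p hp => (hlowdeg p hp).le) ?_
    rintro _ ⟨γ, hγ, q, hq, rfl⟩ h
    have h1 := coeff_eq_zero_of_natDegree_lt (hlowdeg _ h)
    rw [coeff_sq_mul (by omega) γ hq.1] at h1
    exact (hq.2.2.resolve_left hns).ne' h1
  · refine disjoint_image_coeffVec (natDegree_linear_mul_le (by omega) da)
      (fun p hp => (hlowdeg p hp).le) ?_
    rintro _ ⟨q, hq, rfl⟩ h
    have h1 := coeff_eq_zero_of_natDegree_lt (hlowdeg _ h)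
    obtain ⟨m, rfl⟩ : ∃ m, n = m + 1 := ⟨n - 1, by omega⟩
    have hq1 : q.coeff (m + 1) = 0 := by
      apply coeff_eq_zero_of_natDegree_lt
      have := hq.1
      omega
    simp only [sub_mul, coeff_sub, coeff_X_mul, coeff_C_mul, hq1, mul_zero, sub_zero] at h1
    exact (hq.2.2.resolve_left hns).ne' h1

/-- A polynomial of odd degree is not nonnegative on the real line. -/
lemma coeff_eq_zero_of_nonneg_of_odd {k : ℕ} (hk : Odd k) {p : ℝ[X]} (hp : p ∈ NonnegPolys univ k) :
    p.coeff k = 0 := by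
  have h1 : 0 ≤ p.coeff k :=
    coeff_nonneg_of_nonneg (a := 0) ⟨hp.1, fun t _ => hp.2 t (mem_univ t)⟩
  -- Reflection preserves nonnegativity on the line and negates the coefficient of odd degree `k`.
  have h2 : 0 ≤ (p.comp (-X)).coeff k := by
    refine coeff_nonneg_of_nonneg (a := 0) ⟨?_, fun t _ => ?_⟩
    · rw [natDegree_comp, natDegree_neg, natDegree_X, mul_one]
      exact hp.1
    · rw [eval_comp]
      exact hp.2 _ (mem_univ _)
  by_contra h0
  have hdeg : p.natDegree = k := hp.1.antisymm (le_natDegree_of_ne_zero h0)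
  have hlead := comp_neg_X_leadingCoeff_eq p
  rw [leadingCoeff, leadingCoeff, natDegree_comp, natDegree_neg, natDegree_X, mul_one, hdeg,
    hk.neg_one_pow] at hlead
  exact h0 (by linarith)

/-- There is no piece at infinity here: for even `n`, losing the leading coefficient also kills the
next one, which leaves only `n - 1` parameters, a null set. -/
theorem boundary_univ {n : ℕ} (hn : 2 ≤ n) (heven : Even n) :
    frontier (posCone univ n) =ᵐ[Measure.hausdorffMeasure (n : ℝ)]
        (doubleRootPiece pUniv univ univ n : Set (Coeffs n)) ∧
      IsDiffeoOntoImage (phi pUniv n n) (dom univ n) ∧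
      DoubleRootDiffeo pUniv univ univ n := by
  have hchart := isChart_univ heven hn
  obtain ⟨hD, hDeq⟩ := doubleRoot_of_isChart (p := pUniv) hn isClosed_univ univ_nonempty
    subset_rfl fun h => isChart_univ (k := n - 2) (by grind) (by grind)
  have hlead : ∀ k, ∀ p ∈ NonnegPolys univ k, Bornology.IsBounded (univ : Set ℝ) ∨ 0 ≤ p.coeff k :=
    fun k p hp => Or.inr
      (coeff_nonneg_of_nonneg (a := 0) ⟨hp.1, fun t _ => hp.2 t (mem_univ t)⟩)
  have hcount : (univ \ interior univ : Set ℝ).Countable := by simp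
  rw [hDeq]
  refine ⟨?_, hchart.isDiffeoOntoImage le_rfl, hD⟩
  refine frontier_posCone_ae_eq (by omega) hchart.isOpen
    (fun p hp => doubleRootPolys_nonneg hn subset_rfl hp) ?_
    ((thin_sq_mul_degenerate hn hlead hcount).union (thin_degree_lt (n - 1)))
  intro p hp
  rcases exists_root_or_coeff_eq_zero (hlead n) hp with ⟨t, ht, h0⟩ | ⟨-, h0⟩
  · rcases mem_of_interior_root hn hp.1 (by simp) h0 with h | h
    · exact Or.inl (doubleRootPolys_mono (subset_univ _) _ h)
    · exact Or.inr (Or.inl h)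
  · have hdeg : p.natDegree ≤ n - 1 := by
      have := (degree_lt_iff_coeff_zero p n).1 (degree_lt_of_coeff_eq_zero hp.1.1 h0)
      rw [natDegree_le_iff_coeff_eq_zero]
      exact fun m hm => this m (by omega)
    refine Or.inr (Or.inr (degree_lt_of_coeff_eq_zero hdeg ?_))
    exact coeff_eq_zero_of_nonneg_of_odd (by grind) ⟨hdeg, hp.1.2⟩

end PosPoly

end

theorem mainTheorem6 (n : ℕ) (hn : 2 ≤ n) :
    -- the case `T = [a, b]`
    (∀ (a b : ℝ), a < b → ∀ S : Set ℝ, S = interior (Icc a b) ∨ S = Icc a b →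
      frontier (posCone (Icc a b) n) =ᵐ[Measure.hausdorffMeasure (n : ℝ)]
          (doubleRootPiece (pIcc a b) (Icc a b) S n ∪ leftPiece (pIcc a b) (Icc a b) a n ∪
            rightPiece (pIcc a b) (Icc a b) b n : Set (Coeffs n)) ∧
        Disjoint (doubleRootPiece (pIcc a b) (Icc a b) S n)
          (leftPiece (pIcc a b) (Icc a b) a n) ∧
        Disjoint (doubleRootPiece (pIcc a b) (Icc a b) S n)
          (rightPiece (pIcc a b) (Icc a b) b n) ∧
        Disjoint (leftPiece (pIcc a b) (Icc a b) a n)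
          (rightPiece (pIcc a b) (Icc a b) b n) ∧
        IsDiffeoOntoImage (phi (pIcc a b) n n) (dom (Icc a b) n) ∧
        DoubleRootDiffeo (pIcc a b) (Icc a b) S n ∧
        IsDiffeoOntoImage (fun x => phiRoot (pIcc a b) n 1 x a) (dom (Icc a b) (n - 1)) ∧
        IsDiffeoOntoImage (fun x => phiRoot (pIcc a b) n 1 x b) (dom (Icc a b) (n - 1))) ∧
    -- the case `T = [a, ∞)`
    (∀ (a : ℝ), ∀ S : Set ℝ, S = interior (Ici a) ∨ S = Ici a →
      frontier (posCone (Ici a) n) =ᵐ[Measure.hausdorffMeasure (n : ℝ)]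
          (doubleRootPiece (pIci a) (Ici a) S n ∪ leftPiece (pIci a) (Ici a) a n ∪
            lowDegreePiece (pIci a) (Ici a) n : Set (Coeffs n)) ∧
        Disjoint (doubleRootPiece (pIci a) (Ici a) S n)
          (leftPiece (pIci a) (Ici a) a n) ∧
        Disjoint (doubleRootPiece (pIci a) (Ici a) S n)
          (lowDegreePiece (pIci a) (Ici a) n) ∧
        Disjoint (leftPiece (pIci a) (Ici a) a n)
          (lowDegreePiece (pIci a) (Ici a) n) ∧
        IsDiffeoOntoImage (phi (pIci a) n n) (dom (Ici a) n) ∧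
        DoubleRootDiffeo (pIci a) (Ici a) S n ∧
        IsDiffeoOntoImage (fun x => phiRoot (pIci a) n 1 x a) (dom (Ici a) (n - 1)) ∧
        IsDiffeoOntoImage (phi (pIci a) n (n - 1)) (dom (Ici a) (n - 1))) ∧
    -- the case `T = (-∞, ∞)`
    (Even n →
      frontier (posCone univ n) =ᵐ[Measure.hausdorffMeasure (n : ℝ)]
          (doubleRootPiece pUniv univ univ n : Set (Coeffs n)) ∧
        IsDiffeoOntoImage (phi pUniv n n) (dom univ n) ∧
        DoubleRootDiffeo pUniv univ univ n) := by
  exact ⟨fun a b hab S hS => boundary_Icc hn hab hS, fun a S hS => boundary_Ici hn a hS,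
    fun heven => boundary_univ hn heven⟩
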